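/- **Setting.** Let $\hat\Gamma$ be a finite $n$-player extensive-form game with chance and perfect recall, with utilities $\hat u_i:\hat Z\to[0,1]$, and let $\hat u_0:\hat Z\to[0,1]$ be a mediator objective. Let $\Gamma$ be the mediator-augmented game with the extra Player $0$ (the mediator, who has perfect information): at every decision node of a player $i$, the mediator first recommends one of the legal actions to $i$, who privately observes it and then chooses an action; once two players have disobeyed a recommendation, no further recommendations are given. Utilities of $\Gamma$ (including $u_0$) are those of the underlying terminal node of $\hat\Gamma$. Let $Z$ be the set of terminal nodes of $\Gamma$, let $\Sigma_i$ be the set of sequences of Player $i$ at terminal nodes, and let $X_i\subset[0,1]^{\Sigma_i}$ be the polytope of sequence-form mixed strategies; write $x_i[z]$ for the entry of $x_i$ at the sequence of $z$, and $\hat x[z]=\prod_{i=1}^n x_i[z]$. Let $d_i\in X_i$ be a direct strategy: a pure strategy that follows every recommendation (arbitrary where none is given). Let $d_i\in Y_i\subseteq X_i$ for $i=1,\dots,n$, and $Y=Y_1\times\dots\times Y_n$. An *equilibrium against $Y$* is a $\mu\in X_0$ with $u_i(\mu,y_i,d_{-i})\le u_i(\mu,d)$ for all $i$ and $y_i\in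 Y_i$; it is *optimal* if it maximizes $u_0(\mu,d)$ among these, and $u_0^*$ is the maximum. Call $\lambda^*\ge 0$ *exact for $Y$* if for every $\lambda\ge\lambda^*$ the solutions $\mu$ of $$\max_{\mu\in X_0}\ \inf_{x\in Y}\ u_0(\mu,d)-\lambda\sum_{i=1}^n\bigl[u_i(\mu,x_i,d_{-i})-u_i(\mu,d)\bigr]\qquad(*)$$ are exactly the optimal equilibria against $Y$. **OnlineSteer** with hyperparameters $\alpha,\lambda$ (which does not use $Y$): in round $t=1,\dots,T$ the mediator plays $\mu^{(t)}\in X_0$ and offers Player $i$ the payment $$p_i^{(t)}(x_i,x_{-i})=\alpha\, d_i^\top x_i+\bigl[u_i(\mu^{(t)},x_i,d_{-i})-u_i(\mu^{(t)},x_i,x_{-i})\bigr]-\min_{x_i'\in X_i}\bigl[u_i(\mu^{(t)},x_i',d_{-i})-u_i(\mu^{(t)},x_i',x_{-i})\bigr];$$ the players choose $x_i^{(t)}\in Y_i$; and the mediator's regret minimizer receives the utility $\mu\mapsto\frac1\lambda u_0(\mu,d)-\sum_i[u_i(\mu,x_i^{(t)},d_{-i})-u_i(\mu,d)]$. The mediator's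 regret over $X_0$ after $T$ rounds is at most $R_0(T)$. The regret of each Player $i$ over $Y_i$, with respect to $v_i^{(t)}(y)=u_i(\mu^{(t)},y,x_{-i}^{(t)})+p_i^{(t)}(y,x_{-i}^{(t)})$ and normalized by the factor $\frac14=\frac1{P+1}$ with $P=3$, is at most $R(T)$. **Claim.** 1. If every $Y_i$ has the same convex hull as some finite set (for example, $Y_i$ is finite or a polytope, such as $Y_i=X_i$), then an exact $\lambda^*$ for $Y$ exists. 2. Let $\lambda^*$ be exact for $Y$. Then an optimal equilibrium against $Y$ exists, so $u_0^*$ is well defined. Let $\varepsilon=(R_0(T)+4nR(T))/T>0$, $\alpha=\varepsilon^{2/3}|Z|^{-1/3}$, $\lambda=|Z|^{2/3}\varepsilon^{-1/3}$, and suppose that $\alpha\le 1/|Z|$. Then in every run of OnlineSteer with these hyperparameters, the average realized payment $\frac1T\sum_t p_i^{(t)}(x^{(t)})$ to each Player $i$, the directness gap $\sum_{z\in Z}\bigl|\frac1T\sum_t\hat x^{(t)}[z]-\hat d[z]\bigr|$, and the optimality gap $u_0^*-\frac1T\sum_t u_0(\mu^{(t)},x^{(t)})$ are all at most $$7\,\max\{1,\lambda^*\}\,|Z|^{4/3}\,\varepsilon^{1/3}.$$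 -/

import Mathlib

noncomputable section

/-- A finite extensive-form game with player set `P`, action labels `A` and information-set labels
`I`. A node of the tree is the list of the actions that lead to it, the most recent action first,
so that `[]` is the root and `a :: h` is the child of `h` along the edge labelled `a`. The values
of `turn`, `info`, `chance` and `utility` matter only at the nodes indicated by the laws. -/
structure ExtensiveGame (P A I : Type*) [Fintype A] where
  hist : Set (List A)
  finite_hist : hist.Finite
  nil_mem : [] ∈ hist
  tail_mem : ∀ a h, a :: h ∈ hist → h ∈ hist
  /-- The player who moves at a non-terminal node; `none` stands for chance. -/
  turn : List A → Option P
  /-- Two decision nodes of a player are in the same information set iff they have equal labels. -/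
  info : List A → I
  /-- Nodes of the same information set have the same legal actions. -/
  info_legal : ∀ h ∈ hist, ∀ h' ∈ hist, (∃ a, a :: h ∈ hist) → (∃ a, a :: h' ∈ hist) →
    ∀ i, turn h = some i → turn h' = some i → info h = info h' →
      ∀ a, a :: h ∈ hist ↔ a :: h' ∈ hist
  /-- `chance h a` is the probability of the action `a` at the chance node `h`. -/
  chance : List A → A → ℝ
  chance_nonneg : ∀ h ∈ hist, turn h = none → ∀ a, a :: h ∈ hist → 0 ≤ chance h a
  chance_sum : ∀ h ∈ hist, turn h = none → (∃ a, a :: h ∈ hist) →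
    ∑ᶠ a ∈ {a | a :: h ∈ hist}, chance h a = 1
  utility : P → List A → ℝ
  utility_mem : ∀ i, ∀ h ∈ hist, (∀ a, a :: h ∉ hist) → utility i h ∈ Set.Icc (0 : ℝ) 1

namespace ExtensiveGame

variable {P A I : Type*} [Fintype A]

/-! ### Sequences, strategies, utilities -/

open Classical in
/-- The set `Z` of terminal nodes. -/
def terminals (G : ExtensiveGame P A I) : Finset (List A) :=
  G.finite_hist.toFinset.filter fun h => ∀ a, a :: h ∉ G.hist

/-- The type of terminal nodes. -/
abbrev Leaf (G : ExtensiveGame P A I) : Type _ := {z // z ∈ G.terminals}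

open Classical in
/-- The sequence `σ_i(h)`: the information sets of `i` met on the path to `h` (excluding `h`) with
the actions that `i` played there, the most recent first. -/
def seq (G : ExtensiveGame P A I) (i : P) : List A → List (I × A)
  | [] => []
  | a :: h => if G.turn h = some i then (G.info h, a) :: G.seq i h else G.seq i h

/-- Player `i` has perfect recall. -/
def PerfectRecall (G : ExtensiveGame P A I) (i : P) : Prop :=
  ∀ h ∈ G.hist, ∀ h' ∈ G.hist, (∃ a, a :: h ∈ G.hist) → (∃ a, a :: h' ∈ G.hist) →
    G.turn h = some i → G.turn h' = some i → G.info h = G.info h' → G.seq i h = G.seq i h'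

open Classical in
/-- The set `Σ_i` of the sequences of player `i` at terminal nodes. -/
def seqs (G : ExtensiveGame P A I) (i : P) : Finset (List (I × A)) :=
  G.terminals.image (G.seq i)

/-- The type of terminal sequences; sequence-form strategies are vectors indexed by it. -/
abbrev Seq (G : ExtensiveGame P A I) (i : P) : Type _ := {σ // σ ∈ G.seqs i}

/-- The terminal sequence `σ_i(z)`. -/
def leafSeq (G : ExtensiveGame P A I) (i : P) (z : G.Leaf) : G.Seq i :=
  ⟨G.seq i z.1, by classical exact Finset.mem_image_of_mem _ z.2⟩

/-- `s` is a pure strategy of `i`: it selects a legal action at each information set of `i`. -/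
def IsPure (G : ExtensiveGame P A I) (i : P) (s : I → A) : Prop :=
  ∀ h ∈ G.hist, (∃ a, a :: h ∈ G.hist) → G.turn h = some i → s (G.info h) :: h ∈ G.hist

open Classical in
/-- The sequence form of a pure strategy. -/
def seqForm (G : ExtensiveGame P A I) (i : P) (s : I → A) : G.Seq i → ℝ :=
  fun σ => if ∀ p ∈ σ.1, s p.1 = p.2 then 1 else 0

/-- The polytope `X_i` of sequence-form mixed strategies of player `i`. -/
def strategies (G : ExtensiveGame P A I) (i : P) : Set (G.Seq i → ℝ) :=
  convexHull ℝ (G.seqForm i '' {s | G.IsPure i s})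

open Classical in
/-- The product of the probabilities of the chance actions on the path to a node. -/
def chanceReach (G : ExtensiveGame P A I) : List A → ℝ
  | [] => 1
  | a :: h => (if G.turn h = none then G.chance h a else 1) * G.chanceReach h

/-- The expected utility `u_i(x)` under a profile of sequence-form mixed strategies: the terminal
node `z` is reached with probability `chanceReach z * ∏ j, x j [z]`. -/
def expUtility [Fintype P] (G : ExtensiveGame P A I) (i : P) (x : ∀ j, G.Seq j → ℝ) : ℝ :=
  ∑ z : G.Leaf, (G.chanceReach z.1 * ∏ j, x j (G.leafSeq j z)) * G.utility i z.1

/-! ### The mediator-augmented game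

A letter `Sum.inl a` of the augmented game is the action `a` of the original game being played,
and `Sum.inr r` is the mediator recommending the action `r` to the player about to move. -/

/-- The underlying node of the original game. -/
def base : List (A ⊕ A) → List A
  | [] => []
  | .inl a :: g => a :: base g
  | .inr _ :: g => base g

/-- The recommendation that has just been given and not yet been answered, if there is one. -/
def pending : List (A ⊕ A) → Option A
  | .inr r :: _ => some r
  | _ => none

open Classical in
/-- The set of players who have disobeyed a recommendation so far. -/
def deviators (G : ExtensiveGame P A I) : List (A ⊕ A) → Finset P
  | [] => ∅
  | .inr _ :: g => G.deviators g
  | .inl a :: g =>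
      if ∃ r, pending g = some r ∧ r ≠ a then (G.turn (base g)).toFinset ∪ G.deviators g
      else G.deviators g

/-- It is the mediator's turn to recommend: a player is to move, has not yet been given a
recommendation at this point, and at most one player has disobeyed so far. -/
def MediatorMoves (G : ExtensiveGame P A I) (g : List (A ⊕ A)) : Prop :=
  pending g = none ∧ G.turn (base g) ≠ none ∧ (G.deviators g).card < 2

/-- The nodes of the augmented game. -/
def AugHist (G : ExtensiveGame P A I) : List (A ⊕ A) → Prop
  | [] => True
  | .inl a :: g => G.AugHist g ∧ ¬ G.MediatorMoves g ∧ a :: base g ∈ G.hist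
  | .inr r :: g => G.AugHist g ∧ G.MediatorMoves g ∧ r :: base g ∈ G.hist

open Classical in
/-- The recommendations given so far at nodes with mover `o`, the most recent first. -/
def heard (G : ExtensiveGame P A I) (o : Option P) : List (A ⊕ A) → List A
  | [] => []
  | .inl _ :: g => G.heard o g
  | .inr r :: g => if G.turn (base g) = o then r :: G.heard o g else G.heard o g

open Classical in
/-- The mover in the augmented game; the mediator is the new player `none`. -/
def augTurn (G : ExtensiveGame P A I) (g : List (A ⊕ A)) : Option (Option P) :=
  if G.MediatorMoves g then some none else (G.turn (base g)).map some

open Classical in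
/-- Information labels of the augmented game. The mediator has perfect information; a player sees
the original information set, the current recommendation (if any) and the earlier recommendations
given to that player. -/
def augInfo (G : ExtensiveGame P A I) (g : List (A ⊕ A)) :
    List (A ⊕ A) ⊕ (I × Option A × List A) :=
  if G.MediatorMoves g then .inl g
  else .inr (G.info (base g), pending g, G.heard (G.turn (base g)) g)

theorem AugHist.base_mem {G : ExtensiveGame P A I} :
    ∀ {g : List (A ⊕ A)}, G.AugHist g → base g ∈ G.hist
  | [], _ => G.nil_mem
  | .inl _ :: _, h => h.2.2
  | .inr _ :: _, h => h.1.base_mem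

theorem AugHist.length_le {G : ExtensiveGame P A I} :
    ∀ {g : List (A ⊕ A)}, G.AugHist g →
      g.length ≤ 2 * (base g).length + (if pending g = none then 0 else 1)
  | [], _ => by simp
  | .inl _ :: g, h => by
      have := h.1.length_le
      simp only [List.length_cons, base, pending]
      split_ifs at this <;> simp <;> omega
  | .inr _ :: g, h => by
      have := h.1.length_le
      rw [if_pos h.2.1.1] at this
      simp only [List.length_cons, base, pending]
      simpa using this

theorem finite_augHist (G : ExtensiveGame P A I) : {g | G.AugHist g}.Finite := by
  obtain ⟨N, hN⟩ := (G.finite_hist.image List.length).bddAbove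
  refine (List.finite_length_le (A ⊕ A) (2 * N + 1)).subset fun g hg => ?_
  have h1 := AugHist.length_le hg
  have h2 : (base g).length ≤ N := hN ⟨_, AugHist.base_mem hg, rfl⟩
  simp only [Set.mem_ofPred_eq]
  split_ifs at h1 <;> omega

/-- The mediator-augmented game of `G`, in which the mediator has the objective `u₀`. -/
def augment (G : ExtensiveGame P A I) (u₀ : List A → ℝ)
    (hu₀ : ∀ h ∈ G.hist, (∀ a, a :: h ∉ G.hist) → u₀ h ∈ Set.Icc (0 : ℝ) 1) :
    ExtensiveGame (Option P) (A ⊕ A) (List (A ⊕ A) ⊕ (I × Option A × List A)) where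
  hist := {g | G.AugHist g}
  finite_hist := G.finite_augHist
  nil_mem := trivial
  tail_mem := by
    rintro (a | r) g h
    · exact h.1
    · exact h.1
  turn := G.augTurn
  info := G.augInfo
  info_legal := by
    intro g hg g' hg' hne hne' i hi hi' hinfo l
    by_cases hm : G.MediatorMoves g <;> by_cases hm' : G.MediatorMoves g'
    · simp only [augInfo, hm, hm', if_true, Sum.inl.injEq] at hinfo
      rw [hinfo]
    · simp [augInfo, hm, hm'] at hinfo
    · simp [augInfo, hm, hm'] at hinfo
    · simp only [augInfo, hm, hm', if_false, Sum.inr.injEq, Prod.mk.injEq] at hinfo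
      simp only [augTurn, hm, hm', if_false, Option.map_eq_some_iff] at hi hi'
      obtain ⟨j, hj, rfl⟩ := hi
      obtain ⟨j', hj', hjj⟩ := hi'
      obtain rfl : j' = j := by simpa using hjj
      have key : ∀ {g : List (A ⊕ A)}, ¬ G.MediatorMoves g → (∃ l, l :: g ∈ {g | G.AugHist g}) →
          ∃ a, a :: base g ∈ G.hist := by
        rintro g hm ⟨a | r, h⟩
        · exact ⟨a, h.2.2⟩
        · exact absurd h.2.1 hm
      have := G.info_legal _ (AugHist.base_mem hg) _ (AugHist.base_mem hg') (key hm hne)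
        (key hm' hne') j' hj hj' hinfo.1
      rcases l with a | r
      · exact ⟨fun h => ⟨hg', hm', (this a).1 h.2.2⟩, fun h => ⟨hg, hm, (this a).2 h.2.2⟩⟩
      · exact ⟨fun h => absurd h.2.1 hm, fun h => absurd h.2.1 hm'⟩
  chance g l := Sum.elim (G.chance (base g)) (fun _ => 0) l
  chance_nonneg := by
    intro g hg ht l hl
    have hm : ¬ G.MediatorMoves g := fun hm => by simp [augTurn, hm] at ht
    simp only [augTurn, hm, if_false, Option.map_eq_none_iff] at ht
    rcases l with a | r
    · exact G.chance_nonneg _ (AugHist.base_mem hg) ht a hl.2.2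
    · exact le_rfl
  chance_sum := by
    intro g hg ht hne
    have hm : ¬ G.MediatorMoves g := fun hm => by simp [augTurn, hm] at ht
    simp only [augTurn, hm, if_false, Option.map_eq_none_iff] at ht
    have hset : {l | l :: g ∈ {g | G.AugHist g}} = Sum.inl '' {a | a :: base g ∈ G.hist} := by
      ext l
      rcases l with a | r
      · simpa using ⟨fun h => h.2.2, fun h => ⟨hg, hm, h⟩⟩
      · simpa using fun h : G.AugHist (Sum.inr r :: g) => hm h.2.1
    have hne' : ∃ a, a :: base g ∈ G.hist := by
      obtain ⟨l, hl⟩ := hne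
      have : l ∈ Sum.inl '' {a | a :: base g ∈ G.hist} := hset ▸ hl
      obtain ⟨a, ha, -⟩ := this
      exact ⟨a, ha⟩
    rw [hset, finsum_mem_image Sum.inl_injective.injOn]
    exact G.chance_sum _ (AugHist.base_mem hg) ht hne'
  utility i g := i.elim (u₀ (base g)) fun j => G.utility j (base g)
  utility_mem := by
    intro i g hg hterm
    have hbase : ∀ a, a :: base g ∉ G.hist := by
      intro a ha
      by_cases hm : G.MediatorMoves g
      · exact hterm (.inr a) ⟨hg, hm, ha⟩
      · exact hterm (.inl a) ⟨hg, hm, ha⟩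
    cases i with
    | none => exact hu₀ _ (AugHist.base_mem hg) hbase
    | some j => exact G.utility_mem j _ (AugHist.base_mem hg) hbase

/-! ### Mediated games: equilibria, saddle points and online steering

From here on `M` is a game whose player `none` is the mediator, and `d` is the profile of the
players' direct strategies, in sequence form. -/

/-- `s` is a direct strategy of player `i` in the augmented game of `G`: a pure strategy that
follows every recommendation. (It is unconstrained where no recommendation is given.) -/
def IsDirect (G : ExtensiveGame P A I) (u₀ : List A → ℝ)
    (hu₀ : ∀ h ∈ G.hist, (∀ a, a :: h ∉ G.hist) → u₀ h ∈ Set.Icc (0 : ℝ) 1) (i : P)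
    (s : List (A ⊕ A) ⊕ (I × Option A × List A) → A ⊕ A) : Prop :=
  (G.augment u₀ hu₀).IsPure (some i) s ∧
    ∀ g, G.AugHist g → G.turn (base g) = some i → ∀ r, pending g = some r →
      s (G.augInfo g) = .inl r

variable [Fintype P] [DecidableEq P]

/-- The profile in which the mediator plays `μ` and the players play `x`. -/
def withMediator (M : ExtensiveGame (Option P) A I) (μ : M.Seq none → ℝ)
    (x : ∀ i : P, M.Seq (some i) → ℝ) : ∀ j : Option P, M.Seq j → ℝ
  | none => μ
  | some i => x i

/-- The utility `u_j(μ, x)` of `j`, where `j = none` is the mediator. -/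
def util (M : ExtensiveGame (Option P) A I) (j : Option P) (μ : M.Seq none → ℝ)
    (x : ∀ i : P, M.Seq (some i) → ℝ) : ℝ :=
  M.expUtility j (M.withMediator μ x)

/-- The gain `u_i(μ, y, d_{-i}) - u_i(μ, d)` of player `i` from a deviation `y`. -/
def gain (M : ExtensiveGame (Option P) A I) (d : ∀ i : P, M.Seq (some i) → ℝ) (i : P)
    (μ : M.Seq none → ℝ) (y : M.Seq (some i) → ℝ) : ℝ :=
  M.util (some i) μ (Function.update d i y) - M.util (some i) μ d

/-- `μ` is an equilibrium against the deviation sets `Y`: no player can gain by a unilateral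
deviation from the direct profile to a strategy in `Y i`. -/
def IsEquilibrium (M : ExtensiveGame (Option P) A I) (d : ∀ i : P, M.Seq (some i) → ℝ)
    (Y : ∀ i : P, Set (M.Seq (some i) → ℝ)) (μ : M.Seq none → ℝ) : Prop :=
  μ ∈ M.strategies none ∧ ∀ i, ∀ y ∈ Y i, M.gain d i μ y ≤ 0

/-- `μ` is an equilibrium against `Y` that maximizes the mediator's objective `u_0(μ, d)`. -/
def IsOptimalEquilibrium (M : ExtensiveGame (Option P) A I)
    (d : ∀ i : P, M.Seq (some i) → ℝ) (Y : ∀ i : P, Set (M.Seq (some i) → ℝ))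
    (μ : M.Seq none → ℝ) : Prop :=
  M.IsEquilibrium d Y μ ∧ ∀ ν, M.IsEquilibrium d Y ν → M.util none ν d ≤ M.util none μ d

/-- The objective of the saddle-point problem with multiplier `lam`. -/
def lagrangian (M : ExtensiveGame (Option P) A I) (d : ∀ i : P, M.Seq (some i) → ℝ) (lam : ℝ)
    (μ : M.Seq none → ℝ) (x : ∀ i : P, M.Seq (some i) → ℝ) : ℝ :=
  M.util none μ d - lam * ∑ i, M.gain d i μ (x i)

/-- `μ` is a solution of `max_{μ ∈ X_0} min_{x ∈ Y} lagrangian μ x`. -/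
def IsSaddleSolution (M : ExtensiveGame (Option P) A I) (d : ∀ i : P, M.Seq (some i) → ℝ)
    (Y : ∀ i : P, Set (M.Seq (some i) → ℝ)) (lam : ℝ) (μ : M.Seq none → ℝ) : Prop :=
  μ ∈ M.strategies none ∧ ∀ ν ∈ M.strategies none,
    sInf (M.lagrangian d lam ν '' Set.univ.pi Y) ≤ sInf (M.lagrangian d lam μ '' Set.univ.pi Y)

/-- For every multiplier `lam ≥ lamStar`, the solutions of the saddle-point problem over `Y` are
exactly the optimal equilibria against `Y`. -/
def IsExactMultiplier (M : ExtensiveGame (Option P) A I) (d : ∀ i : P, M.Seq (some i) → ℝ)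
    (Y : ∀ i : P, Set (M.Seq (some i) → ℝ)) (lamStar : ℝ) : Prop :=
  0 ≤ lamStar ∧ ∀ lam, lamStar ≤ lam → ∀ μ,
    M.IsSaddleSolution d Y lam μ ↔ M.IsOptimalEquilibrium d Y μ

/-- The sandboxing term `u_i(y, d_{-i}) - u_i(y, x_{-i})` in the game with the mediator's strategy
fixed to `μ`. -/
def sandbox (M : ExtensiveGame (Option P) A I) (d : ∀ i : P, M.Seq (some i) → ℝ) (i : P)
    (μ : M.Seq none → ℝ) (x : ∀ i : P, M.Seq (some i) → ℝ) (y : M.Seq (some i) → ℝ) : ℝ :=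
  M.util (some i) μ (Function.update d i y) - M.util (some i) μ (Function.update x i y)

/-- The payment `p_i(y, x_{-i})` to player `i` for playing `y` against `x_{-i}`, in the game with
the mediator's strategy fixed to `μ`. The minimum is over all of `X_i`. -/
def payment (M : ExtensiveGame (Option P) A I) (d : ∀ i : P, M.Seq (some i) → ℝ) (α : ℝ) (i : P)
    (μ : M.Seq none → ℝ) (x : ∀ i : P, M.Seq (some i) → ℝ) (y : M.Seq (some i) → ℝ) : ℝ :=
  α * (∑ σ, d i σ * y σ) + M.sandbox d i μ x y
    - sInf (M.sandbox d i μ x '' M.strategies (some i))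

/-- The utility with payments, `v_i(y) = u_i(y, x_{-i}) + p_i(y, x_{-i})`. -/
def paidUtil (M : ExtensiveGame (Option P) A I) (d : ∀ i : P, M.Seq (some i) → ℝ) (α : ℝ) (i : P)
    (μ : M.Seq none → ℝ) (x : ∀ i : P, M.Seq (some i) → ℝ) (y : M.Seq (some i) → ℝ) : ℝ :=
  M.util (some i) μ (Function.update x i y) + M.payment d α i μ x y

/-- The utility `μ ↦ u_0(μ, d) / lam - ∑ i, (u_i(μ, x_i, d_{-i}) - u_i(μ, d))` that is passed to
the mediator's regret minimizer. -/
def mediatorReward (M : ExtensiveGame (Option P) A I) (d : ∀ i : P, M.Seq (some i) → ℝ) (lam : ℝ)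
    (x : ∀ i : P, M.Seq (some i) → ℝ) (μ : M.Seq none → ℝ) : ℝ :=
  1 / lam * M.util none μ d - ∑ i, M.gain d i μ (x i)

/-- `T` rounds of online steering with hyperparameters `α` and `lam`, against players who choose
from the sets `Y i`: in round `t` the mediator plays `μ t` and the players play `x t`. The regret
of each player with respect to `Y i` is at most `R`, where utilities (with payments) are normalized
by `1 / (3 + 1)` since payments lie in `[0, 3]`; the regret of the mediator is at most `R₀`. -/
structure IsOnlineSteer (M : ExtensiveGame (Option P) A I) (d : ∀ i : P, M.Seq (some i) → ℝ)
    (Y : ∀ i : P, Set (M.Seq (some i) → ℝ)) (α lam : ℝ) (T : ℕ) (R R₀ : ℝ)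
    (μ : ℕ → M.Seq none → ℝ) (x : ℕ → ∀ i : P, M.Seq (some i) → ℝ) : Prop where
  mediator_mem : ∀ t < T, μ t ∈ M.strategies none
  player_mem : ∀ t < T, ∀ i, x t i ∈ Y i
  player_regret : ∀ i, ∀ y ∈ Y i,
    1 / (3 + 1) * (∑ t ∈ Finset.range T, M.paidUtil d α i (μ t) (x t) y
      - ∑ t ∈ Finset.range T, M.paidUtil d α i (μ t) (x t) (x t i)) ≤ R
  mediator_regret : ∀ ν ∈ M.strategies none,
    ∑ t ∈ Finset.range T, M.mediatorReward d lam (x t) ν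
      - ∑ t ∈ Finset.range T, M.mediatorReward d lam (x t) (μ t) ≤ R₀

/-- The average realized payment to player `i`. -/
def avgPayment (M : ExtensiveGame (Option P) A I) (d : ∀ i : P, M.Seq (some i) → ℝ) (α : ℝ)
    (T : ℕ) (μ : ℕ → M.Seq none → ℝ) (x : ℕ → ∀ i : P, M.Seq (some i) → ℝ) (i : P) : ℝ :=
  1 / (T : ℝ) * ∑ t ∈ Finset.range T, M.payment d α i (μ t) (x t) (x t i)

/-- The directness gap `‖(1/T) ∑ t, x̂ t - d̂‖₁`, where `x̂[z] = ∏ i, x i [z]` is the product over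
the players other than the mediator. -/
def directnessGap (M : ExtensiveGame (Option P) A I) (d : ∀ i : P, M.Seq (some i) → ℝ)
    (T : ℕ) (x : ℕ → ∀ i : P, M.Seq (some i) → ℝ) : ℝ :=
  ∑ z : M.Leaf, |1 / (T : ℝ) * ∑ t ∈ Finset.range T, ∏ i, x t i (M.leafSeq (some i) z)
    - ∏ i, d i (M.leafSeq (some i) z)|

end ExtensiveGame

end

/-! Part 1 is exact penalization for a linear program. When the deviation sets have polyhedral
hulls, finding an optimal equilibrium is a linear program over the vertices of `X_0`. Farkas' lemma
yields nonnegative weights, with sum Λ, such that any excess of u_0(μ, d) over the optimum is at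
most a weighted sum of deviation gains at μ (`exists_penalty`). With a multiplier above Λ a mediator
loses strictly by leaving a profitable deviation open, so the saddle solutions are the optimal
equilibria (`exists_isExactMultiplier`).

This needs an equilibrium to exist (`exists_isEquilibrium_augment`). If there is none, Gordan's
theorem gives weights on the pure deviations whose weighted gain is positive against every vertex of
`X_0`, in particular against the mediator who recommends a fixed profile σ of pure strategies.
Against that mediator a deviation of one player acts as a self-map of that player's pure strategies
in the original game; perfect recall is used here. Following Hart and Schmeidler, let each player's
strategy be drawn independently from a stationary distribution of the weighted self-maps. Then the
weighted gain averages to zero, a contradiction.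

For Part 2, measure the departure from directness by the loss ∑_i d_i^⊤(d_i - x_i). The payments
make Player i's incentive equal to the directness bonus plus the gain against direct opponents.
Adding the mediator's regret to all players' regrets cancels the realized gains
(`IsOnlineSteer.combined`): with μ̄ the average of the mediator's strategies and l the average loss,
every y ∈ Y satisfies α (l - loss(y)) + (u_0^* - u_0(μ̄, d))/λ + ∑_i gain_i(μ̄, y_i) ≤ ε. Put w =
u_0(μ̄, d) - u_0^*. Taking y = d bounds α l by ε + w/λ. Taking all y bounds the gains at μ̄, so
exactness of λ^* yields w ≤ λ^*(ε + w/λ + αD), where D bounds the loss. If λ ≥ 2λ^*, the w on the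
right is absorbed, and l ≤ 6 max{1, λ^*} b with b = (|Z|ε)^{1/3}. The loss controls reach
probabilities, utilities and sandboxing terms, hence all three quantities. If λ < 2λ^*, the claimed
bound exceeds the trivial ones.

No factor n appears because D = 2(|Z| - 1) suffices (`sum_directLoss_le`). The direct sequences that
a pure strategy of Player i misses are encoded by terminal nodes at which i has disobeyed; each
terminal node has at most two disobedient players, and a fully obedient one has none. -/

noncomputable section

/-! ### Linear inequalities -/

/-- **Farkas' lemma** for finitely many linear functionals. -/
theorem exists_nonneg_combination_of_le_zero {W ι : Type*} [AddCommGroup W] [Module ℝ W]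
    (s : Finset ι) (L : ι → W →ₗ[ℝ] ℝ) (c : W →ₗ[ℝ] ℝ)
    (h : ∀ x, (∀ i ∈ s, L i x ≤ 0) → c x ≤ 0) :
    ∃ y : ι → ℝ, (∀ i, 0 ≤ y i) ∧ ∀ x, c x = ∑ i ∈ s, y i * L i x := by
  classical
  induction s using Finset.induction_on generalizing L c with
  | empty =>
    refine ⟨0, fun _ => le_rfl, fun x => ?_⟩
    have h1 := h x (by simp)
    have h2 := h (-x) (by simp)
    simp only [map_neg] at h2
    simp only [Finset.sum_empty]
    linarith
  | insert k s hk ih =>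
    -- If the constraint `k` is redundant, it receives multiplier zero. Otherwise some `x₀`
    -- satisfies all the other constraints and has `c x₀ > 0`, which forces `L k x₀ > 0`.
    by_cases hc : ∀ x, (∀ i ∈ s, L i x ≤ 0) → c x ≤ 0
    · obtain ⟨y, hy, hyc⟩ := ih L c hc
      refine ⟨Function.update y k 0, fun i => ?_, fun x => ?_⟩
      · by_cases hi : i = k
        · simp [hi]
        · simpa [hi] using hy i
      · rw [Finset.sum_insert hk, hyc x, Function.update_self, zero_mul, zero_add]
        refine Finset.sum_congr rfl fun i hi => ?_
        rw [Function.update_of_ne (ne_of_mem_of_not_mem hi hk)]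
    · push Not at hc
      obtain ⟨x₀, hx₀, hc₀⟩ := hc
      have ha : 0 < L k x₀ := by
        by_contra hle
        have := h x₀ (by
          intro i hi
          rcases Finset.mem_insert.1 hi with rfl | hi
          · exact not_lt.1 hle
          · exact hx₀ i hi)
        linarith
      set a := L k x₀ with ha'
      -- Projecting along `x₀` onto the kernel of `L k` turns the constraint `k` into an equality,
      -- so the induction hypothesis applies to the projected functionals.
      have key : ∀ x, (∀ i ∈ s, L i x - L k x / a * L i x₀ ≤ 0) →
          c x - L k x / a * c x₀ ≤ 0 := by
        intro x hx
        have := h (x - (L k x / a) • x₀) (by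
          intro i hi
          rcases Finset.mem_insert.1 hi with rfl | hi
          · simp only [map_sub, map_smul, smul_eq_mul, ← ha']
            rw [div_mul_cancel₀ _ ha.ne', sub_self]
          · simpa using hx i hi)
        simpa using this
      obtain ⟨y, hy, hyc⟩ := ih (fun i => L i - (L i x₀ / a) • L k) (c - (c x₀ / a) • L k) (by
        intro x hx
        have := key x (fun i hi => by
          have := hx i hi
          simp only [LinearMap.sub_apply, LinearMap.smul_apply, smul_eq_mul] at this
          calc _ = L i x - L i x₀ / a * L k x := by ring
            _ ≤ 0 := this)
        simp only [LinearMap.sub_apply, LinearMap.smul_apply, smul_eq_mul]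
        calc _ = c x - L k x / a * c x₀ := by ring
          _ ≤ 0 := this)
      -- The multiplier of `k` is chosen to make the identity hold at `x₀`. It is nonnegative
      -- because `c x₀ > 0` while every `L i x₀` with `i ∈ s` is nonpositive.
      refine ⟨Function.update y k ((c x₀ - ∑ i ∈ s, y i * L i x₀) / a), fun i => ?_, fun x => ?_⟩
      · by_cases hi : i = k
        · subst hi
          rw [Function.update_self]
          refine div_nonneg ?_ ha.le
          have : ∑ i ∈ s, y i * L i x₀ ≤ 0 :=
            Finset.sum_nonpos fun i hi => mul_nonpos_of_nonneg_of_nonpos (hy i) (hx₀ i hi)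
          linarith
        · simpa [hi] using hy i
      · rw [Finset.sum_insert hk, Function.update_self]
        have h1 : ∑ i ∈ s, Function.update y k ((c x₀ - ∑ i ∈ s, y i * L i x₀) / a) i * L i x
            = ∑ i ∈ s, y i * L i x := Finset.sum_congr rfl fun i hi => by
          rw [Function.update_of_ne (ne_of_mem_of_not_mem hi hk)]
        have h2 := hyc x
        simp only [LinearMap.sub_apply, LinearMap.smul_apply, smul_eq_mul, mul_sub,
          Finset.sum_sub_distrib] at h2
        have h3 : ∑ i ∈ s, y i * (L i x₀ / a * L k x) = (∑ i ∈ s, y i * L i x₀) / a * L k x := by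
          rw [Finset.sum_div, Finset.sum_mul]
          exact Finset.sum_congr rfl fun i _ => by ring
        rw [h1]
        rw [h3] at h2
        linear_combination h2

/-- Farkas' lemma for a system of inequalities in nonnegative unknowns. -/
theorem exists_nonneg_dominating_combination {V K : Type*} [Fintype V] [Fintype K]
    (L : K → V → ℝ) (c : V → ℝ)
    (h : ∀ w : V → ℝ, (∀ v, 0 ≤ w v) → (∀ k, ∑ v, w v * L k v ≤ 0) → ∑ v, w v * c v ≤ 0) :
    ∃ y : K → ℝ, (∀ k, 0 ≤ y k) ∧ ∀ v, c v ≤ ∑ k, y k * L k v := by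
  classical
  -- The sign conditions enter as extra constraints `-w v ≤ 0`; their multipliers are the slack in
  -- the resulting inequality.
  obtain ⟨y, hy, hyc⟩ := exists_nonneg_combination_of_le_zero
    (Finset.univ : Finset (K ⊕ V))
    (Sum.elim (fun k => Fintype.linearCombination ℝ (L k)) fun v => -LinearMap.proj v)
    (Fintype.linearCombination ℝ c) (by
      intro w hw
      have := h w (fun v => by simpa using hw (.inr v) (Finset.mem_univ _))
        (fun k => by
          simpa [Fintype.linearCombination_apply] using hw (.inl k) (Finset.mem_univ _))
      simpa [Fintype.linearCombination_apply] using this)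
  refine ⟨fun k => y (.inl k), fun k => hy _, fun v => ?_⟩
  have := hyc (Pi.single v 1)
  simp only [Fintype.sum_sum_type, Sum.elim_inl, Sum.elim_inr, LinearMap.neg_apply,
    LinearMap.proj_apply, Fintype.linearCombination_apply_single, one_smul] at this
  have h2 : ∑ u, y (.inr u) * -(Pi.single v (1 : ℝ) : V → ℝ) u ≤ 0 :=
    Finset.sum_nonpos fun u _ => by
      have h3 : 0 ≤ (Pi.single v (1 : ℝ) : V → ℝ) u := by
        by_cases hu : u = v
        · simp [hu]
        · simp [hu]
      have := mul_nonneg (hy (.inr u)) h3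
      linarith
  linarith

/-- **Gordan's theorem** in the form of a statement on matrix games. -/
theorem exists_stdSimplex_le_zero_or_exists_pos {V K : Type*} [Fintype V] [Fintype K]
    (L : K → V → ℝ) :
    (∃ w : V → ℝ, (∀ v, 0 ≤ w v) ∧ ∑ v, w v = 1 ∧ ∀ k, ∑ v, w v * L k v ≤ 0) ∨
      ∃ y : K → ℝ, (∀ k, 0 ≤ y k) ∧ ∀ v, 0 < ∑ k, y k * L k v := by
  by_cases h : ∀ w : V → ℝ, (∀ v, 0 ≤ w v) → (∀ k, ∑ v, w v * L k v ≤ 0) → ∑ v, w v * 1 ≤ 0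
  · right
    obtain ⟨y, hy, hyc⟩ := exists_nonneg_dominating_combination L (fun _ => 1) h
    exact ⟨y, hy, fun v => zero_lt_one.trans_le (hyc v)⟩
  · left
    push Not at h
    obtain ⟨w, hw, hL, hpos⟩ := h
    simp only [mul_one] at hpos
    refine ⟨fun v => w v / ∑ u, w u, fun v => div_nonneg (hw v) hpos.le, ?_, fun k => ?_⟩
    · rw [← Finset.sum_div, div_self hpos.ne']
    · have : ∑ v, w v / (∑ u, w u) * L k v = (∑ v, w v * L k v) / ∑ u, w u := by
        rw [Finset.sum_div]
        exact Finset.sum_congr rfl fun v _ => by ring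
      rw [this]
      exact div_nonpos_of_nonpos_of_nonneg (hL k) hpos.le

namespace ExtensiveGame

variable {P A I : Type*} [Fintype A]

/-! ### Nodes and pure strategies -/

theorem mem_terminals {G : ExtensiveGame P A I} {z : List A} :
    z ∈ G.terminals ↔ z ∈ G.hist ∧ ∀ a, a :: z ∉ G.hist := by
  simp [terminals]

theorem mem_hist_of_suffix (G : ExtensiveGame P A I) {h g : List A} (hs : h <:+ g)
    (hg : g ∈ G.hist) : h ∈ G.hist := by
  obtain ⟨t, rfl⟩ := hs
  induction t with
  | nil => exact hg
  | cons a t ih => exact ih (G.tail_mem a _ hg)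

/-- A property of nodes that can be kept along some edge at each non-terminal node can be kept up
to a terminal node. -/
theorem exists_terminal_extension (G : ExtensiveGame P A I) (Q : List A → Prop) {h₀ : List A}
    (hh₀ : h₀ ∈ G.hist) (hQ : Q h₀)
    (step : ∀ h ∈ G.hist, Q h → (∃ a, a :: h ∈ G.hist) → ∃ a, a :: h ∈ G.hist ∧ Q (a :: h)) :
    ∃ z ∈ G.terminals, h₀ <:+ z ∧ Q z := by
  obtain ⟨z, ⟨hz, hsz, hQz⟩, hmax⟩ := Set.exists_max_image {h | h ∈ G.hist ∧ h₀ <:+ h ∧ Q h}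
    List.length (G.finite_hist.subset fun h hh => hh.1) ⟨h₀, hh₀, List.suffix_rfl, hQ⟩
  refine ⟨z, mem_terminals.2 ⟨hz, fun a ha => ?_⟩, hsz, hQz⟩
  obtain ⟨b, hb, hQb⟩ := step z hz hQz ⟨a, ha⟩
  have := hmax (b :: z) ⟨hb, hsz.trans (List.suffix_cons b z), hQb⟩
  simp at this

theorem terminals_nonempty (G : ExtensiveGame P A I) : G.terminals.Nonempty := by
  obtain ⟨z, hz, -⟩ := G.exists_terminal_extension (fun _ => True) G.nil_mem trivial
    fun h _ _ ⟨a, ha⟩ => ⟨a, ha, trivial⟩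
  exact ⟨z, hz⟩

theorem exists_isPure [Nonempty A] (G : ExtensiveGame P A I) (i : P) : ∃ s, G.IsPure i s := by
  classical
  have key : ∀ c : I, ∃ a : A, ∀ h ∈ G.hist, (∃ a, a :: h ∈ G.hist) → G.turn h = some i →
      G.info h = c → a :: h ∈ G.hist := by
    intro c
    by_cases hc : ∃ h ∈ G.hist, (∃ a, a :: h ∈ G.hist) ∧ G.turn h = some i ∧ G.info h = c
    · obtain ⟨h, hh, ⟨a, ha⟩, ht, hi⟩ := hc
      exact ⟨a, fun h' hh' hne ht' hi' =>
        (G.info_legal h hh h' hh' ⟨a, ha⟩ hne i ht ht' (hi.trans hi'.symm) a).1 ha⟩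
    · refine ⟨Classical.arbitrary A, fun h hh hne ht hi => ?_⟩
      exact absurd ⟨h, hh, hne, ht, hi⟩ hc
  choose s hs using key
  exact ⟨s, fun h hh hne ht => hs _ h hh hne ht rfl⟩

/-- The pure strategy `s` of player `i` allows the node `h` to be reached. -/
def Follows (G : ExtensiveGame P A I) (i : P) (s : I → A) (h : List A) : Prop :=
  ∀ p ∈ G.seq i h, s p.1 = p.2

@[simp] theorem follows_nil (G : ExtensiveGame P A I) (i : P) (s : I → A) : G.Follows i s [] := by
  simp [Follows, seq]

theorem follows_cons (G : ExtensiveGame P A I) (i : P) (s : I → A) (a : A) (h : List A) :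
    G.Follows i s (a :: h) ↔ G.Follows i s h ∧ (G.turn h = some i → s (G.info h) = a) := by
  unfold Follows
  rw [seq]
  split_ifs with ht
  · simp [ht, and_comm]
  · simp [ht]

theorem Follows.of_suffix {G : ExtensiveGame P A I} {i : P} {s : I → A} {h g : List A}
    (hg : G.Follows i s g) (hs : h <:+ g) : G.Follows i s h := by
  obtain ⟨t, rfl⟩ := hs
  induction t with
  | nil => exact hg
  | cons a t ih => exact ih ((G.follows_cons i s a _).1 hg).1

open Classical in
theorem seqForm_leafSeq (G : ExtensiveGame P A I) (i : P) (s : I → A) (z : G.Leaf) :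
    G.seqForm i s (G.leafSeq i z) = if G.Follows i s z.1 then 1 else 0 := by
  unfold seqForm
  exact if_congr Iff.rfl rfl rfl

theorem leafSeq_surjective (G : ExtensiveGame P A I) (i : P) :
    Function.Surjective (G.leafSeq i) := by
  classical
  rintro ⟨σ, hσ⟩
  obtain ⟨z, hz, rfl⟩ := Finset.mem_image.1 hσ
  exact ⟨⟨z, hz⟩, rfl⟩

theorem card_seq_le (G : ExtensiveGame P A I) (i : P) :
    Fintype.card (G.Seq i) ≤ G.terminals.card := by
  rw [← Fintype.card_coe]
  exact Fintype.card_le_of_surjective _ (G.leafSeq_surjective i)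

theorem chanceReach_nonneg (G : ExtensiveGame P A I) :
    ∀ h ∈ G.hist, 0 ≤ G.chanceReach h
  | [], _ => by simp [chanceReach]
  | a :: h, hh => by
    have h1 := G.tail_mem a h hh
    rw [chanceReach]
    refine mul_nonneg ?_ (G.chanceReach_nonneg h h1)
    split_ifs with ht
    · exact G.chance_nonneg h h1 ht a hh
    · exact zero_le_one

open Classical in
/-- A weight on nodes that is preserved at each non-terminal node is preserved as a whole. -/
theorem sum_terminals_eq_root (G : ExtensiveGame P A I) (w : List A → ℝ)
    (hw : ∀ h ∈ G.hist, (∃ a, a :: h ∈ G.hist) →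
      ∑ a ∈ Finset.univ.filter (fun a => a :: h ∈ G.hist), w (a :: h) = w h) :
    ∑ z ∈ G.terminals, w z = w [] := by
  set H := G.finite_hist.toFinset with hH
  -- The double sum over nodes and their children is evaluated twice: each non-root node is a child
  -- exactly once, and the children of each non-terminal node carry its weight. Comparing the two
  -- leaves the terminal nodes on one side and the root on the other.
  have h1 : ∑ h ∈ H, ∑ a ∈ Finset.univ.filter (fun a => a :: h ∈ G.hist), w (a :: h)
      = ∑ g ∈ H.erase [], w g := by
    rw [Finset.sum_sigma']
    refine Finset.sum_bij (fun p _ => p.2 :: p.1) ?_ ?_ ?_ ?_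
    · rintro ⟨h, a⟩ hp
      simp only [Finset.mem_sigma, Finset.mem_filter, hH, Set.Finite.mem_toFinset] at hp
      simp [hH, hp.2.2]
    · rintro ⟨h, a⟩ - ⟨h', a'⟩ - heq
      simp only [List.cons.injEq] at heq
      obtain ⟨rfl, rfl⟩ := heq
      rfl
    · rintro (_ | ⟨a, h⟩) hg
      · simp at hg
      · simp only [Finset.mem_erase, hH, Set.Finite.mem_toFinset] at hg
        exact ⟨⟨h, a⟩, by simp [hH, hg.2, G.tail_mem a h hg.2], rfl⟩
    · rintro ⟨h, a⟩ -
      rfl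
  have h2 : ∑ h ∈ H, ∑ a ∈ Finset.univ.filter (fun a => a :: h ∈ G.hist), w (a :: h)
      = ∑ h ∈ H.filter (fun h => ¬ ∀ a, a :: h ∉ G.hist), w h := by
    rw [Finset.sum_filter]
    refine Finset.sum_congr rfl fun h hh => ?_
    by_cases hne : ∃ a, a :: h ∈ G.hist
    · rw [if_pos (by simpa using hne)]
      exact hw h (by simpa [hH] using hh) hne
    · rw [if_neg (by simpa using hne)]
      push Not at hne
      rw [Finset.filter_false_of_mem (fun a _ => hne a), Finset.sum_empty]
  have h3 := Finset.add_sum_erase H w (a := []) (by simp [hH, G.nil_mem])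
  have h4 := Finset.sum_filter_add_sum_filter_not H (fun h => ∀ a, a :: h ∉ G.hist) w
  have h5 : G.terminals = H.filter (fun h => ∀ a, a :: h ∉ G.hist) := by
    simp only [terminals, hH]
  rw [h5]
  linarith

open Classical in
/-- Under a profile of pure strategies, the terminal nodes are reached with total probability 1. -/
theorem sum_chanceReach_follows (G : ExtensiveGame P A I) (s : P → I → A)
    (hs : ∀ j, G.IsPure j (s j)) :
    ∑ z ∈ G.terminals, G.chanceReach z * (if ∀ j, G.Follows j (s j) z then 1 else 0) = 1 := by
  rw [G.sum_terminals_eq_root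
    (fun h => G.chanceReach h * (if ∀ j, G.Follows j (s j) h then 1 else 0))]
  · simp [chanceReach]
  intro h hh hne
  simp only [chanceReach, follows_cons, forall_and]
  by_cases hf : ∀ j, G.Follows j (s j) h
  swap
  · simp [hf]
  simp only [hf, implies_true, true_and, if_true, mul_one]
  cases ht : G.turn h with
  | none =>
    have := G.chance_sum h hh ht hne
    rw [finsum_mem_eq_finite_toFinset_sum _ (Set.toFinite _)] at this
    simp only [if_true, reduceCtorEq, IsEmpty.forall_iff, implies_true, mul_one]
    rw [← Finset.sum_mul]
    convert one_mul _
    convert this using 2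
    ext a
    simp
  | some i =>
    simp only [reduceCtorEq, if_false, one_mul, Option.some.injEq, forall_eq']
    rw [← Finset.mul_sum, Finset.sum_ite_eq, if_pos, mul_one]
    simpa using hs i h hh hne ht

/-! ### Sequence-form mixed strategies -/

theorem finite_image_seqForm (G : ExtensiveGame P A I) (i : P) :
    (G.seqForm i '' {s | G.IsPure i s}).Finite := by
  refine Set.Finite.subset (Set.Finite.pi' fun _ : G.Seq i => (Set.toFinite {(0 : ℝ), 1})) ?_
  rintro _ ⟨s, -, rfl⟩ σ
  simp only [seqForm]
  split_ifs <;> simp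

theorem convex_strategies (G : ExtensiveGame P A I) (i : P) : Convex ℝ (G.strategies i) :=
  convex_convexHull ℝ _

theorem isCompact_strategies (G : ExtensiveGame P A I) (i : P) : IsCompact (G.strategies i) :=
  (G.finite_image_seqForm i).isCompact_convexHull (𝕜 := ℝ)

theorem seqForm_mem_strategies (G : ExtensiveGame P A I) {i : P} {s : I → A}
    (hs : G.IsPure i s) : G.seqForm i s ∈ G.strategies i :=
  subset_convexHull ℝ _ ⟨s, hs, rfl⟩

theorem strategies_nonempty [Nonempty A] (G : ExtensiveGame P A I) (i : P) :
    (G.strategies i).Nonempty := by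
  obtain ⟨s, hs⟩ := G.exists_isPure i
  exact ⟨_, G.seqForm_mem_strategies hs⟩

theorem strategies_mem_Icc (G : ExtensiveGame P A I) {i : P} {x : G.Seq i → ℝ}
    (hx : x ∈ G.strategies i) (σ : G.Seq i) : x σ ∈ Set.Icc (0 : ℝ) 1 := by
  have : G.strategies i ⊆ {x | x σ ∈ Set.Icc (0 : ℝ) 1} := by
    refine convexHull_min ?_ ((convex_Icc (0 : ℝ) 1).linear_preimage
      (LinearMap.proj σ : (G.Seq i → ℝ) →ₗ[ℝ] ℝ))
    rintro _ ⟨s, -, rfl⟩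
    simp only [seqForm, Set.mem_ofPred_eq]
    split_ifs <;> simp
  exact this hx

/-- A property of strategy profiles that is convex in each coordinate holds if it holds for pure
profiles. -/
theorem strategies_induction [Fintype P] [DecidableEq P] (G : ExtensiveGame P A I)
    (Q : (∀ j, G.Seq j → ℝ) → Prop)
    (hpure : ∀ s : P → I → A, (∀ j, G.IsPure j (s j)) → Q fun j => G.seqForm j (s j))
    (hconv : ∀ x j, Convex ℝ {v | Q (Function.update x j v)})
    (x : ∀ j, G.Seq j → ℝ) (hx : ∀ j, x j ∈ G.strategies j) : Q x := by
  -- The players in `S` mix and the others are pure; inserting a player into `S` passes from the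
  -- vertices to the convex hull in one coordinate.
  have key : ∀ S : Finset P, ∀ x : ∀ j, G.Seq j → ℝ, (∀ j ∈ S, x j ∈ G.strategies j) →
      (∀ j ∉ S, x j ∈ G.seqForm j '' {s | G.IsPure j s}) → Q x := by
    intro S
    induction S using Finset.induction_on with
    | empty =>
      intro x _ h
      choose s hs hsx using fun j => h j (Finset.notMem_empty j)
      have := hpure s hs
      simp only [hsx] at this
      exact this
    | insert k S hk ih =>
      intro x h1 h2
      have : G.strategies k ⊆ {v | Q (Function.update x k v)} := by
        refine convexHull_min (fun v hv => ih _ (fun j hj => ?_) (fun j hj => ?_)) (hconv x k)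
        · rw [Function.update_of_ne (ne_of_mem_of_not_mem hj hk)]
          exact h1 j (Finset.mem_insert_of_mem hj)
        · by_cases hjk : j = k
          · subst hjk
            rwa [Function.update_self]
          · rw [Function.update_of_ne hjk]
            exact h2 j (by simp [hjk, hj])
      have h3 := this (h1 k (Finset.mem_insert_self k S))
      simpa using h3
  exact key Finset.univ x (fun j _ => hx j) (fun j hj => absurd (Finset.mem_univ j) hj)

/-- A weighted sum of reach probabilities over the leaves is linear in each strategy. -/
theorem exists_linear_leafSum [Fintype P] [DecidableEq P] (G : ExtensiveGame P A I)
    (f : G.Leaf → ℝ) (x : ∀ j, G.Seq j → ℝ) (k : P) :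
    ∃ φ : (G.Seq k → ℝ) →ₗ[ℝ] ℝ, ∀ v,
      ∑ z, f z * ∏ j, Function.update x k v j (G.leafSeq j z) = φ v := by
  refine ⟨∑ z : G.Leaf, (f z * ∏ j ∈ Finset.univ.erase k, x j (G.leafSeq j z)) •
    LinearMap.proj (G.leafSeq k z), fun v => ?_⟩
  rw [LinearMap.sum_apply]
  refine Finset.sum_congr rfl fun z _ => ?_
  rw [← Finset.mul_prod_erase Finset.univ _ (Finset.mem_univ k), Function.update_self,
    LinearMap.smul_apply, LinearMap.proj_apply, smul_eq_mul]
  have : ∏ j ∈ Finset.univ.erase k, Function.update x k v j (G.leafSeq j z)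
      = ∏ j ∈ Finset.univ.erase k, x j (G.leafSeq j z) :=
    Finset.prod_congr rfl fun j hj => by rw [Function.update_of_ne (Finset.ne_of_mem_erase hj)]
  rw [this]
  ring

theorem exists_linear_expUtility [Fintype P] [DecidableEq P] (G : ExtensiveGame P A I) (i : P)
    (x : ∀ j, G.Seq j → ℝ) (k : P) :
    ∃ φ : (G.Seq k → ℝ) →ₗ[ℝ] ℝ, ∀ v, G.expUtility i (Function.update x k v) = φ v := by
  obtain ⟨φ, hφ⟩ := G.exists_linear_leafSum
    (fun z => G.chanceReach z.1 * G.utility i z.1) x k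
  refine ⟨φ, fun v => ?_⟩
  rw [← hφ]
  exact Finset.sum_congr rfl fun z _ => by ring

open Classical in
theorem prod_seqForm_leafSeq [Fintype P] (G : ExtensiveGame P A I) (s : P → I → A) (z : G.Leaf) :
    ∏ j, G.seqForm j (s j) (G.leafSeq j z) = if ∀ j, G.Follows j (s j) z.1 then 1 else 0 := by
  simp only [seqForm_leafSeq]
  rw [Finset.prod_ite_zero]
  simp

theorem sum_reach_eq_one [Fintype P] (G : ExtensiveGame P A I) {x : ∀ j, G.Seq j → ℝ}
    (hx : ∀ j, x j ∈ G.strategies j) :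
    ∑ z : G.Leaf, G.chanceReach z.1 * ∏ j, x j (G.leafSeq j z) = 1 := by
  classical
  refine G.strategies_induction
    (fun x => ∑ z : G.Leaf, G.chanceReach z.1 * ∏ j, x j (G.leafSeq j z) = 1)
    (fun s hs => ?_) (fun x k => ?_) x hx
  · simp only [prod_seqForm_leafSeq]
    refine Eq.trans ?_ (G.sum_chanceReach_follows s hs)
    convert Finset.sum_coe_sort G.terminals
      fun z => G.chanceReach z * (if ∀ j, G.Follows j (s j) z then 1 else 0)
  · obtain ⟨φ, hφ⟩ := G.exists_linear_leafSum (fun z => G.chanceReach z.1) x k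
    simp only [hφ]
    exact (convex_singleton (1 : ℝ)).linear_preimage φ

theorem Leaf.mem_hist {G : ExtensiveGame P A I} (z : G.Leaf) : z.1 ∈ G.hist :=
  (mem_terminals.1 z.2).1

theorem Leaf.utility_mem {G : ExtensiveGame P A I} (z : G.Leaf) (i : P) :
    G.utility i z.1 ∈ Set.Icc (0 : ℝ) 1 :=
  G.utility_mem i z.1 z.mem_hist (mem_terminals.1 z.2).2

theorem reach_nonneg [Fintype P] (G : ExtensiveGame P A I) {x : ∀ j, G.Seq j → ℝ}
    (hx : ∀ j, x j ∈ G.strategies j) (z : G.Leaf) :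
    0 ≤ G.chanceReach z.1 * ∏ j, x j (G.leafSeq j z) :=
  mul_nonneg (G.chanceReach_nonneg _ z.mem_hist)
    (Finset.prod_nonneg fun j _ => (G.strategies_mem_Icc (hx j) _).1)

theorem expUtility_mem_Icc [Fintype P] (G : ExtensiveGame P A I) (i : P) {x : ∀ j, G.Seq j → ℝ}
    (hx : ∀ j, x j ∈ G.strategies j) : G.expUtility i x ∈ Set.Icc (0 : ℝ) 1 := by
  constructor
  · exact Finset.sum_nonneg fun z _ => mul_nonneg (G.reach_nonneg hx z) (z.utility_mem i).1
  · rw [← G.sum_reach_eq_one hx]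
    exact Finset.sum_le_sum fun z _ =>
      mul_le_of_le_one_right (G.reach_nonneg hx z) (z.utility_mem i).2

/-- If reach probabilities drop at most by the factor `1 - δ` when the profile `a` is replaced by
`b`, then utilities change at most by `δ`. -/
theorem abs_expUtility_sub_le [Fintype P] (G : ExtensiveGame P A I) (i : P)
    {a b : ∀ j, G.Seq j → ℝ} (ha : ∀ j, a j ∈ G.strategies j) (hb : ∀ j, b j ∈ G.strategies j)
    {δ : ℝ} (hδ : 0 ≤ δ)
    (h : ∀ z : G.Leaf, ∏ j, a j (G.leafSeq j z) - ∏ j, b j (G.leafSeq j z)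
      ≤ δ * ∏ j, a j (G.leafSeq j z)) :
    |G.expUtility i a - G.expUtility i b| ≤ δ := by
  set α : G.Leaf → ℝ := fun z => G.chanceReach z.1 * ∏ j, a j (G.leafSeq j z) with hα
  set β : G.Leaf → ℝ := fun z => G.chanceReach z.1 * ∏ j, b j (G.leafSeq j z) with hβ
  have hαβ : ∀ z, α z - β z ≤ δ * α z := fun z => by
    have := mul_le_mul_of_nonneg_left (h z) (G.chanceReach_nonneg _ z.mem_hist)
    simp only [hα, hβ]
    linarith
  have hα0 : ∀ z, 0 ≤ α z := G.reach_nonneg ha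
  have hα1 : ∑ z, α z = 1 := G.sum_reach_eq_one ha
  have hβ1 : ∑ z, β z = 1 := G.sum_reach_eq_one hb
  have hsum : ∀ c : G.Leaf → ℝ, (∀ z, c z ∈ Set.Icc (0 : ℝ) 1) → ∑ z, (α z - β z) * c z ≤ δ := by
    intro c hc
    calc ∑ z, (α z - β z) * c z ≤ ∑ z, δ * α z := Finset.sum_le_sum fun z _ => by
          have h1 := mul_le_mul_of_nonneg_right (hαβ z) (hc z).1
          have h2 := mul_le_of_le_one_right (mul_nonneg hδ (hα0 z)) (hc z).2
          linarith
      _ = δ := by rw [← Finset.mul_sum, hα1, mul_one]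
  have e : G.expUtility i a - G.expUtility i b = ∑ z : G.Leaf, (α z - β z) * G.utility i z.1 := by
    rw [expUtility, expUtility, ← Finset.sum_sub_distrib]
    exact Finset.sum_congr rfl fun z _ => by simp only [hα, hβ]; ring
  rw [e, abs_le]
  refine ⟨?_, hsum _ fun z => z.utility_mem i⟩
  -- The hypothesis only limits how much the reach probabilities drop. Both distributions have mass
  -- one, so testing against `1 - u` gives the opposite inequality.
  have h1 := hsum (fun z => 1 - G.utility i z.1) fun z => by
    have := z.utility_mem i
    exact ⟨by linarith [this.2], by linarith [this.1]⟩
  have h2 : ∑ z : G.Leaf, (α z - β z) * (1 - G.utility i z.1)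
      = ∑ z, (α z - β z) - ∑ z : G.Leaf, (α z - β z) * G.utility i z.1 := by
    rw [← Finset.sum_sub_distrib]
    exact Finset.sum_congr rfl fun z _ => by ring
  rw [h2, Finset.sum_sub_distrib, hα1, hβ1] at h1
  linarith

/-! ### Departure from a pure strategy -/

theorem IsPure.exists_leaf_of_follows {G : ExtensiveGame P A I} {i : P} {s : I → A}
    (hs : G.IsPure i s) {h : List A} (hh : h ∈ G.hist) (hf : G.Follows i s h) :
    ∃ z : G.Leaf, h <:+ z.1 ∧ G.Follows i s z.1 := by
  obtain ⟨z, hz, h1, h2⟩ := G.exists_terminal_extension (G.Follows i s) hh hf (by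
    rintro g hg hfg ⟨a, ha⟩
    by_cases ht : G.turn g = some i
    · exact ⟨s (G.info g), hs g hg ⟨a, ha⟩ ht, (G.follows_cons i s _ g).2 ⟨hfg, fun _ => rfl⟩⟩
    · exact ⟨a, ha, (G.follows_cons i s _ g).2 ⟨hfg, fun h => absurd h ht⟩⟩)
  exact ⟨⟨z, hz⟩, h1, h2⟩

theorem exists_first_departure (G : ExtensiveGame P A I) {i : P} {s : I → A} :
    ∀ {z : List A}, ¬ G.Follows i s z →
      ∃ a h, a :: h <:+ z ∧ G.turn h = some i ∧ s (G.info h) ≠ a ∧ G.Follows i s h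
  | [], hz => absurd (G.follows_nil i s) hz
  | a :: h, hz => by
    by_cases hf : G.Follows i s h
    · have : G.turn h = some i ∧ s (G.info h) ≠ a := by
        by_contra hcon
        exact hz ((G.follows_cons i s a h).2 ⟨hf, fun ht => by_contra fun hne => hcon ⟨ht, hne⟩⟩)
      exact ⟨a, h, List.suffix_rfl, this.1, this.2, hf⟩
    · obtain ⟨b, g, hg, h1⟩ := G.exists_first_departure hf
      exact ⟨b, g, hg.trans (List.suffix_cons a h), h1⟩

/-- The amount `dᵀ(d - x)` by which the strategy `x` falls short of the strategy `d`. -/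
def directLoss (G : ExtensiveGame P A I) (i : P) (d x : G.Seq i → ℝ) : ℝ :=
  ∑ σ, d σ * (d σ - x σ)

theorem directLoss_eq (G : ExtensiveGame P A I) (i : P) (d x : G.Seq i → ℝ) :
    G.directLoss i d x = ∑ σ, d σ * d σ - ∑ σ, d σ * x σ := by
  rw [directLoss, ← Finset.sum_sub_distrib]
  exact Finset.sum_congr rfl fun σ _ => by ring

@[simp] theorem directLoss_self (G : ExtensiveGame P A I) (i : P) (d : G.Seq i → ℝ) :
    G.directLoss i d d = 0 := by
  simp [directLoss]

theorem seqForm_mul_sub_nonneg (G : ExtensiveGame P A I) {i : P} (s : I → A) {x : G.Seq i → ℝ}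
    (hx : x ∈ G.strategies i) (σ : G.Seq i) :
    0 ≤ G.seqForm i s σ * (G.seqForm i s σ - x σ) := by
  have := (G.strategies_mem_Icc hx σ).2
  unfold seqForm
  split_ifs
  · linarith
  · simp

theorem directLoss_nonneg (G : ExtensiveGame P A I) {i : P} (s : I → A) {x : G.Seq i → ℝ}
    (hx : x ∈ G.strategies i) : 0 ≤ G.directLoss i (G.seqForm i s) x :=
  Finset.sum_nonneg fun σ _ => G.seqForm_mul_sub_nonneg s hx σ

theorem one_sub_le_directLoss (G : ExtensiveGame P A I) {i : P} {s : I → A} {x : G.Seq i → ℝ}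
    (hx : x ∈ G.strategies i) {z : G.Leaf} (hz : G.Follows i s z.1) :
    1 - x (G.leafSeq i z) ≤ G.directLoss i (G.seqForm i s) x := by
  have := Finset.single_le_sum (fun σ _ => G.seqForm_mul_sub_nonneg s hx σ)
    (Finset.mem_univ (G.leafSeq i z))
  simpa [seqForm_leafSeq, hz, directLoss] using this

/-- An inequality between affine functions of a mixed strategy follows from the case of pure
strategies. -/
theorem strategies_le_of_pure (G : ExtensiveGame P A I) {i : P}
    (φ : (G.Seq i → ℝ) →ₗ[ℝ] ℝ) (c : ℝ) (h : ∀ s, G.IsPure i s → φ (G.seqForm i s) ≤ c)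
    {x : G.Seq i → ℝ} (hx : x ∈ G.strategies i) : φ x ≤ c := by
  have : G.strategies i ⊆ {x | φ x ≤ c} := by
    refine convexHull_min ?_ ((convex_Iic c).linear_preimage φ)
    rintro _ ⟨s, hs, rfl⟩
    exact h s hs
  exact this hx

/-- For pure `y` reaching `z`, consider the first node on the path to `z` where `s` would act
differently. Continuing from there with `s` leads to a leaf compatible with `s` that `y` does not
reach, so `y` misses at least one sequence of `s` and its loss is at least 1. Mixed strategies
follow by linearity. -/
theorem le_directLoss_of_not_follows (G : ExtensiveGame P A I) {i : P} {s : I → A}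
    (hs : G.IsPure i s) {x : G.Seq i → ℝ} (hx : x ∈ G.strategies i) {z : G.Leaf}
    (hz : ¬ G.Follows i s z.1) : x (G.leafSeq i z) ≤ G.directLoss i (G.seqForm i s) x := by
  have := G.strategies_le_of_pure
    (LinearMap.proj (G.leafSeq i z) + ∑ σ, G.seqForm i s σ • (LinearMap.proj σ :
      (G.Seq i → ℝ) →ₗ[ℝ] ℝ))
    (∑ σ, G.seqForm i s σ * G.seqForm i s σ) (fun y hy => ?_) hx
  · rw [directLoss_eq]
    simp only [LinearMap.add_apply, LinearMap.sum_apply, LinearMap.smul_apply,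
      LinearMap.proj_apply, smul_eq_mul] at this
    linarith
  · simp only [LinearMap.add_apply, LinearMap.sum_apply, LinearMap.smul_apply,
      LinearMap.proj_apply, smul_eq_mul]
    suffices G.seqForm i y (G.leafSeq i z) ≤ G.directLoss i (G.seqForm i s) (G.seqForm i y) by
      rw [directLoss_eq] at this
      linarith
    by_cases hyz : G.Follows i y z.1
    · obtain ⟨a, h, hsuf, ht, hne, hf⟩ := G.exists_first_departure hz
      have hah := G.mem_hist_of_suffix hsuf z.mem_hist
      have hya : y (G.info h) = a := ((G.follows_cons i y a h).1 (hyz.of_suffix hsuf)).2 ht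
      have hh := G.tail_mem a h hah
      obtain ⟨z', hz', hfz'⟩ := hs.exists_leaf_of_follows (hs h hh ⟨a, hah⟩ ht)
        ((G.follows_cons i s _ h).2 ⟨hf, fun _ => rfl⟩)
      have h1 := G.one_sub_le_directLoss (G.seqForm_mem_strategies hy) hfz'
      have h2 : ¬ G.Follows i y z'.1 := fun hcon => hne <| by
        rw [← ((G.follows_cons i y _ h).1 (hcon.of_suffix hz')).2 ht, hya]
      rw [seqForm_leafSeq, if_neg h2, sub_zero] at h1
      rwa [seqForm_leafSeq, if_pos hyz]
    · rw [seqForm_leafSeq, if_neg hyz]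
      exact G.directLoss_nonneg s (G.seqForm_mem_strategies hy)

/-! ### Structure of the augmented game -/

theorem base_suffix {B : Type*} {g z : List (B ⊕ B)} (h : g <:+ z) : base g <:+ base z := by
  obtain ⟨t, rfl⟩ := h
  induction t with
  | nil => exact List.suffix_rfl
  | cons l t ih =>
    rcases l with a | r
    · exact ih.trans (List.suffix_cons a _)
    · exact ih

theorem not_mediatorMoves_of_pending {G : ExtensiveGame P A I} {g : List (A ⊕ A)} {r : A}
    (h : pending g = some r) : ¬ G.MediatorMoves g := fun hm => by
  rw [hm.1] at h
  exact absurd h (by simp)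

theorem augTurn_of_mediatorMoves {G : ExtensiveGame P A I} {g : List (A ⊕ A)}
    (h : G.MediatorMoves g) : G.augTurn g = some none := if_pos h

theorem augTurn_of_not_mediatorMoves {G : ExtensiveGame P A I} {g : List (A ⊕ A)}
    (h : ¬ G.MediatorMoves g) : G.augTurn g = (G.turn (base g)).map some := if_neg h

theorem augTurn_eq_player_iff {G : ExtensiveGame P A I} {g : List (A ⊕ A)} {i : P} :
    G.augTurn g = some (some i) ↔ ¬ G.MediatorMoves g ∧ G.turn (base g) = some i := by
  by_cases h : G.MediatorMoves g
  · simp [augTurn_of_mediatorMoves h, h]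
  · simp [augTurn_of_not_mediatorMoves h, h]

theorem augTurn_eq_mediator_iff {G : ExtensiveGame P A I} {g : List (A ⊕ A)} :
    G.augTurn g = some none ↔ G.MediatorMoves g := by
  by_cases h : G.MediatorMoves g
  · simp [augTurn_of_mediatorMoves h, h]
  · simp [augTurn_of_not_mediatorMoves h, h]

theorem augInfo_of_mediatorMoves {G : ExtensiveGame P A I} {g : List (A ⊕ A)}
    (h : G.MediatorMoves g) : G.augInfo g = .inl g := if_pos h

theorem augInfo_of_not_mediatorMoves {G : ExtensiveGame P A I} {g : List (A ⊕ A)}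
    (h : ¬ G.MediatorMoves g) :
    G.augInfo g = .inr (G.info (base g), pending g, G.heard (G.turn (base g)) g) := if_neg h

/-- Induction over the nodes of the augmented game at which no recommendation is pending. -/
theorem augHist_induction {G : ExtensiveGame P A I} {motive : List (A ⊕ A) → Prop}
    (nil : motive [])
    (play : ∀ a g, G.AugHist g → pending g = none → ¬ G.MediatorMoves g → a :: base g ∈ G.hist →
      motive g → motive (.inl a :: g))
    (answer : ∀ a r g, G.AugHist g → G.MediatorMoves g → r :: base g ∈ G.hist →
      a :: base g ∈ G.hist → motive g → motive (.inl a :: .inr r :: g)) :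
    ∀ g, G.AugHist g → pending g = none → motive g
  | [], _, _ => nil
  | .inr _ :: _, _, hp => absurd hp (by simp [pending])
  | [.inl a], h, _ => play a [] h.1 rfl h.2.1 h.2.2 nil
  | .inl a :: .inl b :: g, h, _ => play a _ h.1 rfl h.2.1 h.2.2
      (augHist_induction nil play answer _ h.1 rfl)
  | .inl a :: .inr r :: g, h, _ => answer a r g h.1.1 h.1.2.1 h.1.2.2 h.2.2
      (augHist_induction nil play answer _ h.1.1 h.1.2.1.1)

open Classical in
/-- The node of the augmented game over the node `w` in which, whenever the mediator moves at a
node over `h` and the action `a` is played next, the recommendation is `ρ a h`. -/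
def lift (G : ExtensiveGame P A I) (ρ : A → List A → A) : List A → List (A ⊕ A)
  | [] => []
  | a :: h => if G.MediatorMoves (G.lift ρ h) then .inl a :: .inr (ρ a h) :: G.lift ρ h
      else .inl a :: G.lift ρ h

section Augment

variable {G : ExtensiveGame P A I} {u₀ : List A → ℝ}
  {hu₀ : ∀ h ∈ G.hist, (∀ a, a :: h ∉ G.hist) → u₀ h ∈ Set.Icc (0 : ℝ) 1}

open Classical in
theorem seq_augment_play (i : P) (a : A) {g : List (A ⊕ A)} (h : ¬ G.MediatorMoves g) :
    (G.augment u₀ hu₀).seq (some i) (.inl a :: g) =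
      if G.turn (base g) = some i then
        (.inr (G.info (base g), pending g, G.heard (some i) g), .inl a) ::
          (G.augment u₀ hu₀).seq (some i) g
      else (G.augment u₀ hu₀).seq (some i) g := by
  rw [seq]
  by_cases ht : G.turn (base g) = some i
  · rw [if_pos ht, if_pos (show (G.augment u₀ hu₀).turn g = _ from
      augTurn_eq_player_iff.2 ⟨h, ht⟩)]
    change (G.augInfo g, _) :: _ = _
    rw [augInfo_of_not_mediatorMoves h, ht]
  · rw [if_neg ht]
    exact if_neg fun hc => ht (augTurn_eq_player_iff.1 hc).2

open Classical in
theorem seq_augment_answer (i : P) (a r : A) {g : List (A ⊕ A)} (h : G.MediatorMoves g) :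
    (G.augment u₀ hu₀).seq (some i) (.inl a :: .inr r :: g) =
      if G.turn (base g) = some i then
        (.inr (G.info (base g), some r, r :: G.heard (some i) g), .inl a) ::
          (G.augment u₀ hu₀).seq (some i) g
      else (G.augment u₀ hu₀).seq (some i) g := by
  have h1 : (G.augment u₀ hu₀).seq (some i) (.inr r :: g) = (G.augment u₀ hu₀).seq (some i) g := by
    rw [seq]
    exact if_neg fun hc => (augTurn_eq_player_iff.1 hc).1 h
  rw [seq_augment_play i a (not_mediatorMoves_of_pending rfl), h1]
  change (if G.turn (base g) = some i then _ else _) = _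
  split_ifs with ht
  · simp [heard, ht, pending, base]
  · rfl

theorem deviators_play (a : A) {g : List (A ⊕ A)} (h : pending g = none) :
    G.deviators (.inl a :: g) = G.deviators g := by
  rw [deviators, if_neg]
  simp [h]

theorem mem_deviators_answer (a r : A) (g : List (A ⊕ A)) (j : P) :
    j ∈ G.deviators (.inl a :: .inr r :: g) ↔
      (r ≠ a ∧ G.turn (base g) = some j) ∨ j ∈ G.deviators g := by
  classical
  rw [deviators]
  by_cases hra : r = a
  · rw [if_neg (by simp [pending, hra])]
    simp [hra, deviators]
  · rw [if_pos ⟨r, rfl, hra⟩]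
    simp [hra, deviators, base]

/-- A recommendation is given only while fewer than two players have disobeyed, and one answer adds
at most one player. -/
theorem card_deviators_le (g : List (A ⊕ A)) (hg : G.AugHist g) (hp : pending g = none) :
    (G.deviators g).card ≤ 2 := by
  classical
  refine augHist_induction (motive := fun g => (G.deviators g).card ≤ 2) (by simp [deviators])
    (fun a g _ hp _ _ ih => by rwa [deviators_play a hp]) ?_ g hg hp
  · intro a r g _ hm _ _ _
    obtain ⟨j, hj⟩ := Option.ne_none_iff_exists'.1 hm.2.1
    have : G.deviators (.inl a :: .inr r :: g) ⊆ insert j (G.deviators g) := by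
      intro k hk
      rcases (mem_deviators_answer a r g k).1 hk with ⟨-, h⟩ | h
      · rw [hj] at h
        simp [Option.some.inj h]
      · exact Finset.mem_insert_of_mem h
    have h1 := (Finset.card_le_card this).trans (Finset.card_insert_le _ _)
    have h2 := hm.2.2
    omega

theorem mem_terminals_augment {z : List (A ⊕ A)} :
    z ∈ (G.augment u₀ hu₀).terminals ↔
      G.AugHist z ∧ pending z = none ∧ base z ∈ G.terminals := by
  rw [mem_terminals, mem_terminals]
  change G.AugHist z ∧ (∀ l, ¬ G.AugHist (l :: z)) ↔ _
  constructor
  · rintro ⟨h, hl⟩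
    have hb : ∀ a, a :: base z ∉ G.hist := by
      intro a ha
      by_cases hm : G.MediatorMoves z
      · exact hl (.inr a) ⟨h, hm, ha⟩
      · exact hl (.inl a) ⟨h, hm, ha⟩
    refine ⟨h, ?_, h.base_mem, hb⟩
    rcases z with _ | ⟨a | r, z⟩
    · rfl
    · rfl
    · exact absurd h.2.2 (hb r)
  · rintro ⟨h, -, -, hb⟩
    refine ⟨h, ?_⟩
    rintro (a | r) hl
    · exact hb a hl.2.2
    · exact hb r hl.2.2

/-- A player who follows a direct strategy never disobeys. -/
theorem notMem_deviators_of_follows {i : P}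
    {s : List (A ⊕ A) ⊕ (I × Option A × List A) → A ⊕ A} (hs : G.IsDirect u₀ hu₀ i s)
    (g : List (A ⊕ A)) (hg : G.AugHist g) (hp : pending g = none)
    (hf : (G.augment u₀ hu₀).Follows (some i) s g) : i ∉ G.deviators g := by
  revert hf
  refine augHist_induction (motive := fun g => (G.augment u₀ hu₀).Follows (some i) s g →
    i ∉ G.deviators g) (fun _ => by simp [deviators]) ?_ ?_ g hg hp
  · intro a g hg hp hm ha ih hf
    rw [deviators_play a hp]
    exact ih (hf.of_suffix (List.suffix_cons _ _))
  · intro a r g hg hm hr ha ih hf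
    rw [mem_deviators_answer, not_or]
    refine ⟨?_, ih (hf.of_suffix ((List.suffix_cons _ _).trans (List.suffix_cons _ _)))⟩
    rintro ⟨hra, ht⟩
    have h1 := hs.2 (.inr r :: g) ⟨hg, hm, hr⟩ ht r rfl
    have h2 := (((G.augment u₀ hu₀).follows_cons _ _ _ _).1 hf).2
      (augTurn_eq_player_iff.2 ⟨not_mediatorMoves_of_pending rfl, ht⟩)
    exact hra (Sum.inl_injective (h1.symm.trans h2))

theorem lift_cons_of_mediatorMoves {ρ : A → List A → A} (a : A) {h : List A}
    (hm : G.MediatorMoves (G.lift ρ h)) :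
    G.lift ρ (a :: h) = .inl a :: .inr (ρ a h) :: G.lift ρ h := if_pos hm

theorem lift_cons_of_not_mediatorMoves {ρ : A → List A → A} (a : A) {h : List A}
    (hm : ¬ G.MediatorMoves (G.lift ρ h)) : G.lift ρ (a :: h) = .inl a :: G.lift ρ h := if_neg hm

@[simp] theorem base_lift (ρ : A → List A → A) : ∀ w, base (G.lift ρ w) = w
  | [] => rfl
  | a :: h => by
    by_cases hm : G.MediatorMoves (G.lift ρ h)
    · simp [lift_cons_of_mediatorMoves a hm, base, base_lift ρ h]
    · simp [lift_cons_of_not_mediatorMoves a hm, base, base_lift ρ h]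

@[simp] theorem pending_lift (ρ : A → List A → A) : ∀ w, pending (G.lift ρ w) = none
  | [] => rfl
  | a :: h => by
    by_cases hm : G.MediatorMoves (G.lift ρ h)
    · simp [lift_cons_of_mediatorMoves a hm, pending]
    · simp [lift_cons_of_not_mediatorMoves a hm, pending]

theorem mediatorMoves_lift {ρ : A → List A → A} {h : List A} :
    G.MediatorMoves (G.lift ρ h) ↔ G.turn h ≠ none ∧ (G.deviators (G.lift ρ h)).card < 2 := by
  simp [MediatorMoves]

theorem mem_deviators_lift_cons {ρ : A → List A → A} {a : A} {h : List A} {j : P} :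
    j ∈ G.deviators (G.lift ρ (a :: h)) ↔
      (G.MediatorMoves (G.lift ρ h) ∧ ρ a h ≠ a ∧ G.turn h = some j) ∨
        j ∈ G.deviators (G.lift ρ h) := by
  by_cases hm : G.MediatorMoves (G.lift ρ h)
  · rw [lift_cons_of_mediatorMoves a hm, mem_deviators_answer]
    simp [hm]
  · rw [lift_cons_of_not_mediatorMoves a hm, deviators_play a (pending_lift ρ h)]
    simp [hm]

theorem augHist_lift {ρ : A → List A → A} {w : List A} (hw : w ∈ G.hist)
    (hρ : ∀ a h, a :: h <:+ w → G.turn h ≠ none → ρ a h :: h ∈ G.hist) :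
    G.AugHist (G.lift ρ w) := by
  induction w with
  | nil => trivial
  | cons a h ih =>
    have h1 := ih (G.tail_mem a h hw) fun b g hb => hρ b g (hb.trans (List.suffix_cons a h))
    by_cases hm : G.MediatorMoves (G.lift ρ h)
    · rw [lift_cons_of_mediatorMoves a hm]
      exact ⟨⟨h1, hm, by simpa using hρ a h List.suffix_rfl (mediatorMoves_lift.1 hm).1⟩,
        not_mediatorMoves_of_pending rfl, by simpa [base] using hw⟩
    · rw [lift_cons_of_not_mediatorMoves a hm]
      exact ⟨h1, hm, by simpa using hw⟩

theorem lift_mem_terminals {ρ : A → List A → A} {w : List A} (hw : w ∈ G.terminals)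
    (hρ : ∀ a h, a :: h <:+ w → G.turn h ≠ none → ρ a h :: h ∈ G.hist) :
    G.lift ρ w ∈ (G.augment u₀ hu₀).terminals :=
  mem_terminals_augment.2 ⟨augHist_lift (mem_terminals.1 hw).1 hρ, pending_lift ρ w, by simpa⟩

end Augment

/-! ### Counting the direct sequences -/

open Classical in
/-- The recommendations heard by a player `i` who obeys on the way to the node `w` of the original
game, if recommendations stop after time `τ`. -/
def obeyHeard (G : ExtensiveGame P A I) (i : P) (τ : ℕ∞) : List A → List A
  | [] => []
  | a :: h => if G.turn h = some i ∧ (h.length : ℕ∞) ≤ τ then a :: G.obeyHeard i τ h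
      else G.obeyHeard i τ h

open Classical in
/-- The sequence in the augmented game of a player `i` who obeys on the way to the node `w` of the
original game, if recommendations stop after time `τ`. -/
def obeySeq (G : ExtensiveGame P A I) (i : P) (τ : ℕ∞) :
    List A → List ((List (A ⊕ A) ⊕ (I × Option A × List A)) × (A ⊕ A))
  | [] => []
  | a :: h => if G.turn h = some i then
      (if (h.length : ℕ∞) ≤ τ then (.inr (G.info h, some a, a :: G.obeyHeard i τ h), .inl a)
        else (.inr (G.info h, none, G.obeyHeard i τ h), .inl a)) :: G.obeySeq i τ h
      else G.obeySeq i τ h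

open Classical in
/-- The last time at which a player other than `i` disobeyed a recommendation. -/
def lastOtherDeviation (G : ExtensiveGame P A I) (i : P) : List (A ⊕ A) → ℕ∞
  | [] => ⊤
  | .inr _ :: g => G.lastOtherDeviation i g
  | .inl a :: g => if (∃ r, pending g = some r ∧ r ≠ a) ∧ G.turn (base g) ≠ some i then
      (base g).length else G.lastOtherDeviation i g

section

variable {G : ExtensiveGame P A I} {u₀ : List A → ℝ}
  {hu₀ : ∀ h ∈ G.hist, (∀ a, a :: h ∉ G.hist) → u₀ h ∈ Set.Icc (0 : ℝ) 1}

theorem obeyHeard_congr (i : P) {τ τ' : ℕ∞} :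
    ∀ h : List A, (h.length : ℕ∞) ≤ τ → (h.length : ℕ∞) ≤ τ' →
      G.obeyHeard i τ h = G.obeyHeard i τ' h
  | [], _, _ => rfl
  | a :: h, h1, h2 => by
    have hl : (h.length : ℕ∞) ≤ (a :: h).length := by simp
    have h1' := hl.trans h1
    have h2' := hl.trans h2
    rw [obeyHeard, obeyHeard, obeyHeard_congr i h h1' h2']
    congr 1
    simp [h1', h2']

theorem obeySeq_congr (i : P) {τ τ' : ℕ∞} :
    ∀ h : List A, (h.length : ℕ∞) ≤ τ → (h.length : ℕ∞) ≤ τ' →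
      G.obeySeq i τ h = G.obeySeq i τ' h
  | [], _, _ => rfl
  | a :: h, h1, h2 => by
    have hl : (h.length : ℕ∞) ≤ (a :: h).length := by simp
    have h1' := hl.trans h1
    have h2' := hl.trans h2
    simp only [obeySeq, obeySeq_congr i h h1' h2', obeyHeard_congr i h h1' h2', h1', h2']

/-- The sequence of a player who obeys is determined by the underlying node and the time at which
recommendations stop, which is a time at which some other player disobeyed. -/
theorem exists_seq_eq_obeySeq (i : P) (g : List (A ⊕ A)) (hg : G.AugHist g)
    (hp : pending g = none) (hi : i ∉ G.deviators g) :
    ∃ τ : ℕ∞, (G.augment u₀ hu₀).seq (some i) g = G.obeySeq i τ (base g) ∧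
      G.heard (some i) g = G.obeyHeard i τ (base g) ∧
      ((G.deviators g).card < 2 ∧ τ = ⊤ ∨ ¬ (G.deviators g).card < 2 ∧
        ∃ m : ℕ, τ = m ∧ m < (base g).length ∧ ∃ a b h k, a :: h <:+ base g ∧ h.length = m ∧
          G.turn h = some k ∧ k ≠ i ∧ b ≠ a ∧ b :: h ∈ G.hist) := by
  revert hi
  refine augHist_induction (motive := fun g => i ∉ G.deviators g →
    ∃ τ : ℕ∞, (G.augment u₀ hu₀).seq (some i) g = G.obeySeq i τ (base g) ∧
      G.heard (some i) g = G.obeyHeard i τ (base g) ∧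
      ((G.deviators g).card < 2 ∧ τ = ⊤ ∨ ¬ (G.deviators g).card < 2 ∧
        ∃ m : ℕ, τ = m ∧ m < (base g).length ∧ ∃ a b h k, a :: h <:+ base g ∧ h.length = m ∧
          G.turn h = some k ∧ k ≠ i ∧ b ≠ a ∧ b :: h ∈ G.hist)) ?_ ?_ ?_ g hg hp
  · exact fun _ => ⟨⊤, rfl, rfl, .inl ⟨by simp [deviators], rfl⟩⟩
  · intro a g hg hp hm ha ih hi
    rw [deviators_play a hp] at hi ⊢
    obtain ⟨τ, h1, h2, h3⟩ := ih hi
    have hlen : (base (.inl a :: g)).length = (base g).length + 1 := by simp [base]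
    have h3' : (G.deviators g).card < 2 ∧ τ = ⊤ ∨ ¬ (G.deviators g).card < 2 ∧
        ∃ m : ℕ, τ = m ∧ m < (base (.inl a :: g)).length ∧
          ∃ b c h k, b :: h <:+ base (.inl a :: g) ∧ h.length = m ∧
          G.turn h = some k ∧ k ≠ i ∧ c ≠ b ∧ c :: h ∈ G.hist := by
      refine h3.imp_right fun ⟨hc, m, hτ, hml, b, c, h, k, hs, hr⟩ => ?_
      exact ⟨hc, m, hτ, by omega, b, c, h, k, hs.trans (List.suffix_cons a _), hr⟩
    refine ⟨τ, ?_, ?_, h3'⟩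
    · rw [seq_augment_play i a hm, base, obeySeq, h1, h2]
      split_ifs with ht hτ
      -- Here `i` moves without a recommendation although the cutoff `τ` has not passed. With fewer
      -- than two disobedient players the mediator would have moved; otherwise the cutoff lies
      -- strictly before this node.
      · exfalso
        rcases h3 with h3 | ⟨-, m, rfl, hml, -⟩
        · exact hm ⟨hp, by simp [ht], h3.1⟩
        · exact absurd (by exact_mod_cast hτ) (not_le.2 hml)
      · rw [hp]
      · rfl
    · rw [heard, base, obeyHeard, h2, if_neg]
      rintro ⟨ht, hτ⟩
      rcases h3 with h3 | ⟨-, m, rfl, hml, -⟩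
      · exact hm ⟨hp, by simp [ht], h3.1⟩
      · exact absurd (by exact_mod_cast hτ) (not_le.2 hml)
  · intro a r g hg hm hr ha ih hi
    rw [mem_deviators_answer, not_or] at hi
    obtain ⟨τ, h1, h2, h3⟩ := ih hi.2
    have hτ : τ = ⊤ := by
      rcases h3 with h3 | h3
      · exact h3.2
      · exact absurd hm.2.2 h3.1
    subst hτ
    have key : ∀ τ : ℕ∞, ((base g).length : ℕ∞) ≤ τ →
        (G.augment u₀ hu₀).seq (some i) (.inl a :: .inr r :: g)
          = G.obeySeq i τ (base (.inl a :: .inr r :: g)) ∧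
        G.heard (some i) (.inl a :: .inr r :: g)
          = G.obeyHeard i τ (base (.inl a :: .inr r :: g)) := by
      intro τ hτ
      rw [seq_augment_answer i a r hm, heard, heard, base, base, obeySeq, obeyHeard, h1, h2,
        obeySeq_congr i _ le_top hτ, obeyHeard_congr i _ le_top hτ]
      by_cases ht : G.turn (base g) = some i
      · have hra : r = a := by
          by_contra hne
          exact hi.1 ⟨hne, ht⟩
        simp [ht, hτ, hra]
      · simp [ht]
    -- If this answer creates the second disobedient player, recommendations stop after it, and the
    -- cutoff is the length of the current node. The inequality `≤ τ` in `obeySeq` still counts the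
    -- recommendation just given.
    by_cases hc : (G.deviators (.inl a :: .inr r :: g)).card < 2
    · exact ⟨⊤, (key ⊤ le_top).1, (key ⊤ le_top).2, .inl ⟨hc, rfl⟩⟩
    · refine ⟨(base g).length, (key _ le_rfl).1, (key _ le_rfl).2,
        .inr ⟨hc, _, rfl, by simp [base], ?_⟩⟩
      obtain ⟨k, hk⟩ := Option.ne_none_iff_exists'.1 hm.2.1
      have hra : r ≠ a := by
        rintro rfl
        apply hc
        have : G.deviators (.inl r :: .inr r :: g) = G.deviators g := by
          ext j
          simp [mem_deviators_answer]
        rw [this]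
        exact hm.2.2
      refine ⟨a, r, base g, k, List.suffix_rfl, rfl, hk, ?_, hra, hr⟩
      rintro rfl
      exact hi.1 ⟨hra, hk⟩

theorem lastOtherDeviation_lift_cons {ρ : A → List A → A} {i : P} {a : A} {h : List A} :
    open Classical in
    G.lastOtherDeviation i (G.lift ρ (a :: h)) =
      if G.MediatorMoves (G.lift ρ h) ∧ ρ a h ≠ a ∧ G.turn h ≠ some i then (h.length : ℕ∞)
      else G.lastOtherDeviation i (G.lift ρ h) := by
  classical
  by_cases hm : G.MediatorMoves (G.lift ρ h)
  · rw [lift_cons_of_mediatorMoves a hm, lastOtherDeviation]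
    simp [pending, hm, base, lastOtherDeviation]
  · rw [lift_cons_of_not_mediatorMoves a hm, lastOtherDeviation]
    simp [hm]

/-- A node at which exactly the players moving at times `e` and `m` have disobeyed. -/
theorem deviators_lift_of_two_flips {i : P} {k : Option P} (hk : k ≠ some i) {w : List A} {e : ℕ} {m : ℕ∞}
    {be bm : A}
    (hw : ∀ a h, a :: h <:+ w → (h.length = e → G.turn h = some i ∧ be ≠ a) ∧
      ((h.length : ℕ∞) = m → G.turn h = k ∧ k ≠ none ∧ bm ≠ a))
    (ρ : A → List A → A)
    (hρ : ∀ a h, (h.length = e → ρ a h = be) ∧ (h.length ≠ e → (h.length : ℕ∞) = m → ρ a h = bm) ∧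
      (h.length ≠ e → (h.length : ℕ∞) ≠ m → ρ a h = a)) :
    (∀ j, j ∈ G.deviators (G.lift ρ w) ↔ (j = i ∧ e < w.length) ∨ (some j = k ∧ m < w.length)) ∧
      (m < w.length → G.lastOtherDeviation i (G.lift ρ w) = m) ∧
      (¬ m < w.length → G.lastOtherDeviation i (G.lift ρ w) = ⊤) := by
  induction w with
  | nil => simp [lift, deviators, lastOtherDeviation]
  | cons a h ih =>
    obtain ⟨ih1, ih2, ih3⟩ := ih fun b g hb => hw b g (hb.trans (List.suffix_cons a h))
    obtain ⟨hwe, hwm⟩ := hw a h List.suffix_rfl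
    obtain ⟨hρe, hρm, hρa⟩ := hρ a h
    have hlt : m < ((a :: h).length : ℕ∞) ↔ m < h.length ∨ (h.length : ℕ∞) = m := by
      rw [List.length_cons, Nat.cast_add, Nat.cast_one, ENat.lt_natCast_add_one_iff, le_iff_lt_or_eq,
        eq_comm (a := m)]
    have hlte : e < (a :: h).length ↔ e < h.length ∨ h.length = e := by
      rw [List.length_cons]; omega
    -- Before either of the two times at most one player has disobeyed, so the mediator still speaks
    -- there and a changed recommendation does count as disobedience.
    have hcard : ∀ x, (∀ j, j ∈ G.deviators (G.lift ρ h) → some j = x) →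
        (G.deviators (G.lift ρ h)).card < 2 := fun x hx =>
      (Finset.card_le_one.2 fun p hp q hq =>
        Option.some.inj ((hx p hp).trans (hx q hq).symm)).trans_lt one_lt_two
    simp only [mem_deviators_lift_cons, lastOtherDeviation_lift_cons]
    by_cases he : h.length = e
    · subst he
      obtain ⟨ht, hbe⟩ := hwe rfl
      have hm : (h.length : ℕ∞) ≠ m := fun hm => by
        exact hk ((hwm hm).1.symm.trans ht)
      have hmm : G.MediatorMoves (G.lift ρ h) := mediatorMoves_lift.2
        ⟨by simp [ht], hcard k fun j hj => by
          rcases (ih1 j).1 hj with h | h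
          · exact absurd h.2 (lt_irrefl _)
          · exact h.1⟩
      simp only [hlt, hm, or_false, ih1, hlte, or_true, and_true, ht, hmm, hρe rfl,
        ne_eq, not_true, and_false, if_false, true_and, lt_irrefl, false_or]
      refine ⟨fun j => ?_, ih2, ih3⟩
      simp [hbe, eq_comm]
    · by_cases hm : (h.length : ℕ∞) = m
      · obtain ⟨ht, hk0, hbm⟩ := hwm hm
        have hmm : G.MediatorMoves (G.lift ρ h) := mediatorMoves_lift.2
          ⟨by rwa [ht], hcard (some i) fun j hj => by
            rcases (ih1 j).1 hj with h | h
            · rw [h.1]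
            · rw [hm] at h
              exact absurd h.2 (lt_irrefl _)⟩
        simp only [hlt, hm, or_true, ih1, hlte, he, or_false, hmm, hρm he hm, ht, true_and,
          not_true, false_imp_iff, and_true]
        refine ⟨fun j => ?_, fun _ => ?_⟩
        · simp [hbm, eq_comm, or_comm]
        · rw [if_pos ⟨hmm, by rwa [hρm he hm], by rwa [ht]⟩]
      · simp only [hlt, hm, or_false, ih1, hlte, he, hρa he hm, ne_eq, not_true, false_and,
          and_false, if_false, false_or, implies_true, true_and]
        exact ⟨ih2, ih3⟩

theorem cons_eq_of_suffix_of_length_eq {B : Type*} {a b : B} {g h w : List B} (hg : a :: g <:+ w)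
    (hh : b :: h <:+ w) (hl : g.length = h.length) : a = b ∧ g = h := by
  have := (List.suffix_of_suffix_length_le hg hh (by simp [hl])).eq_of_length (by simp [hl])
  simpa using this

/-- The encoding behind the count. Keep the actions on the path to `z` but change the
recommendations: where `y` first departs from the path, recommend what `y` would play, so that `i`
disobeys; at the cutoff time of `z`, if there is one, recommend another legal action, so that the
other player disobeys; everywhere else recommend the action played. The new leaf retains the
underlying node and the cutoff, and these determine the sequence of the obedient `i` at `z`. -/
theorem exists_leaf_mem_deviators {i : P}
    {s y : List (A ⊕ A) ⊕ (I × Option A × List A) → A ⊕ A} (hs : G.IsDirect u₀ hu₀ i s)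
    (hy : (G.augment u₀ hu₀).IsPure (some i) y) {z : List (A ⊕ A)}
    (hz : z ∈ (G.augment u₀ hu₀).terminals)
    (hsz : (G.augment u₀ hu₀).Follows (some i) s z)
    (hyz : ¬ (G.augment u₀ hu₀).Follows (some i) y z) :
    ∃ z' ∈ (G.augment u₀ hu₀).terminals, i ∈ G.deviators z' ∧
      G.obeySeq i (G.lastOtherDeviation i z') (base z') = (G.augment u₀ hu₀).seq (some i) z := by
  obtain ⟨hz1, hz2, hz3⟩ := mem_terminals_augment.1 hz
  obtain ⟨τ, hseq, -, hτ⟩ := exists_seq_eq_obeySeq (u₀ := u₀) (hu₀ := hu₀) i z hz1 hz2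
    (notMem_deviators_of_follows hs z hz1 hz2 hsz)
  obtain ⟨l, g, hlg, ht, hne, -⟩ := (G.augment u₀ hu₀).exists_first_departure hyz
  have hlg' : G.AugHist (l :: g) := (G.augment u₀ hu₀).mem_hist_of_suffix hlg hz1
  have hg : G.AugHist g := (G.augment u₀ hu₀).tail_mem l g hlg'
  have hyg : G.AugHist (y (G.augInfo g) :: g) := hy g hg ⟨l, hlg'⟩ ht
  obtain ⟨hm, hti⟩ := augTurn_eq_player_iff.1 ht
  change y (G.augInfo g) ≠ l at hne
  obtain ⟨a, rfl⟩ : ∃ a, l = .inl a := by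
    rcases l with a | r
    · exact ⟨a, rfl⟩
    · exact absurd hlg'.2.1 hm
  obtain ⟨b, hb⟩ : ∃ b, y (G.augInfo g) = .inl b := by
    rcases hyl : y (G.augInfo g) with b | r
    · exact ⟨b, rfl⟩
    · rw [hyl] at hyg
      exact absurd hyg.2.1 hm
  rw [hb] at hyg hne
  have hba : b ≠ a := fun h => hne (by rw [h])
  have hsuf : a :: base g <:+ base z := base_suffix hlg
  have hbg : b :: base g ∈ G.hist := hyg.2.2
  -- If recommendations never stop on the way to `z`, the cutoff is `⊤`, no node has that length,
  -- and the values `none` and `b` are placeholders.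
  obtain ⟨k, hk, bm, hbm⟩ : ∃ k : Option P, k ≠ some i ∧ ∃ bm, ∀ a h, a :: h <:+ base z →
      (h.length : ℕ∞) = τ → (G.turn h = k ∧ k ≠ none ∧ bm ≠ a) ∧ bm :: h ∈ G.hist := by
    rcases hτ with ⟨-, rfl⟩ | ⟨-, m, rfl, -, a', b', h', k, h1, h2, h3, h4, h5, h6⟩
    · exact ⟨none, by simp, b, fun a h _ hc => absurd hc (by simp)⟩
    · refine ⟨some k, by simpa using h4, b', fun a h hsuf hl => ?_⟩
      obtain ⟨rfl, rfl⟩ := cons_eq_of_suffix_of_length_eq hsuf h1 (by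
        rw [h2]
        exact_mod_cast hl)
      exact ⟨⟨h3, by simp, h5⟩, h6⟩
  have hbe : ∀ a' h, a' :: h <:+ base z → h.length = (base g).length →
      (G.turn h = some i ∧ b ≠ a') ∧ b :: h ∈ G.hist := by
    intro a' h hh hl
    obtain ⟨rfl, rfl⟩ := cons_eq_of_suffix_of_length_eq hh hsuf hl
    exact ⟨⟨hti, hba⟩, hbg⟩
  classical
  set ρ : A → List A → A := fun a h => if h.length = (base g).length then b
    else if (h.length : ℕ∞) = τ then bm else a with hρ
  have hρ' : ∀ a h, (h.length = (base g).length → ρ a h = b) ∧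
      (h.length ≠ (base g).length → (h.length : ℕ∞) = τ → ρ a h = bm) ∧
      (h.length ≠ (base g).length → (h.length : ℕ∞) ≠ τ → ρ a h = a) := fun a h =>
    ⟨fun h1 => if_pos h1, fun h1 h2 => (if_neg h1).trans (if_pos h2),
      fun h1 h2 => (if_neg h1).trans (if_neg h2)⟩
  obtain ⟨k1, k2, k3⟩ := deviators_lift_of_two_flips hk
    (fun a h hh => ⟨fun hl => (hbe a h hh hl).1, fun hl => (hbm a h hh hl).1⟩) ρ hρ'
  refine ⟨G.lift ρ (base z), lift_mem_terminals hz3 fun a' h hh _ => ?_, ?_, ?_⟩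
  · by_cases h1 : h.length = (base g).length
    · rw [(hρ' a' h).1 h1]
      exact (hbe a' h hh h1).2
    · by_cases h2 : (h.length : ℕ∞) = τ
      · rw [(hρ' a' h).2.1 h1 h2]
        exact (hbm a' h hh h2).2
      · rw [(hρ' a' h).2.2 h1 h2]
        exact G.mem_hist_of_suffix hh hz1.base_mem
  · refine (k1 i).2 (.inl ⟨rfl, ?_⟩)
    have := hsuf.length_le
    simp only [List.length_cons] at this
    omega
  · rw [base_lift, hseq]
    congr 1
    rcases hτ with ⟨-, rfl⟩ | ⟨-, m, rfl, hm, -⟩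
    · exact k3 (by simp)
    · exact k2 (by exact_mod_cast hm)

open Classical in
-- By linearity it suffices to treat pure `y`, whose loss is the number of sequences of `s` that `y`
-- misses. Each of them can be recovered from a leaf at which `i` has disobeyed.
theorem directLoss_le_card_deviating {i : P}
    {s : List (A ⊕ A) ⊕ (I × Option A × List A) → A ⊕ A} (hs : G.IsDirect u₀ hu₀ i s)
    {x : (G.augment u₀ hu₀).Seq (some i) → ℝ} (hx : x ∈ (G.augment u₀ hu₀).strategies (some i)) :
    (G.augment u₀ hu₀).directLoss (some i) ((G.augment u₀ hu₀).seqForm (some i) s) x ≤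
      ((G.augment u₀ hu₀).terminals.filter fun z => i ∈ G.deviators z).card := by
  set M := G.augment u₀ hu₀ with hM
  set W := M.terminals.filter fun z => i ∈ G.deviators z with hW
  set d := M.seqForm (some i) s with hd
  have hpure : ∀ y, M.IsPure (some i) y → M.directLoss (some i) d (M.seqForm (some i) y) ≤
      (W.card : ℝ) := by
    intro y hy
    set T : Finset (M.Seq (some i)) := Finset.univ.filter fun σ =>
      (∀ p ∈ σ.1, s p.1 = p.2) ∧ ¬ ∀ p ∈ σ.1, y p.1 = p.2 with hT
    have h1 : M.directLoss (some i) d (M.seqForm (some i) y) = (T.card : ℝ) := by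
      rw [hT, Finset.card_filter, directLoss]
      push_cast
      refine Finset.sum_congr rfl fun σ _ => ?_
      simp only [hd, seqForm]
      split_ifs <;> first | (exfalso; tauto) | simp
    rw [h1]
    have h2 : T.image Subtype.val ⊆
        W.image fun z => G.obeySeq i (G.lastOtherDeviation i z) (base z) := by
      intro σ hσ
      obtain ⟨σ, hσT, rfl⟩ := Finset.mem_image.1 hσ
      obtain ⟨z, rfl⟩ := M.leafSeq_surjective (some i) σ
      simp only [hT, Finset.mem_filter, Finset.mem_univ, true_and] at hσT
      obtain ⟨z', h1, h2, h3⟩ := exists_leaf_mem_deviators hs hy z.2 hσT.1 hσT.2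
      exact Finset.mem_image.2 ⟨z', Finset.mem_filter.2 ⟨h1, h2⟩, h3⟩
    have h3 := (Finset.card_le_card h2).trans Finset.card_image_le
    rw [Finset.card_image_of_injective _ Subtype.val_injective] at h3
    exact_mod_cast h3
  have := M.strategies_le_of_pure (-∑ σ, d σ • (LinearMap.proj σ : (M.Seq (some i) → ℝ) →ₗ[ℝ] ℝ))
    (W.card - ∑ σ, d σ * d σ) (fun y hy => ?_) hx
  · simp only [LinearMap.neg_apply, LinearMap.sum_apply, LinearMap.smul_apply,
      LinearMap.proj_apply, smul_eq_mul] at this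
    rw [directLoss_eq]
    linarith
  · have := hpure y hy
    rw [directLoss_eq] at this
    simp only [LinearMap.neg_apply, LinearMap.sum_apply, LinearMap.smul_apply,
      LinearMap.proj_apply, smul_eq_mul]
    linarith

/-- The direct strategies of all players together have few terminal sequences that can be missed. -/
theorem sum_directLoss_le [Fintype P]
    {s : P → List (A ⊕ A) ⊕ (I × Option A × List A) → A ⊕ A} (hs : ∀ i, G.IsDirect u₀ hu₀ i (s i))
    {x : ∀ i : P, (G.augment u₀ hu₀).Seq (some i) → ℝ}
    (hx : ∀ i, x i ∈ (G.augment u₀ hu₀).strategies (some i)) :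
    ∑ i, (G.augment u₀ hu₀).directLoss (some i) ((G.augment u₀ hu₀).seqForm (some i) (s i)) (x i)
      ≤ 2 * (((G.augment u₀ hu₀).terminals.card : ℝ) - 1) := by
  classical
  set M := G.augment u₀ hu₀ with hM
  refine (Finset.sum_le_sum fun i _ => directLoss_le_card_deviating (hs i) (hx i)).trans ?_
  obtain ⟨w, hw⟩ := G.terminals_nonempty
  -- Recommending every action that is then played gives a leaf without disobedience; it accounts
  -- for the `- 1`.
  set z₀ := G.lift (fun a _ => a) w with hz₀
  have h0 : z₀ ∈ M.terminals := lift_mem_terminals hw fun a h hh _ =>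
    G.mem_hist_of_suffix hh (mem_terminals.1 hw).1
  have hdev : ∀ w, G.deviators (G.lift (fun a _ => a) w) = ∅ := by
    intro w
    induction w with
    | nil => simp [lift, deviators]
    | cons a h ih =>
      ext j
      simp [mem_deviators_lift_cons, ih]
  have h1 : ∑ i, (M.terminals.filter fun z => i ∈ G.deviators z).card
      = ∑ z ∈ M.terminals, (G.deviators z).card := by
    simp only [Finset.card_filter]
    rw [Finset.sum_comm]
    refine Finset.sum_congr rfl fun z _ => ?_
    rw [← Finset.card_filter, Finset.filter_mem_eq_inter, Finset.univ_inter]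
  have h2 : ∑ z ∈ M.terminals, (G.deviators z).card ≤ 2 * (M.terminals.card - 1) := by
    rw [← Finset.add_sum_erase _ _ h0, hz₀, hdev, Finset.card_empty, zero_add, ← hz₀,
      ← Finset.card_erase_of_mem h0, mul_comm, ← smul_eq_mul]
    refine Finset.sum_le_card_nsmul _ _ _ fun z hz => ?_
    obtain ⟨h1, h2, -⟩ := mem_terminals_augment.1 (Finset.mem_of_mem_erase hz)
    exact card_deviators_le z h1 h2
  have h3 : 1 ≤ M.terminals.card := Finset.card_pos.2 ⟨z₀, h0⟩
  calc ∑ i, ((M.terminals.filter fun z => i ∈ G.deviators z).card : ℝ)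
      = ((∑ z ∈ M.terminals, (G.deviators z).card : ℕ) : ℝ) := by rw [← h1]; push_cast; rfl
    _ ≤ ((2 * (M.terminals.card - 1) : ℕ) : ℝ) := by exact_mod_cast h2
    _ = 2 * ((M.terminals.card : ℝ) - 1) := by push_cast [Nat.cast_sub h3]; ring

end

end ExtensiveGame

/-! ### Correlated deviations -/

/-- A finite family of weighted self-maps has a stationary distribution. -/
theorem exists_stationary_distribution {S K : Type*} [Fintype S] [Nonempty S] [Fintype K]
    (c : K → ℝ) (hc : ∀ k, 0 ≤ c k) (φ : K → S → S) :
    ∃ p : S → ℝ, (∀ s, 0 ≤ p s) ∧ ∑ s, p s = 1 ∧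
      ∀ F : S → ℝ, ∑ s, p s * ∑ k, c k * (F (φ k s) - F s) = 0 := by
  classical
  set L : S → S → ℝ := fun q s => ∑ k, c k * ((if φ k s = q then 1 else 0) - if s = q then 1 else 0)
    with hL
  have key : ∀ (F : S → ℝ) s, ∑ q, F q * L q s = ∑ k, c k * (F (φ k s) - F s) := by
    intro F s
    simp only [hL, Finset.mul_sum]
    rw [Finset.sum_comm]
    refine Finset.sum_congr rfl fun k _ => ?_
    have : ∀ q, F q * (c k * ((if φ k s = q then (1 : ℝ) else 0) - if s = q then 1 else 0))
        = c k * ((if φ k s = q then F q else 0) - if s = q then F q else 0) := by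
      intro q
      split_ifs <;> ring
    simp only [this]
    rw [← Finset.mul_sum, Finset.sum_sub_distrib]
    simp
  -- `L q s` is the net rate of flow from `s` into `q`. The first alternative is a distribution with
  -- nonpositive net inflow at every point; these inflows sum to zero, so each vanishes. The second
  -- alternative fails at a point `s` where `y` is maximal, since no map can increase `y` there.
  rcases exists_stdSimplex_le_zero_or_exists_pos L with ⟨p, hp, hp1, hpL⟩ | ⟨y, -, hyL⟩
  · refine ⟨p, hp, hp1, fun F => ?_⟩
    have h0 : ∑ q, ∑ s, p s * L q s = 0 := by
      rw [Finset.sum_comm]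
      refine Finset.sum_eq_zero fun s _ => ?_
      rw [← Finset.mul_sum]
      have := key (fun _ => 1) s
      simp only [one_mul, sub_self, mul_zero, Finset.sum_const_zero] at this
      rw [this, mul_zero]
    have h1 := (Finset.sum_eq_zero_iff_of_nonpos fun q _ => hpL q).1 h0
    have h2 : ∑ q, F q * ∑ s, p s * L q s = 0 :=
      Finset.sum_eq_zero fun q hq => by rw [h1 q hq, mul_zero]
    rw [← h2]
    simp only [Finset.mul_sum, ← key]
    rw [Finset.sum_comm]
    exact Finset.sum_congr rfl fun q _ => Finset.sum_congr rfl fun s _ => by ring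
  · exfalso
    obtain ⟨s, -, hs⟩ := Finset.exists_max_image Finset.univ y Finset.univ_nonempty
    have := hyL s
    rw [key y s] at this
    refine absurd this (not_lt.2 (Finset.sum_nonpos fun k _ => ?_))
    exact mul_nonpos_of_nonneg_of_nonpos (hc k) (sub_nonpos.2 (hs _ (Finset.mem_univ _)))

/-- For given weights on finitely many deviation maps of the players, there is a product
distribution under which the weighted gains from deviating cancel (Hart and Schmeidler). -/
theorem exists_distribution_sum_gain_eq_zero {P : Type*} [Fintype P] [DecidableEq P]
    {S K : P → Type*} [∀ i, Fintype (S i)] [∀ i, Nonempty (S i)] [∀ i, Fintype (K i)]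
    (c : ∀ i, K i → ℝ) (hc : ∀ i k, 0 ≤ c i k) (φ : ∀ i, K i → S i → S i)
    (U : P → (∀ i, S i) → ℝ) :
    ∃ p : (∀ i, S i) → ℝ, (∀ σ, 0 ≤ p σ) ∧ ∑ σ, p σ = 1 ∧
      ∑ σ, p σ * ∑ i, ∑ k, c i k * (U i (Function.update σ i (φ i k (σ i))) - U i σ) = 0 := by
  choose π hπ hπ1 hπF using fun i => exists_stationary_distribution (c i) (hc i) (φ i)
  refine ⟨fun σ => ∏ i, π i (σ i), fun σ => Finset.prod_nonneg fun i _ => hπ i _, ?_, ?_⟩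
  · rw [← Fintype.prod_sum]
    simp [hπ1]
  -- Under a product distribution, coordinate `i` may be redrawn independently. The proof swaps
  -- coordinate `i` with the fresh draw, an involution that preserves the weights. Conditionally on
  -- the other coordinates, stationarity of `π i` then annihilates the gains of player `i`.
  have resample : ∀ i (H : (∀ i, S i) → ℝ), ∑ σ, (∏ j, π j (σ j)) * H σ
      = ∑ σ, (∏ j, π j (σ j)) * ∑ s, π i s * H (Function.update σ i s) := by
    intro i H
    set e : (∀ i, S i) × S i → (∀ i, S i) × S i := fun q => (Function.update q.1 i q.2, q.1 i)
      with he
    have hinv : Function.Involutive e := by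
      rintro ⟨σ, s⟩
      simp [he]
    have hw : ∀ q, (∏ j, π j ((e q).1 j)) * π i (e q).2 = (∏ j, π j (q.1 j)) * π i q.2 := by
      rintro ⟨σ, s⟩
      simp only [he]
      rw [← Finset.mul_prod_erase _ _ (Finset.mem_univ i),
        ← Finset.mul_prod_erase _ (fun j => π j (σ j)) (Finset.mem_univ i), Function.update_self]
      have : ∏ j ∈ Finset.univ.erase i, π j (Function.update σ i s j)
          = ∏ j ∈ Finset.univ.erase i, π j (σ j) := Finset.prod_congr rfl fun j hj => by
        rw [Function.update_of_ne (Finset.ne_of_mem_erase hj)]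
      rw [this]
      ring
    calc ∑ σ, (∏ j, π j (σ j)) * H σ
        = ∑ σ, ∑ s, (∏ j, π j (σ j)) * π i s * H σ := by
          refine Finset.sum_congr rfl fun σ _ => ?_
          rw [← Finset.sum_mul, ← Finset.mul_sum, hπ1, mul_one]
      _ = ∑ q : (∀ i, S i) × S i, (∏ j, π j (q.1 j)) * π i q.2 * H q.1 :=
          by rw [Fintype.sum_prod_type]
      _ = ∑ q : (∀ i, S i) × S i, (∏ j, π j (q.1 j)) * π i q.2 * H (Function.update q.1 i q.2) :=
          (Fintype.sum_bijective e hinv.bijective _ _ fun q => by rw [hw]).symm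
      _ = ∑ σ, ∑ s, (∏ j, π j (σ j)) * π i s * H (Function.update σ i s) :=
          by rw [Fintype.sum_prod_type]
      _ = _ := by
          refine Finset.sum_congr rfl fun σ _ => ?_
          rw [Finset.mul_sum]
          exact Finset.sum_congr rfl fun s _ => by ring
  simp only [Finset.mul_sum]
  rw [Finset.sum_comm]
  refine Finset.sum_eq_zero fun i _ => ?_
  simp only [← Finset.mul_sum]
  rw [resample i]
  refine Finset.sum_eq_zero fun σ _ => ?_
  have := hπF i fun s => U i (Function.update σ i s)
  simp only [Function.update_self, Function.update_idem]
  rw [this, mul_zero]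

namespace ExtensiveGame

variable {P A I : Type*} [Fintype A]

/-! ### Recommending a profile of pure strategies -/

/-- The action that the profile `σ` prescribes at the node `h`, and `a` if `h` is a chance node. -/
def prescribed (G : ExtensiveGame P A I) (σ : P → I → A) (a : A) (h : List A) : A :=
  (G.turn h).elim a fun j => σ j (G.info h)

/-- The pure strategy of the mediator that recommends the actions prescribed by `σ`. -/
def recommend [Nonempty A] (G : ExtensiveGame P A I) (σ : P → I → A) :
    List (A ⊕ A) ⊕ (I × Option A × List A) → A ⊕ A :=
  Sum.elim (fun g => .inr (G.prescribed σ (Classical.arbitrary A) (base g)))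
    fun _ => .inr (Classical.arbitrary A)

open Classical in
/-- The pure strategy of `i` in the original game that results from playing `s` in the augmented
game when the recommendations follow `f`. -/
def respond (G : ExtensiveGame P A I) (i : P)
    (s : List (A ⊕ A) ⊕ (I × Option A × List A) → A ⊕ A) (f : I → A) (c : I) : A :=
  if hc : ∃ h ∈ G.hist, (∃ a, a :: h ∈ G.hist) ∧ G.turn h = some i ∧ G.info h = c then
    (s (.inr (c, some (f c), f c :: (G.seq i hc.choose).map fun p => f p.1))).elim id id
  else f c

open Classical in
/-- The expected utility under a profile of pure strategies. -/
def pureUtility (G : ExtensiveGame P A I) (i : P) (τ : P → I → A) : ℝ :=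
  ∑ w ∈ G.terminals, G.chanceReach w * (if ∀ j, G.Follows j (τ j) w then 1 else 0) * G.utility i w

section

variable {G : ExtensiveGame P A I} {u₀ : List A → ℝ}
  {hu₀ : ∀ h ∈ G.hist, (∀ a, a :: h ∉ G.hist) → u₀ h ∈ Set.Icc (0 : ℝ) 1}

theorem prescribed_of_turn {σ : P → I → A} {h : List A} {j : P} (hj : G.turn h = some j) (a : A) :
    G.prescribed σ a h = σ j (G.info h) := by
  simp [prescribed, hj]

theorem prescribed_mem {σ : P → I → A} (hσ : ∀ j, G.IsPure j (σ j)) {a : A} {h : List A}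
    (hne : ∃ a, a :: h ∈ G.hist) (ht : G.turn h ≠ none) : G.prescribed σ a h :: h ∈ G.hist := by
  obtain ⟨j, hj⟩ := Option.ne_none_iff_exists'.1 ht
  obtain ⟨b, hb⟩ := hne
  rw [prescribed_of_turn hj]
  exact hσ j h (G.tail_mem b h hb) ⟨b, hb⟩ hj

theorem recommend_isPure [Nonempty A] {σ : P → I → A} (hσ : ∀ j, G.IsPure j (σ j)) :
    (G.augment u₀ hu₀).IsPure none (G.recommend σ) := by
  rintro g hg ⟨l, hl⟩ ht
  have hm : G.MediatorMoves g := augTurn_eq_mediator_iff.1 ht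
  change G.AugHist (G.recommend σ (G.augInfo g) :: g)
  rw [augInfo_of_mediatorMoves hm]
  rcases l with a | r
  · exact absurd hm hl.2.1
  · exact ⟨hg, hm, prescribed_mem hσ ⟨r, hl.2.2⟩ hm.2.1⟩

theorem follows_recommend_play [Nonempty A] {σ : P → I → A} {a : A} {g : List (A ⊕ A)}
    (hm : ¬ G.MediatorMoves g) :
    (G.augment u₀ hu₀).Follows none (G.recommend σ) (.inl a :: g) ↔
      (G.augment u₀ hu₀).Follows none (G.recommend σ) g := by
  rw [follows_cons]
  exact and_iff_left fun ht => absurd (augTurn_eq_mediator_iff.1 ht) hm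

theorem follows_recommend_answer [Nonempty A] {σ : P → I → A} {a r : A} {g : List (A ⊕ A)}
    (hm : G.MediatorMoves g) :
    (G.augment u₀ hu₀).Follows none (G.recommend σ) (.inl a :: .inr r :: g) ↔
      (G.augment u₀ hu₀).Follows none (G.recommend σ) g ∧ G.prescribed σ a (base g) = r := by
  rw [follows_recommend_play (not_mediatorMoves_of_pending rfl), follows_cons]
  refine and_congr_right fun _ => ?_
  change (G.augTurn g = some none → G.recommend σ (G.augInfo g) = _) ↔ _
  obtain ⟨j, hj⟩ := Option.ne_none_iff_exists'.1 hm.2.1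
  rw [augInfo_of_mediatorMoves hm, augTurn_of_mediatorMoves hm, prescribed_of_turn hj]
  simp [recommend, prescribed_of_turn hj]

theorem follows_recommend_lift [Nonempty A] (σ : P → I → A) (w : List A) :
    (G.augment u₀ hu₀).Follows none (G.recommend σ) (G.lift (G.prescribed σ) w) := by
  induction w with
  | nil => exact follows_nil _ _ _
  | cons a h ih =>
    by_cases hm : G.MediatorMoves (G.lift (G.prescribed σ) h)
    · rw [lift_cons_of_mediatorMoves a hm, follows_recommend_answer hm, base_lift]
      exact ⟨ih, rfl⟩
    · rwa [lift_cons_of_not_mediatorMoves a hm, follows_recommend_play hm]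

theorem eq_lift_of_follows_recommend [Nonempty A] {σ : P → I → A} (g : List (A ⊕ A))
    (hg : G.AugHist g) (hp : pending g = none)
    (hf : (G.augment u₀ hu₀).Follows none (G.recommend σ) g) :
    g = G.lift (G.prescribed σ) (base g) := by
  revert hf
  refine augHist_induction (motive := fun g =>
    (G.augment u₀ hu₀).Follows none (G.recommend σ) g → g = G.lift (G.prescribed σ) (base g))
    (fun _ => rfl) ?_ ?_ g hg hp
  · intro a g hg hp hm ha ih hf
    have := ih ((follows_recommend_play hm).1 hf)
    have hm' := hm
    rw [this] at hm'
    rw [base, lift_cons_of_not_mediatorMoves a hm', ← this]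
  · intro a r g hg hm hr ha ih hf
    obtain ⟨hf1, hf2⟩ := (follows_recommend_answer hm).1 hf
    have := ih hf1
    have hm' := hm
    rw [this] at hm'
    rw [base, base, lift_cons_of_mediatorMoves a hm', ← this, hf2]

theorem chanceReach_lift (ρ : A → List A → A) :
    ∀ w, (G.augment u₀ hu₀).chanceReach (G.lift ρ w) = G.chanceReach w
  | [] => rfl
  | a :: h => by
    have ih := chanceReach_lift ρ h
    by_cases hm : G.MediatorMoves (G.lift ρ h)
    · have h1 : (G.augment u₀ hu₀).turn (.inr (ρ a h) :: G.lift ρ h) ≠ none := by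
        change G.augTurn _ ≠ none
        rw [augTurn_of_not_mediatorMoves (not_mediatorMoves_of_pending rfl)]
        simpa [base] using (mediatorMoves_lift.1 hm).1
      have h2 : (G.augment u₀ hu₀).turn (G.lift ρ h) ≠ none := by
        change G.augTurn _ ≠ none
        rw [augTurn_of_mediatorMoves hm]
        simp
      rw [lift_cons_of_mediatorMoves a hm, chanceReach, chanceReach, if_neg h1, if_neg h2, ih,
        chanceReach, if_neg (mediatorMoves_lift.1 hm).1, one_mul]
    · rw [lift_cons_of_not_mediatorMoves a hm, chanceReach, chanceReach, ih]
      by_cases ht : G.turn h = none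
      · have h1 : (G.augment u₀ hu₀).turn (G.lift ρ h) = none := by
          change G.augTurn _ = none
          rw [augTurn_of_not_mediatorMoves hm]
          simp [ht]
        rw [if_pos h1, if_pos ht]
        simp [augment]
      · have h1 : (G.augment u₀ hu₀).turn (G.lift ρ h) ≠ none := by
          change G.augTurn _ ≠ none
          rw [augTurn_of_not_mediatorMoves hm]
          simpa using ht
        rw [if_neg h1, if_neg ht]

/-- Fewer than two players have disobeyed, so no recommendation was withheld on the way: player `j`
has heard exactly one for each own move. -/
theorem heard_lift {ρ : A → List A → A} {j : P} {f : I → A}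
    (hρ : ∀ a h, G.turn h = some j → ρ a h = f (G.info h)) :
    ∀ w, (G.deviators (G.lift ρ w)).card < 2 →
      G.heard (some j) (G.lift ρ w) = (G.seq j w).map fun p => f p.1
  | [], _ => rfl
  | a :: h, hc => by
    have hc' : (G.deviators (G.lift ρ h)).card < 2 :=
      (Finset.card_le_card fun k hk => mem_deviators_lift_cons.2 (.inr hk)).trans_lt hc
    have ih := heard_lift hρ h hc'
    by_cases ht : G.turn h = none
    · have hm : ¬ G.MediatorMoves (G.lift ρ h) := fun hm => (mediatorMoves_lift.1 hm).1 ht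
      rw [lift_cons_of_not_mediatorMoves a hm, heard, seq, ih, if_neg (by simp [ht])]
    · rw [lift_cons_of_mediatorMoves a (mediatorMoves_lift.2 ⟨ht, hc'⟩), heard, heard, seq, ih,
        base_lift]
      by_cases hj : G.turn h = some j
      · simp [hj, hρ a h hj]
      · simp [hj]

theorem eq_of_mem_deviators_lift {ρ : A → List A → A} {i : P} :
    ∀ {w : List A}, (∀ a h, a :: h <:+ w → G.turn h ≠ none → G.turn h ≠ some i → ρ a h = a) →
      ∀ j ∈ G.deviators (G.lift ρ w), j = i
  | [], _, j, hj => by simp [lift, deviators] at hj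
  | a :: h, hw, j, hj => by
    rcases mem_deviators_lift_cons.1 hj with ⟨-, h2, h3⟩ | h1
    · by_contra hne
      exact h2 (hw a h List.suffix_rfl (by simp [h3]) (by simpa [h3] using hne))
    · exact eq_of_mem_deviators_lift
        (fun b g hb => hw b g (hb.trans (List.suffix_cons a h))) j h1

theorem card_deviators_lift_lt_two {ρ : A → List A → A} {i : P} {w : List A}
    (hw : ∀ a h, a :: h <:+ w → G.turn h ≠ none → G.turn h ≠ some i → ρ a h = a) :
    (G.deviators (G.lift ρ w)).card < 2 := by
  refine (Finset.card_le_one.2 fun p hp q hq => ?_).trans_lt one_lt_two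
  rw [eq_of_mem_deviators_lift hw p hp, eq_of_mem_deviators_lift hw q hq]

/-- The reaction of a pure strategy of the augmented game to recommendations according to `f`. -/
theorem exists_reaction {i : P} {f : I → A} (hf : G.IsPure i f)
    {s : List (A ⊕ A) ⊕ (I × Option A × List A) → A ⊕ A}
    (hs : (G.augment u₀ hu₀).IsPure (some i) s) {h : List A} (hh : h ∈ G.hist)
    (hne : ∃ a, a :: h ∈ G.hist) (ht : G.turn h = some i) :
    ∃ a, s (.inr (G.info h, some (f (G.info h)),
        f (G.info h) :: (G.seq i h).map fun p => f p.1)) = .inl a ∧ a :: h ∈ G.hist ∧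
      (G.IsDirect u₀ hu₀ i s → a = f (G.info h)) := by
  classical
  -- All players other than `i` are recommended what they play, so only `i` can have disobeyed and
  -- the mediator still speaks at `h`.
  set ρ : A → List A → A := fun a h => if G.turn h = some i then f (G.info h) else a with hρ
  have hρi : ∀ a h, G.turn h = some i → ρ a h = f (G.info h) := fun a h ht => if_pos ht
  have hcard : (G.deviators (G.lift ρ h)).card < 2 :=
    card_deviators_lift_lt_two (i := i) fun a h _ _ ht => if_neg ht
  have hlift : G.AugHist (G.lift ρ h) := augHist_lift hh fun a g hg _ => by
    have hag := G.mem_hist_of_suffix hg hh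
    by_cases hgi : G.turn g = some i
    · rw [hρi a g hgi]
      exact hf g (G.tail_mem a g hag) ⟨a, hag⟩ hgi
    · rwa [show ρ a g = a from if_neg hgi]
  have hm : G.MediatorMoves (G.lift ρ h) := mediatorMoves_lift.2 ⟨by simp [ht], hcard⟩
  have hfh := hf h hh hne ht
  set g : List (A ⊕ A) := .inr (f (G.info h)) :: G.lift ρ h with hg
  have hbase : base g = h := by simp [hg, base]
  have hgm : ¬ G.MediatorMoves g := not_mediatorMoves_of_pending rfl
  have hgH : G.AugHist g := ⟨hlift, hm, by simpa using hfh⟩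
  have hinfo : G.augInfo g = .inr (G.info h, some (f (G.info h)),
      f (G.info h) :: (G.seq i h).map fun p => f p.1) := by
    rw [augInfo_of_not_mediatorMoves hgm, hbase, ht, hg, heard, base_lift, if_pos ht,
      heard_lift hρi h hcard]
    rfl
  have hsg : G.AugHist (s (G.augInfo g) :: g) := hs g hgH
    ⟨.inl (f (G.info h)), ⟨hgH, hgm, by rwa [hbase]⟩⟩
    (augTurn_eq_player_iff.2 ⟨hgm, by rwa [hbase]⟩)
  rw [← hinfo]
  rcases hsl : s (G.augInfo g) with a | r
  · rw [hsl] at hsg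
    refine ⟨a, rfl, by simpa [hbase] using hsg.2.2, fun hd => ?_⟩
    have := hd.2 g hgH (by rwa [hbase]) _ rfl
    rw [hsl] at this
    exact Sum.inl_injective this
  · rw [hsl] at hsg
    exact absurd hsg.2.1 hgm

theorem respond_spec {i : P} (hG : G.PerfectRecall i) {f : I → A} (hf : G.IsPure i f)
    {s : List (A ⊕ A) ⊕ (I × Option A × List A) → A ⊕ A}
    (hs : (G.augment u₀ hu₀).IsPure (some i) s) {h : List A} (hh : h ∈ G.hist)
    (hne : ∃ a, a :: h ∈ G.hist) (ht : G.turn h = some i) :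
    s (.inr (G.info h, some (f (G.info h)), f (G.info h) :: (G.seq i h).map fun p => f p.1))
        = .inl (G.respond i s f (G.info h)) ∧ G.respond i s f (G.info h) :: h ∈ G.hist ∧
      (G.IsDirect u₀ hu₀ i s → G.respond i s f (G.info h) = f (G.info h)) := by
  obtain ⟨a, h1, h2, h3⟩ := exists_reaction hf hs hh hne ht
  have hc : ∃ h' ∈ G.hist, (∃ a, a :: h' ∈ G.hist) ∧ G.turn h' = some i ∧ G.info h' = G.info h :=
    ⟨h, hh, hne, ht, rfl⟩
  -- By perfect recall, the representative node chosen in `respond` has the same sequence as `h`,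
  -- hence the same earlier recommendations.
  have hr : G.respond i s f (G.info h) = a := by
    obtain ⟨k1, k2, k3, k4⟩ := hc.choose_spec
    rw [respond, dif_pos hc, hG _ k1 h hh k2 hne k3 ht k4, h1]
    rfl
  rw [hr]
  exact ⟨h1, h2, h3⟩

theorem respond_isPure {i : P} (hG : G.PerfectRecall i) {f : I → A} (hf : G.IsPure i f)
    {s : List (A ⊕ A) ⊕ (I × Option A × List A) → A ⊕ A}
    (hs : (G.augment u₀ hu₀).IsPure (some i) s) : G.IsPure i (G.respond i s f) :=
  fun _ hh hne ht => (respond_spec hG hf hs hh hne ht).2.1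

theorem respond_of_notMem {i : P} {f : I → A}
    {s : List (A ⊕ A) ⊕ (I × Option A × List A) → A ⊕ A} {c : I} (hc : c ∉ G.info '' G.hist) :
    G.respond i s f c = f c :=
  dif_neg fun ⟨h, hh, _, _, hi⟩ => hc ⟨h, hh, hi⟩

theorem respond_of_isDirect {i : P} (hG : G.PerfectRecall i) {f : I → A} (hf : G.IsPure i f)
    {s : List (A ⊕ A) ⊕ (I × Option A × List A) → A ⊕ A} (hs : G.IsDirect u₀ hu₀ i s) :
    G.respond i s f = f := by
  funext c
  by_cases hc : ∃ h ∈ G.hist, (∃ a, a :: h ∈ G.hist) ∧ G.turn h = some i ∧ G.info h = c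
  · obtain ⟨h, hh, hne, ht, rfl⟩ := hc
    exact (respond_spec hG hf hs.1 hh hne ht).2.2 hs
  · exact dif_neg hc

/-- When the mediator recommends `σ` and only player `i` may disobey, play of the augmented game
corresponds to play of the original game. -/
theorem follows_lift_iff (hG : ∀ j, G.PerfectRecall j) {σ : P → I → A}
    (hσ : ∀ j, G.IsPure j (σ j)) {t : P → List (A ⊕ A) ⊕ (I × Option A × List A) → A ⊕ A}
    (ht : ∀ j, (G.augment u₀ hu₀).IsPure (some j) (t j)) {i : P}
    (hi : ∀ j, j ≠ i → G.respond j (t j) (σ j) = σ j) {w : List A} (hw : w ∈ G.hist) :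
    (∀ j, (G.augment u₀ hu₀).Follows (some j) (t j) (G.lift (G.prescribed σ) w)) ↔
      ∀ j, G.Follows j (G.respond j (t j) (σ j)) w := by
  induction w with
  | nil => simp [lift]
  | cons a h ih =>
    have hh := G.tail_mem a h hw
    have ih := ih hh
    have hsuf : ∀ j, (G.augment u₀ hu₀).Follows (some j) (t j) (G.lift (G.prescribed σ) (a :: h)) →
        (G.augment u₀ hu₀).Follows (some j) (t j) (G.lift (G.prescribed σ) h) := by
      intro j hj
      refine hj.of_suffix ?_
      by_cases hm : G.MediatorMoves (G.lift (G.prescribed σ) h)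
      · rw [lift_cons_of_mediatorMoves a hm]
        exact (List.suffix_cons _ _).trans (List.suffix_cons _ _)
      · rw [lift_cons_of_not_mediatorMoves a hm]
        exact List.suffix_cons _ _
    by_cases hf : ∀ j, G.Follows j (G.respond j (t j) (σ j)) h
    swap
    · exact iff_of_false (fun hc => hf (ih.1 fun j => hsuf j (hc j)))
        fun hc => hf fun j => ((G.follows_cons j _ a h).1 (hc j)).1
    -- Every player other than `i` responds to `σ` by obeying, so at most one player disobeys and
    -- recommendations never stop.
    have hcard : (G.deviators (G.lift (G.prescribed σ) h)).card < 2 := by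
      refine card_deviators_lift_lt_two (i := i) fun b g hb htn hti => ?_
      obtain ⟨j, hj⟩ := Option.ne_none_iff_exists'.1 htn
      have hji : j ≠ i := fun h => hti (by rw [hj, h])
      rw [prescribed_of_turn hj, ← hi j hji]
      exact ((G.follows_cons j _ b g).1 ((hf j).of_suffix hb)).2 hj
    refine forall_congr' fun j => ?_
    rw [follows_cons, and_iff_right (hf j)]
    have hfj := ih.2 hf j
    have hfj' : ∀ p ∈ (G.augment u₀ hu₀).seq (some j) (G.lift (G.prescribed σ) h),
        t j p.1 = p.2 := hfj
    by_cases htn : G.turn h = none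
    · have hm : ¬ G.MediatorMoves (G.lift (G.prescribed σ) h) :=
        fun hm => (mediatorMoves_lift.1 hm).1 htn
      rw [lift_cons_of_not_mediatorMoves a hm, Follows, seq_augment_play j a hm, base_lift,
        if_neg (by simp [htn])]
      exact iff_of_true hfj (by simp [htn])
    · have hm := mediatorMoves_lift.2 ⟨htn, hcard⟩
      rw [lift_cons_of_mediatorMoves a hm, Follows, seq_augment_answer j a _ hm, base_lift]
      by_cases hj : G.turn h = some j
      · rw [if_pos hj, List.forall_mem_cons, and_iff_left hfj',
          heard_lift (fun b g hg => prescribed_of_turn hg b) h hcard, prescribed_of_turn hj,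
          (respond_spec (hG j) (hσ j) (ht j) hh ⟨a, hw⟩ hj).1]
        simp [hj]
      · rw [if_neg hj]
        exact iff_of_true hfj fun h => absurd h hj

/-- Lifting along `σ` embeds the leaves of the original game into those of the augmented game. It
preserves chance probabilities and utilities, and its image contains every leaf compatible with
recommending `σ`. -/
theorem expUtility_recommend [Fintype P] [Nonempty A] (hG : ∀ j, G.PerfectRecall j)
    {σ : P → I → A}
    (hσ : ∀ j, G.IsPure j (σ j)) {t : P → List (A ⊕ A) ⊕ (I × Option A × List A) → A ⊕ A}
    (ht : ∀ j, (G.augment u₀ hu₀).IsPure (some j) (t j)) {i : P}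
    (hi : ∀ j, j ≠ i → G.respond j (t j) (σ j) = σ j) (k : P) :
    (G.augment u₀ hu₀).util (some k) ((G.augment u₀ hu₀).seqForm none (G.recommend σ))
        (fun j => (G.augment u₀ hu₀).seqForm (some j) (t j)) =
      G.pureUtility k fun j => G.respond j (t j) (σ j) := by
  classical
  set M := G.augment u₀ hu₀ with hM
  have e : M.withMediator (M.seqForm none (G.recommend σ)) (fun j => M.seqForm (some j) (t j))
      = fun o => M.seqForm o (o.elim (G.recommend σ) t) := by
    funext o
    cases o <;> rfl
  rw [util, expUtility, e, pureUtility]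
  simp only [prod_seqForm_leafSeq, Option.forall, Option.elim]
  rw [Finset.sum_coe_sort M.terminals fun z => M.chanceReach z *
    (if M.Follows none (G.recommend σ) z ∧ ∀ j, M.Follows (some j) (t j) z then 1 else 0) *
      M.utility (some k) z]
  symm
  refine Finset.sum_of_injOn (G.lift (G.prescribed σ)) ?_ ?_ ?_ ?_
  · exact fun w _ w' _ h => by simpa using congrArg base h
  · intro w hw
    exact lift_mem_terminals hw fun a h hh htn =>
      prescribed_mem hσ ⟨a, G.mem_hist_of_suffix hh (mem_terminals.1 hw).1⟩ htn
  · intro z hz hz'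
    have hz0 := mem_terminals_augment.1 hz
    rw [if_neg, mul_zero, zero_mul]
    rintro ⟨hc, -⟩
    exact hz' ⟨base z, hz0.2.2, (eq_lift_of_follows_recommend z hz0.1 hz0.2.1 hc).symm⟩
  · intro w hw
    have h1 := follows_lift_iff hG hσ ht hi (mem_terminals.1 hw).1
    rw [chanceReach_lift]
    have h2 : M.utility (some k) (G.lift (G.prescribed σ) w) = G.utility k w := by
      change G.utility k (base (G.lift (G.prescribed σ) w)) = _
      rw [base_lift]
    rw [h2]
    congr 2
    by_cases hc : ∀ j, G.Follows j (G.respond j (t j) (σ j)) w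
    · rw [if_pos hc, if_pos ⟨follows_recommend_lift σ w, h1.2 hc⟩]
    · rw [if_neg hc, if_neg fun hc' => hc (h1.1 hc'.2)]

end

/-! ### Utilities of mediated games -/

theorem update_withMediator [DecidableEq P] (M : ExtensiveGame (Option P) A I) (μ : M.Seq none → ℝ)
    (x : ∀ i : P, M.Seq (some i) → ℝ) (i : P) (y : M.Seq (some i) → ℝ) :
    Function.update (M.withMediator μ x) (some i) y = M.withMediator μ (Function.update x i y) := by
  funext j
  rcases j with _ | j
  · rfl
  · by_cases hj : j = i
    · subst hj
      simp [withMediator]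
    · rw [Function.update_of_ne (by simpa using hj)]
      simp [withMediator, hj]

theorem withMediator_mem (M : ExtensiveGame (Option P) A I) {μ : M.Seq none → ℝ}
    (hμ : μ ∈ M.strategies none) {x : ∀ i : P, M.Seq (some i) → ℝ}
    (hx : ∀ i, x i ∈ M.strategies (some i)) (j : Option P) :
    M.withMediator μ x j ∈ M.strategies j := by
  cases j
  · exact hμ
  · exact hx _

theorem update_mem_strategies [DecidableEq P] (M : ExtensiveGame (Option P) A I)
    {x : ∀ i : P, M.Seq (some i) → ℝ} (hx : ∀ i, x i ∈ M.strategies (some i)) {i : P}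
    {y : M.Seq (some i) → ℝ} (hy : y ∈ M.strategies (some i)) (j : P) :
    Function.update x i y j ∈ M.strategies (some j) := by
  by_cases hj : j = i
  · subst hj
    simpa using hy
  · rw [Function.update_of_ne hj]
    exact hx j

/-- The vertices of the mediator's strategy polytope. -/
abbrev MediatorVertex (M : ExtensiveGame (Option P) A I) : Type _ :=
  {v // v ∈ (M.finite_image_seqForm none).toFinset}

theorem sum_smul_mem_strategies (M : ExtensiveGame (Option P) A I) {w : M.MediatorVertex → ℝ}
    (hw : ∀ v, 0 ≤ w v) (hw1 : ∑ v, w v = 1) : ∑ v, w v • v.1 ∈ M.strategies none :=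
  (M.convex_strategies none).sum_mem (fun v _ => hw v) hw1 fun v _ =>
    subset_convexHull ℝ _ ((M.finite_image_seqForm none).mem_toFinset.1 v.2)

theorem util_mem_Icc [Fintype P] (M : ExtensiveGame (Option P) A I) (j : Option P) {μ : M.Seq none → ℝ}
    (hμ : μ ∈ M.strategies none) {x : ∀ i : P, M.Seq (some i) → ℝ}
    (hx : ∀ i, x i ∈ M.strategies (some i)) : M.util j μ x ∈ Set.Icc (0 : ℝ) 1 :=
  M.expUtility_mem_Icc j (M.withMediator_mem hμ hx)

section Mediated

variable [Fintype P] [DecidableEq P]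

theorem exists_linear_util_mediator (M : ExtensiveGame (Option P) A I) (j : Option P)
    (x : ∀ i : P, M.Seq (some i) → ℝ) :
    ∃ φ : (M.Seq none → ℝ) →ₗ[ℝ] ℝ, ∀ μ, M.util j μ x = φ μ := by
  obtain ⟨φ, hφ⟩ := M.exists_linear_expUtility j (M.withMediator 0 x) none
  refine ⟨φ, fun μ => ?_⟩
  rw [← hφ, util]
  congr 1
  funext k
  cases k <;> simp [withMediator]

theorem exists_linear_util_player (M : ExtensiveGame (Option P) A I) (j : Option P)
    (μ : M.Seq none → ℝ) (x : ∀ i : P, M.Seq (some i) → ℝ) (i : P) :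
    ∃ φ : (M.Seq (some i) → ℝ) →ₗ[ℝ] ℝ, ∀ y, M.util j μ (Function.update x i y) = φ y := by
  obtain ⟨φ, hφ⟩ := M.exists_linear_expUtility j (M.withMediator μ x) (some i)
  exact ⟨φ, fun y => by rw [← hφ, util, update_withMediator]⟩

theorem exists_linear_gain (M : ExtensiveGame (Option P) A I) (d : ∀ i : P, M.Seq (some i) → ℝ)
    (i : P) (y : M.Seq (some i) → ℝ) :
    ∃ φ : (M.Seq none → ℝ) →ₗ[ℝ] ℝ, ∀ μ, M.gain d i μ y = φ μ := by
  obtain ⟨φ, hφ⟩ := M.exists_linear_util_mediator (some i) (Function.update d i y)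
  obtain ⟨ψ, hψ⟩ := M.exists_linear_util_mediator (some i) d
  exact ⟨φ - ψ, fun μ => by rw [gain, hφ, hψ, LinearMap.sub_apply]⟩

@[simp] theorem gain_self (M : ExtensiveGame (Option P) A I) (d : ∀ i : P, M.Seq (some i) → ℝ)
    (i : P) (μ : M.Seq none → ℝ) : M.gain d i μ (d i) = 0 := by
  simp [gain]

theorem convex_gain_le (M : ExtensiveGame (Option P) A I) (d : ∀ i : P, M.Seq (some i) → ℝ)
    (i : P) (μ : M.Seq none → ℝ) (c : ℝ) : Convex ℝ {y | M.gain d i μ y ≤ c} := by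
  obtain ⟨φ, hφ⟩ := M.exists_linear_util_player (some i) μ d i
  simp only [gain, hφ, sub_le_iff_le_add]
  exact (convex_Iic _).linear_preimage φ

theorem convex_gain_lt (M : ExtensiveGame (Option P) A I) (d : ∀ i : P, M.Seq (some i) → ℝ)
    (i : P) (μ : M.Seq none → ℝ) (c : ℝ) : Convex ℝ {y | M.gain d i μ y < c} := by
  obtain ⟨φ, hφ⟩ := M.exists_linear_util_player (some i) μ d i
  simp only [gain, hφ, sub_lt_iff_lt_add]
  exact (convex_Iio _).linear_preimage φ

theorem abs_gain_le (M : ExtensiveGame (Option P) A I) {d : ∀ i : P, M.Seq (some i) → ℝ}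
    (hd : ∀ i, d i ∈ M.strategies (some i)) (i : P) {μ : M.Seq none → ℝ}
    (hμ : μ ∈ M.strategies none) {y : M.Seq (some i) → ℝ} (hy : y ∈ M.strategies (some i)) :
    |M.gain d i μ y| ≤ 1 := by
  have h1 := M.util_mem_Icc (some i) hμ (M.update_mem_strategies hd hy)
  have h2 := M.util_mem_Icc (some i) hμ hd
  rw [gain, abs_le]
  constructor <;> linarith [h1.1, h1.2, h2.1, h2.2]

/-! ### Saddle points and optimal equilibria -/

theorem lagrangian_self (M : ExtensiveGame (Option P) A I) (d : ∀ i : P, M.Seq (some i) → ℝ)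
    (lam : ℝ) (μ : M.Seq none → ℝ) : M.lagrangian d lam μ d = M.util none μ d := by
  simp [lagrangian]

theorem bddBelow_lagrangian (M : ExtensiveGame (Option P) A I)
    {d : ∀ i : P, M.Seq (some i) → ℝ} {Y : ∀ i : P, Set (M.Seq (some i) → ℝ)}
    (hY : ∀ i, Y i ⊆ M.strategies (some i)) (hdY : ∀ i, d i ∈ Y i) {lam : ℝ} (hlam : 0 ≤ lam)
    {μ : M.Seq none → ℝ} (hμ : μ ∈ M.strategies none) :
    BddBelow (M.lagrangian d lam μ '' Set.univ.pi Y) := by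
  refine ⟨-(lam * Fintype.card P), ?_⟩
  rintro _ ⟨x, hx, rfl⟩
  have h1 := (M.util_mem_Icc none hμ fun i => hY i (hdY i)).1
  have h2 : ∑ i, M.gain d i μ (x i) ≤ Fintype.card P := by
    calc ∑ i, M.gain d i μ (x i) ≤ ∑ _i : P, (1 : ℝ) := Finset.sum_le_sum fun i _ =>
          (abs_le.1 (M.abs_gain_le (fun i => hY i (hdY i)) i hμ (hY i (hx i trivial)))).2
      _ = Fintype.card P := by simp
  have h3 := mul_le_mul_of_nonneg_left h2 hlam
  rw [lagrangian]
  linarith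

theorem IsEquilibrium.sInf_lagrangian {M : ExtensiveGame (Option P) A I}
    {d : ∀ i : P, M.Seq (some i) → ℝ} {Y : ∀ i : P, Set (M.Seq (some i) → ℝ)}
    (hdY : ∀ i, d i ∈ Y i) {lam : ℝ} (hlam : 0 ≤ lam) {μ : M.Seq none → ℝ}
    (hμ : M.IsEquilibrium d Y μ) :
    sInf (M.lagrangian d lam μ '' Set.univ.pi Y) = M.util none μ d := by
  refine IsLeast.csInf_eq ⟨⟨d, fun i _ => hdY i, M.lagrangian_self d lam μ⟩, ?_⟩
  rintro _ ⟨x, hx, rfl⟩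
  have : ∑ i, M.gain d i μ (x i) ≤ 0 :=
    Finset.sum_nonpos fun i _ => hμ.2 i (x i) (hx i trivial)
  have := mul_nonpos_of_nonneg_of_nonpos hlam this
  rw [lagrangian]
  linarith

theorem continuous_util_mediator (M : ExtensiveGame (Option P) A I) (j : Option P)
    (x : ∀ i : P, M.Seq (some i) → ℝ) : Continuous fun μ => M.util j μ x := by
  obtain ⟨φ, hφ⟩ := M.exists_linear_util_mediator j x
  simp only [hφ]
  exact φ.continuous_of_finiteDimensional

theorem continuous_gain (M : ExtensiveGame (Option P) A I) (d : ∀ i : P, M.Seq (some i) → ℝ)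
    (i : P) (y : M.Seq (some i) → ℝ) : Continuous fun μ => M.gain d i μ y :=
  (M.continuous_util_mediator _ _).sub (M.continuous_util_mediator _ _)

/-- `Y` may be any family of sets here. The inner infimum of continuous functions of μ is upper
semicontinuous, which suffices for a maximum on the compact polytope `X_0`. -/
theorem exists_isSaddleSolution [Nonempty A] (M : ExtensiveGame (Option P) A I)
    {d : ∀ i : P, M.Seq (some i) → ℝ} {Y : ∀ i : P, Set (M.Seq (some i) → ℝ)}
    (hY : ∀ i, Y i ⊆ M.strategies (some i)) (hdY : ∀ i, d i ∈ Y i) {lam : ℝ} (hlam : 0 ≤ lam) :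
    ∃ μ, M.IsSaddleSolution d Y lam μ := by
  have husc : UpperSemicontinuousOn
      (fun μ => sInf (M.lagrangian d lam μ '' Set.univ.pi Y)) (M.strategies none) := by
    intro μ _
    simp only [sInf_image']
    refine upperSemicontinuousWithinAt_ciInf ?_ fun x => ?_
    · filter_upwards [self_mem_nhdsWithin] with ν hν
      have := M.bddBelow_lagrangian hY hdY hlam hν
      rwa [Set.image_eq_range] at this
    · have : Continuous fun μ => M.lagrangian d lam μ x.1 :=
        (M.continuous_util_mediator _ _).sub
          (continuous_const.mul (continuous_finsetSum _ fun i _ => M.continuous_gain d i _))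
      exact this.continuousWithinAt.upperSemicontinuousWithinAt
  obtain ⟨μ, hμ, hmax⟩ := husc.exists_isMaxOn (M.strategies_nonempty none)
    (M.isCompact_strategies none)
  exact ⟨μ, hμ, fun ν hν => hmax hν⟩

theorem exists_isOptimalEquilibrium (M : ExtensiveGame (Option P) A I)
    {d : ∀ i : P, M.Seq (some i) → ℝ} {Y : ∀ i : P, Set (M.Seq (some i) → ℝ)}
    (hE : ∃ μ, M.IsEquilibrium d Y μ) : ∃ μ, M.IsOptimalEquilibrium d Y μ := by
  have hcl : IsClosed {μ | ∀ i, ∀ y ∈ Y i, M.gain d i μ y ≤ 0} := by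
    simp only [Set.ofPred_forall]
    exact isClosed_iInter fun i => isClosed_iInter fun y => isClosed_iInter fun _ =>
      isClosed_le (M.continuous_gain d i y) continuous_const
  obtain ⟨μ, hμ, hmax⟩ := ((M.isCompact_strategies none).inter_right hcl).exists_isMaxOn
    hE (M.continuous_util_mediator none d).continuousOn
  exact ⟨μ, hμ, fun ν hν => hmax hν⟩

theorem gain_sum_smul (M : ExtensiveGame (Option P) A I) (d : ∀ i : P, M.Seq (some i) → ℝ)
    (i : P) (y : M.Seq (some i) → ℝ) (w : M.MediatorVertex → ℝ) :
    M.gain d i (∑ v, w v • v.1) y = ∑ v, w v * M.gain d i v.1 y := by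
  obtain ⟨φ, hφ⟩ := M.exists_linear_gain d i y
  simp [hφ]

/-- The linear program for the optimal equilibrium has an exact penalty. -/
theorem exists_penalty (M : ExtensiveGame (Option P) A I) {d : ∀ i : P, M.Seq (some i) → ℝ}
    (F : ∀ i, Finset (M.Seq (some i) → ℝ)) {u : ℝ}
    (hu : ∀ μ ∈ M.strategies none, (∀ i, ∀ f ∈ F i, M.gain d i μ f ≤ 0) → M.util none μ d ≤ u) :
    ∃ c : (Σ i, {f // f ∈ F i}) → ℝ, (∀ k, 0 ≤ c k) ∧ ∀ μ ∈ M.strategies none,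
      M.util none μ d - u ≤ ∑ k, c k * M.gain d k.1 μ k.2.1 := by
  obtain ⟨ψ, hψ⟩ := M.exists_linear_util_mediator none d
  obtain ⟨c, hc, hcv⟩ := exists_nonneg_dominating_combination
    (V := M.MediatorVertex) (K := Σ i, {f // f ∈ F i})
    (fun k v => M.gain d k.1 v.1 k.2.1) (fun v => M.util none v.1 d - u) (by
      intro w hw hL
      have hW : 0 ≤ ∑ v, w v := Finset.sum_nonneg fun v _ => hw v
      -- Farkas' lemma asks about arbitrary nonnegative weights on the vertices. Zero total weight
      -- is trivial; otherwise normalization gives a point of `X_0` to which `hu` applies.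
      rcases hW.eq_or_lt with h0 | h0
      · have := (Finset.sum_eq_zero_iff_of_nonneg fun v _ => hw v).1 h0.symm
        exact (Finset.sum_eq_zero fun v hv => by rw [this v hv, zero_mul]).le
      set W := ∑ v, w v
      have h1 : ∑ v, w v / W = 1 := by rw [← Finset.sum_div, div_self h0.ne']
      have h2 := M.sum_smul_mem_strategies (w := fun v => w v / W)
        (fun v => div_nonneg (hw v) h0.le) h1
      have h3 : ∀ c : M.MediatorVertex → ℝ, ∑ v, w v / W * c v = (∑ v, w v * c v) / W :=
        fun c => by
          rw [Finset.sum_div]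
          exact Finset.sum_congr rfl fun v _ => by ring
      have h4 := hu _ h2 fun i f hf => by
        rw [gain_sum_smul, h3]
        exact div_nonpos_of_nonpos_of_nonneg (hL ⟨i, f, hf⟩) h0.le
      rw [hψ, map_sum] at h4
      simp only [map_smul, smul_eq_mul] at h4
      simp only [← hψ] at h4
      rw [h3, div_le_iff₀ h0] at h4
      simp only [mul_sub, Finset.sum_sub_distrib]
      rw [← Finset.sum_mul]
      linarith)
  refine ⟨c, hc, fun μ hμ => ?_⟩
  choose φ hφ using fun k : Σ i, {f // f ∈ F i} => M.exists_linear_gain d k.1 k.2.1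
  have := M.strategies_le_of_pure (ψ - ∑ k, c k • φ k) u (fun s hs => by
    have := hcv ⟨_, (M.finite_image_seqForm none).mem_toFinset.2 ⟨s, hs, rfl⟩⟩
    simp only [hφ, hψ] at this
    simp only [LinearMap.sub_apply, LinearMap.sum_apply, LinearMap.smul_apply, smul_eq_mul]
    linarith) hμ
  simp only [LinearMap.sub_apply, LinearMap.sum_apply, LinearMap.smul_apply, smul_eq_mul] at this
  simp only [hφ, hψ]
  linarith

/-- The gain is affine in the deviation, so its maximum over the common hull is attained in `F i`.
It is also reached in `Y i`: were all of `Y i` strictly below the maximum, its hull would be too.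
Nonnegativity comes from `d i`, whose gain is zero. -/
theorem exists_best_response (M : ExtensiveGame (Option P) A I)
    {d : ∀ i : P, M.Seq (some i) → ℝ} {Y : ∀ i : P, Set (M.Seq (some i) → ℝ)}
    (hdY : ∀ i, d i ∈ Y i) (F : ∀ i, Finset (M.Seq (some i) → ℝ))
    (hF : ∀ i, convexHull ℝ (Y i) = convexHull ℝ (F i : Set (M.Seq (some i) → ℝ)))
    (μ : M.Seq none → ℝ) (i : P) :
    ∃ y ∈ Y i, 0 ≤ M.gain d i μ y ∧ ∀ f ∈ F i, M.gain d i μ f ≤ M.gain d i μ y := by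
  have hdF : d i ∈ convexHull ℝ (F i : Set (M.Seq (some i) → ℝ)) :=
    hF i ▸ subset_convexHull ℝ _ (hdY i)
  have hne : (F i).Nonempty := by
    have : (convexHull ℝ (F i : Set (M.Seq (some i) → ℝ))).Nonempty := ⟨_, hdF⟩
    simpa using this
  obtain ⟨f, hf, hmax⟩ := (F i).exists_max_image (M.gain d i μ) hne
  obtain ⟨y, hy, hfy⟩ : ∃ y ∈ Y i, M.gain d i μ f ≤ M.gain d i μ y := by
    by_contra! hcon
    have h1 : convexHull ℝ (Y i) ⊆ {y | M.gain d i μ y < M.gain d i μ f} :=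
      convexHull_min hcon (M.convex_gain_lt d i μ _)
    have h2 : f ∈ convexHull ℝ (Y i) := hF i ▸ subset_convexHull ℝ _ hf
    have h3 : M.gain d i μ f < M.gain d i μ f := h1 h2
    exact lt_irrefl _ h3
  have h3 : convexHull ℝ (F i : Set (M.Seq (some i) → ℝ)) ⊆
      {y | M.gain d i μ y ≤ M.gain d i μ f} := convexHull_min hmax (M.convex_gain_le d i μ _)
  have h4 := h3 hdF
  simp only [Set.mem_ofPred_eq, gain_self] at h4
  exact ⟨y, hy, h4.trans hfy, fun g hg => (hmax g hg).trans hfy⟩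

/-- If equilibria exist and the deviation sets have polyhedral hulls, then an exact multiplier
exists. -/
theorem exists_isExactMultiplier (M : ExtensiveGame (Option P) A I)
    {d : ∀ i : P, M.Seq (some i) → ℝ} {Y : ∀ i : P, Set (M.Seq (some i) → ℝ)}
    (hY : ∀ i, Y i ⊆ M.strategies (some i)) (hdY : ∀ i, d i ∈ Y i)
    (hE : ∃ μ, M.IsEquilibrium d Y μ)
    (hfin : ∀ i, ∃ F : Set (M.Seq (some i) → ℝ), F.Finite ∧ convexHull ℝ (Y i) = convexHull ℝ F) :
    ∃ lamStar, M.IsExactMultiplier d Y lamStar := by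
  classical
  choose F₀ hF₀ hconv using hfin
  set F : ∀ i, Finset (M.Seq (some i) → ℝ) := fun i => (hF₀ i).toFinset with hF
  have hconv' : ∀ i, convexHull ℝ (Y i) = convexHull ℝ (F i : Set (M.Seq (some i) → ℝ)) := by
    intro i
    rw [hconv i, hF, Set.Finite.coe_toFinset]
  have hFY : ∀ i (μ : M.Seq none → ℝ), (∀ f ∈ F i, M.gain d i μ f ≤ 0) →
      ∀ y ∈ Y i, M.gain d i μ y ≤ 0 := by
    intro i μ h y hy
    have h1 : convexHull ℝ (F i : Set (M.Seq (some i) → ℝ)) ⊆ {y | M.gain d i μ y ≤ 0} :=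
      convexHull_min h (M.convex_gain_le d i μ 0)
    exact h1 (hconv' i ▸ subset_convexHull ℝ _ hy)
  obtain ⟨μ₀, hμ₀, hmax⟩ := M.exists_isOptimalEquilibrium hE
  set u := M.util none μ₀ d with hu
  obtain ⟨c, hc, hpen⟩ := M.exists_penalty F (u := u) fun μ hμ h =>
    hmax μ ⟨hμ, fun i => hFY i μ (h i)⟩
  have hΛ : 0 ≤ ∑ k, c k := Finset.sum_nonneg fun k _ => hc k
  set Λ := ∑ k, c k with hΛ'
  -- The best responses bound the inner infimum: the penalty inequality lets the objective exceed
  -- `u` by at most `Λ * ∑ i, g i`, while the Lagrangian subtracts `lam * ∑ i, g i`.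
  have key : ∀ lam, Λ ≤ lam → ∀ μ ∈ M.strategies none,
      ∃ g : P → ℝ, (∀ i, 0 ≤ g i) ∧ (∀ i, ∀ f ∈ F i, M.gain d i μ f ≤ g i) ∧
        sInf (M.lagrangian d lam μ '' Set.univ.pi Y) ≤ u - (lam - Λ) * ∑ i, g i := by
    intro lam hlam μ hμ
    choose y hy hy0 hyF using M.exists_best_response hdY F hconv' μ
    refine ⟨fun i => M.gain d i μ (y i), hy0, hyF, ?_⟩
    have h1 : M.util none μ d - u ≤ Λ * ∑ i, M.gain d i μ (y i) := by
      refine (hpen μ hμ).trans ?_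
      rw [hΛ', Finset.sum_mul]
      refine Finset.sum_le_sum fun k _ => mul_le_mul_of_nonneg_left ?_ (hc k)
      exact (hyF k.1 k.2.1 k.2.2).trans
        (Finset.single_le_sum (f := fun i => M.gain d i μ (y i)) (fun i _ => hy0 i)
          (Finset.mem_univ k.1))
    refine (csInf_le (M.bddBelow_lagrangian hY hdY (hΛ.trans hlam) hμ)
      ⟨y, fun i _ => hy i, rfl⟩).trans ?_
    rw [lagrangian]
    linarith
  -- The strict margin over `Λ` forces the gains at a saddle solution to vanish; `Λ` itself would
  -- not.
  refine ⟨Λ + 1, by linarith, fun lam hlam μ => ⟨fun hμ => ?_, fun hμ => ?_⟩⟩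
  · obtain ⟨g, hg0, hgF, hg⟩ := key lam (by linarith) μ hμ.1
    have h1 := hμ.2 μ₀ hμ₀.1
    rw [hμ₀.sInf_lagrangian hdY (by linarith)] at h1
    have hs : 0 ≤ ∑ i, g i := Finset.sum_nonneg fun i _ => hg0 i
    have h2 : ∑ i, g i = 0 := by nlinarith
    have h3 := (Finset.sum_eq_zero_iff_of_nonneg fun i _ => hg0 i).1 h2
    have heq : M.IsEquilibrium d Y μ := ⟨hμ.1, fun i => hFY i μ fun f hf =>
      (hgF i f hf).trans (h3 i (Finset.mem_univ i)).le⟩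
    rw [heq.sInf_lagrangian hdY (by linarith)] at h1
    exact ⟨heq, fun ν hν => (hmax ν hν).trans h1⟩
  · refine ⟨hμ.1.1, fun ν hν => ?_⟩
    rw [hμ.1.sInf_lagrangian hdY (by linarith)]
    obtain ⟨g, hg0, -, hg⟩ := key lam (by linarith) ν hν
    have hs : 0 ≤ ∑ i, g i := Finset.sum_nonneg fun i _ => hg0 i
    have h1 := hμ.2 μ₀ hμ₀
    nlinarith

end Mediated

/-! ### Existence of equilibria -/

/-- In the augmented game of a game with perfect recall, the mediator has a strategy against which
no deviation from the direct strategies is profitable. -/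
theorem exists_isEquilibrium_augment [Fintype P] [DecidableEq P] [Nonempty A]
    {G : ExtensiveGame P A I} {u₀ : List A → ℝ}
    {hu₀ : ∀ h ∈ G.hist, (∀ a, a :: h ∉ G.hist) → u₀ h ∈ Set.Icc (0 : ℝ) 1}
    (hG : ∀ i, G.PerfectRecall i)
    {s : P → List (A ⊕ A) ⊕ (I × Option A × List A) → A ⊕ A} (hs : ∀ i, G.IsDirect u₀ hu₀ i (s i)) :
    ∃ μ, (G.augment u₀ hu₀).IsEquilibrium (fun i => (G.augment u₀ hu₀).seqForm (some i) (s i))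
      (fun i => (G.augment u₀ hu₀).strategies (some i)) μ := by
  classical
  set M := G.augment u₀ hu₀ with hM
  set d : ∀ i, M.Seq (some i) → ℝ := fun i => M.seqForm (some i) (s i) with hd
  set Z : ∀ i, Finset (M.Seq (some i) → ℝ) := fun i => (M.finite_image_seqForm (some i)).toFinset
    with hZ
  rcases exists_stdSimplex_le_zero_or_exists_pos (V := M.MediatorVertex)
    (K := Σ i, {f // f ∈ Z i}) (fun k v => M.gain d k.1 v.1 k.2.1) with ⟨w, hw, hw1, hwL⟩ |
    ⟨c, hc, hcpos⟩
  · refine ⟨_, M.sum_smul_mem_strategies hw hw1, fun i y hy => ?_⟩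
    have : M.strategies (some i) ⊆ {y | M.gain d i (∑ v, w v • v.1) y ≤ 0} := by
      refine convexHull_min (fun f hf => ?_) (M.convex_gain_le d i _ 0)
      change M.gain d i _ f ≤ 0
      rw [gain_sum_smul]
      exact hwL ⟨i, f, (M.finite_image_seqForm (some i)).mem_toFinset.2 hf⟩
    exact this hy
  exfalso
  -- Fixing the values at labels that no node carries leaves finitely many strategies, as the
  -- stationary distributions require. `respond` changes no such value, so it maps `S i` to itself.
  set S : P → Type _ := fun i => {f : I → A // G.IsPure i f ∧
    ∀ c ∉ G.info '' G.hist, f c = Classical.arbitrary A} with hS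
  have : ∀ i, Finite (S i) := fun i => by
    have := (G.finite_hist.image G.info).to_subtype
    refine Finite.of_injective (β := (G.info '' G.hist : Set I) → A) (fun f c => f.1 c.1) ?_
    intro f g hfg
    refine Subtype.ext (funext fun c => ?_)
    by_cases hc : c ∈ G.info '' G.hist
    · exact congrFun hfg ⟨c, hc⟩
    · rw [f.2.2 c hc, g.2.2 c hc]
  have : ∀ i, Fintype (S i) := fun i => Fintype.ofFinite _
  have : ∀ i, Nonempty (S i) := fun i => by
    obtain ⟨f, hf⟩ := G.exists_isPure i
    refine ⟨⟨fun c => if c ∈ G.info '' G.hist then f c else Classical.arbitrary A,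
      fun h hh hne ht => ?_, fun c hc => if_neg hc⟩⟩
    beta_reduce
    rw [if_pos ⟨h, hh, rfl⟩]
    exact hf h hh hne ht
  have hrep : ∀ i (k : {f // f ∈ Z i}), ∃ t, M.IsPure (some i) t ∧ M.seqForm (some i) t = k.1 :=
    fun i k => (M.finite_image_seqForm (some i)).mem_toFinset.1 k.2
  choose t ht htk using hrep
  obtain ⟨p, hp, hp1, hp0⟩ := exists_distribution_sum_gain_eq_zero (S := S)
    (K := fun i => {f // f ∈ Z i}) (fun i k => c ⟨i, k⟩) (fun i k => hc _)
    (fun i k f => ⟨G.respond i (t i k) f.1, respond_isPure (hG i) f.2.1 (ht i k),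
      fun c hc => (respond_of_notMem hc).trans (f.2.2 c hc)⟩)
    (fun i σ => G.pureUtility i fun j => (σ j).1)
  have hpos : ∀ σ : ∀ i, S i, 0 < ∑ i, ∑ k : {f // f ∈ Z i}, c ⟨i, k⟩ *
      (G.pureUtility i (fun j => (Function.update σ i ⟨G.respond i (t i k) (σ i).1,
        respond_isPure (hG i) (σ i).2.1 (ht i k),
        fun c hc => (respond_of_notMem hc).trans ((σ i).2.2 c hc)⟩ j).1) -
        G.pureUtility i fun j => (σ j).1) := by
    intro σ
    have hσ : ∀ j, G.IsPure j (σ j).1 := fun j => (σ j).2.1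
    have h1 := hcpos ⟨_, (M.finite_image_seqForm none).mem_toFinset.2
      ⟨G.recommend fun j => (σ j).1, recommend_isPure hσ, rfl⟩⟩
    rw [Fintype.sum_sigma] at h1
    refine h1.trans_eq (Finset.sum_congr rfl fun i _ => Finset.sum_congr rfl fun k _ => ?_)
    have hdir : ∀ j, G.respond j (s j) (σ j).1 = (σ j).1 := fun j =>
      respond_of_isDirect (hG j) (hσ j) (hs j)
    congr 1
    rw [gain]
    congr 1
    · have h2 := expUtility_recommend (u₀ := u₀) (hu₀ := hu₀) hG hσ
        (t := Function.update s i (t i k)) (fun j => by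
          by_cases hj : j = i
          · subst hj
            simpa using ht j k
          · rw [Function.update_of_ne hj]
            exact (hs j).1) (i := i) (fun j hj => by rw [Function.update_of_ne hj, hdir j]) i
      have h3 : Function.update d i k.1
          = fun j => M.seqForm (some j) (Function.update s i (t i k) j) := by
        funext j
        by_cases hj : j = i
        · subst hj
          simp [htk]
        · rw [Function.update_of_ne hj, Function.update_of_ne hj]
      rw [h3, h2]
      congr 1
      funext j
      by_cases hj : j = i
      · subst hj
        simp
      · rw [Function.update_of_ne hj, Function.update_of_ne hj, hdir j]
    · have h2 := expUtility_recommend (u₀ := u₀) (hu₀ := hu₀) hG hσ (fun j => (hs j).1) (i := i)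
        (fun j _ => hdir j) i
      simp only [hdir] at h2
      exact h2
  refine absurd hp0 (Finset.sum_pos' (fun σ _ => mul_nonneg (hp σ) (hpos σ).le) ?_).ne'
  obtain ⟨σ, hσ⟩ : ∃ σ, 0 < p σ := by
    by_contra! hcon
    have : ∑ σ, p σ ≤ 0 := Finset.sum_nonpos fun σ _ => hcon σ
    linarith
  exact ⟨σ, Finset.mem_univ σ, mul_pos hσ (hpos σ)⟩

end ExtensiveGame

/-! ### Online steering -/

theorem one_sub_prod_le_sum_one_sub {ι : Type*} (s : Finset ι) {f : ι → ℝ}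
    (hf : ∀ i, f i ∈ Set.Icc (0 : ℝ) 1) : 1 - ∏ i ∈ s, f i ≤ ∑ i ∈ s, (1 - f i) := by
  classical
  induction s using Finset.induction_on with
  | empty => simp
  | insert k s hk ih =>
    rw [Finset.prod_insert hk, Finset.sum_insert hk]
    have h1 : 0 ≤ ∏ i ∈ s, f i := Finset.prod_nonneg fun i _ => (hf i).1
    have h2 : ∏ i ∈ s, f i ≤ 1 := Finset.prod_le_one (fun i _ => (hf i).1) fun i _ => (hf i).2
    nlinarith [(hf k).1, (hf k).2]

theorem avg_le_avg {T : ℕ} {f g : ℕ → ℝ} (h : ∀ t < T, f t ≤ g t) :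
    1 / (T : ℝ) * ∑ t ∈ Finset.range T, f t ≤ 1 / (T : ℝ) * ∑ t ∈ Finset.range T, g t :=
  mul_le_mul_of_nonneg_left (Finset.sum_le_sum fun t ht => h t (Finset.mem_range.1 ht))
    (by positivity)

namespace ExtensiveGame

variable {P A I : Type*} [Fintype A]

/-- The total amount by which the profile `x` falls short of the direct profile `d`. -/
def totalLoss [Fintype P] (M : ExtensiveGame (Option P) A I)
    (d x : ∀ i : P, M.Seq (some i) → ℝ) : ℝ :=
  ∑ i, M.directLoss (some i) (d i) (x i)

/-! ### The loss controls utilities and reach probabilities -/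

section Loss

variable [Fintype P] {M : ExtensiveGame (Option P) A I} {s : P → I → A}
  {d : ∀ i : P, M.Seq (some i) → ℝ}

@[simp] theorem totalLoss_self : M.totalLoss d d = 0 := by
  simp [totalLoss]

theorem totalLoss_nonneg (hd : ∀ i, d i = M.seqForm (some i) (s i))
    {x : ∀ i : P, M.Seq (some i) → ℝ} (hx : ∀ i, x i ∈ M.strategies (some i)) :
    0 ≤ M.totalLoss d x :=
  Finset.sum_nonneg fun i _ => by
    rw [hd i]
    exact M.directLoss_nonneg (s i) (hx i)

theorem directLoss_le_totalLoss (hd : ∀ i, d i = M.seqForm (some i) (s i))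
    {x : ∀ i : P, M.Seq (some i) → ℝ} (hx : ∀ i, x i ∈ M.strategies (some i)) (i : P) :
    M.directLoss (some i) (d i) (x i) ≤ M.totalLoss d x :=
  Finset.single_le_sum (f := fun i => M.directLoss (some i) (d i) (x i)) (fun i _ => by
    rw [hd i]
    exact M.directLoss_nonneg (s i) (hx i)) (Finset.mem_univ i)

/-- Utilities change by at most the total loss when some players switch from direct strategies. -/
theorem abs_util_sub_le (hd : ∀ i, d i = M.seqForm (some i) (s i))
    {x : ∀ i : P, M.Seq (some i) → ℝ} (hx : ∀ i, x i ∈ M.strategies (some i)) (j : Option P)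
    {μ : M.Seq none → ℝ} (hμ : μ ∈ M.strategies none)
    {a b : ∀ i : P, M.Seq (some i) → ℝ} (ha : ∀ i, a i ∈ M.strategies (some i))
    (hab : ∀ i, a i = b i ∨ a i = d i ∧ b i = x i) :
    |M.util j μ a - M.util j μ b| ≤ M.totalLoss d x := by
  classical
  have hb : ∀ i, b i ∈ M.strategies (some i) := fun i => by
    rcases hab i with h | h
    · rw [← h]
      exact ha i
    · rw [h.2]
      exact hx i
  refine M.abs_expUtility_sub_le j (M.withMediator_mem hμ ha) (M.withMediator_mem hμ hb)
    (totalLoss_nonneg hd hx) fun z => ?_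
  rw [Fintype.prod_option, Fintype.prod_option]
  change μ _ * ∏ i, a i (M.leafSeq (some i) z) - μ _ * ∏ i, b i (M.leafSeq (some i) z)
    ≤ M.totalLoss d x * (μ _ * ∏ i, a i (M.leafSeq (some i) z))
  have hμz := (M.strategies_mem_Icc hμ (M.leafSeq none z)).1
  suffices ∏ i, a i (M.leafSeq (some i) z) - ∏ i, b i (M.leafSeq (some i) z)
      ≤ M.totalLoss d x * ∏ i, a i (M.leafSeq (some i) z) by
    have := mul_le_mul_of_nonneg_left this hμz
    linarith
  have hb0 : 0 ≤ ∏ i, b i (M.leafSeq (some i) z) :=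
    Finset.prod_nonneg fun i _ => (M.strategies_mem_Icc (hb i) _).1
  have ha0 : 0 ≤ ∏ i, a i (M.leafSeq (some i) z) :=
    Finset.prod_nonneg fun i _ => (M.strategies_mem_Icc (ha i) _).1
  -- If every player who switches has a direct strategy compatible with `z`, passing from `a` to `b`
  -- multiplies the reach by the factors `x i` of those players, and a union bound applies.
  -- Otherwise `z` is not reached under `a`, and a drop is impossible.
  by_cases hz : ∀ i, a i = b i ∨ M.Follows (some i) (s i) z.1
  · set c : P → ℝ := fun i => if a i = b i then 1 else x i (M.leafSeq (some i) z) with hc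
    have hc01 : ∀ i, c i ∈ Set.Icc (0 : ℝ) 1 := fun i => by
      simp only [hc]
      split_ifs
      · simp
      · exact M.strategies_mem_Icc (hx i) _
    have hbc : ∏ i, b i (M.leafSeq (some i) z) = (∏ i, a i (M.leafSeq (some i) z)) * ∏ i, c i := by
      rw [← Finset.prod_mul_distrib]
      refine Finset.prod_congr rfl fun i _ => ?_
      simp only [hc]
      split_ifs with hi
      · rw [hi, mul_one]
      · have h1 := (hab i).resolve_left hi
        rw [h1.1, h1.2, hd i, seqForm_leafSeq, if_pos ((hz i).resolve_left hi), one_mul]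
    have hsum : 1 - ∏ i, c i ≤ M.totalLoss d x := by
      refine (one_sub_prod_le_sum_one_sub _ hc01).trans (Finset.sum_le_sum fun i _ => ?_)
      rw [hd i]
      simp only [hc]
      split_ifs with hi
      · rw [sub_self]
        exact M.directLoss_nonneg (s i) (hx i)
      · exact M.one_sub_le_directLoss (hx i) ((hz i).resolve_left hi)
    rw [hbc]
    have := mul_le_mul_of_nonneg_left hsum ha0
    linarith
  · push Not at hz
    obtain ⟨i, hi, hiz⟩ := hz
    have : ∏ i, a i (M.leafSeq (some i) z) = 0 := by
      refine Finset.prod_eq_zero (Finset.mem_univ i) ?_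
      rw [((hab i).resolve_left hi).1, hd i, seqForm_leafSeq, if_neg hiz]
    rw [this]
    linarith

theorem prod_leafSeq_mem_Icc {x : ∀ i : P, M.Seq (some i) → ℝ}
    (hx : ∀ i, x i ∈ M.strategies (some i)) (z : M.Leaf) :
    ∏ i, x i (M.leafSeq (some i) z) ∈ Set.Icc (0 : ℝ) 1 :=
  ⟨Finset.prod_nonneg fun i _ => (M.strategies_mem_Icc (hx i) _).1,
    Finset.prod_le_one (fun i _ => (M.strategies_mem_Icc (hx i) _).1)
      fun i _ => (M.strategies_mem_Icc (hx i) _).2⟩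

/-- At a leaf reached by the direct profile this is a union bound. At any other leaf some player has
left the direct strategy, and that player's loss alone dominates the reach. -/
theorem abs_prod_sub_prod_le (hs : ∀ i, M.IsPure (some i) (s i))
    (hd : ∀ i, d i = M.seqForm (some i) (s i))
    {x : ∀ i : P, M.Seq (some i) → ℝ} (hx : ∀ i, x i ∈ M.strategies (some i)) (z : M.Leaf) :
    |∏ i, x i (M.leafSeq (some i) z) - ∏ i, d i (M.leafSeq (some i) z)| ≤ M.totalLoss d x := by
  classical
  have hx01 := fun i => M.strategies_mem_Icc (hx i) (M.leafSeq (some i) z)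
  obtain ⟨hp0, hp1⟩ := prod_leafSeq_mem_Icc hx z
  by_cases hz : ∀ i, M.Follows (some i) (s i) z.1
  · have hd1 : ∏ i, d i (M.leafSeq (some i) z) = 1 := Finset.prod_eq_one fun i _ => by
      rw [hd i, seqForm_leafSeq, if_pos (hz i)]
    have h1 : 1 - ∏ i, x i (M.leafSeq (some i) z) ≤ M.totalLoss d x :=
      (one_sub_prod_le_sum_one_sub _ hx01).trans (Finset.sum_le_sum fun i _ => by
        rw [hd i]
        exact M.one_sub_le_directLoss (hx i) (hz i))
    rw [hd1, abs_sub_comm, abs_of_nonneg (by linarith)]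
    exact h1
  · push Not at hz
    obtain ⟨i, hi⟩ := hz
    have hd0 : ∏ i, d i (M.leafSeq (some i) z) = 0 :=
      Finset.prod_eq_zero (Finset.mem_univ i) (by rw [hd i, seqForm_leafSeq, if_neg hi])
    rw [hd0, sub_zero, abs_of_nonneg hp0]
    have h1 : ∏ i, x i (M.leafSeq (some i) z) ≤ x i (M.leafSeq (some i) z) := by
      rw [← Finset.mul_prod_erase _ _ (Finset.mem_univ i)]
      exact mul_le_of_le_one_right (hx01 i).1
        (Finset.prod_le_one (fun k _ => (hx01 k).1) fun k _ => (hx01 k).2)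
    have h2 := M.le_directLoss_of_not_follows (hs i) (hx i) hi
    rw [← hd i] at h2
    exact h1.trans (h2.trans (directLoss_le_totalLoss hd hx i))

theorem directnessGap_le {T : ℕ} (hT : 0 < T) {x : ℕ → ∀ i : P, M.Seq (some i) → ℝ} {c : ℕ → ℝ}
    (hc : ∀ t < T, ∀ z : M.Leaf,
      |∏ i, x t i (M.leafSeq (some i) z) - ∏ i, d i (M.leafSeq (some i) z)| ≤ c t) :
    M.directnessGap d T x ≤ M.terminals.card * (1 / (T : ℝ) * ∑ t ∈ Finset.range T, c t) := by
  have hT' : (0 : ℝ) < T := by exact_mod_cast hT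
  have key : ∀ z : M.Leaf, |1 / (T : ℝ) * ∑ t ∈ Finset.range T, ∏ i, x t i (M.leafSeq (some i) z)
      - ∏ i, d i (M.leafSeq (some i) z)| ≤ 1 / (T : ℝ) * ∑ t ∈ Finset.range T, c t := by
    intro z
    have : 1 / (T : ℝ) * ∑ t ∈ Finset.range T, ∏ i, x t i (M.leafSeq (some i) z)
        - ∏ i, d i (M.leafSeq (some i) z) = 1 / (T : ℝ) * ∑ t ∈ Finset.range T,
          (∏ i, x t i (M.leafSeq (some i) z) - ∏ i, d i (M.leafSeq (some i) z)) := by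
      rw [Finset.sum_sub_distrib, Finset.sum_const, Finset.card_range, nsmul_eq_mul]
      field_simp
    rw [this, abs_mul, abs_of_pos (by positivity : 0 < 1 / (T : ℝ))]
    refine mul_le_mul_of_nonneg_left ?_ (by positivity)
    exact (Finset.abs_sum_le_sum_abs _ _).trans
      (Finset.sum_le_sum fun t ht => hc t (Finset.mem_range.1 ht) z)
  refine (Finset.sum_le_sum fun z _ => key z).trans_eq ?_
  rw [Finset.sum_const, nsmul_eq_mul, Finset.card_univ, Fintype.card_coe]

end Loss

/-- The average of the strategies played by the mediator. -/
def avgMediator (M : ExtensiveGame (Option P) A I) (T : ℕ) (μ : ℕ → M.Seq none → ℝ) :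
    M.Seq none → ℝ :=
  ∑ t ∈ Finset.range T, (1 / (T : ℝ)) • μ t

theorem linear_avgMediator {M : ExtensiveGame (Option P) A I}
    (φ : (M.Seq none → ℝ) →ₗ[ℝ] ℝ) (T : ℕ) (μ : ℕ → M.Seq none → ℝ) :
    φ (M.avgMediator T μ) = 1 / (T : ℝ) * ∑ t ∈ Finset.range T, φ (μ t) := by
  simp [avgMediator, Finset.mul_sum]

theorem avgMediator_mem {M : ExtensiveGame (Option P) A I} {T : ℕ} (hT : 0 < T)
    {μ : ℕ → M.Seq none → ℝ}
    (hμ : ∀ t < T, μ t ∈ M.strategies none) : M.avgMediator T μ ∈ M.strategies none := by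
  have hT' : (T : ℝ) ≠ 0 := by exact_mod_cast hT.ne'
  refine (M.convex_strategies none).sum_mem (fun t _ => by positivity) ?_
    fun t ht => hμ t (Finset.mem_range.1 ht)
  simp [hT']

/-! ### Payments, cancellation of regrets and approximate saddle points -/

section Steer

variable [Fintype P] [DecidableEq P] {M : ExtensiveGame (Option P) A I} {s : P → I → A}
  {d : ∀ i : P, M.Seq (some i) → ℝ}

/-- If the sandboxing term is at most `B` in absolute value, then the payment is at most `2 * B`
plus the directness bonus. -/
theorem payment_le {α : ℝ} (hα : 0 ≤ α) (hd : ∀ i, d i ∈ M.strategies (some i)) {i : P}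
    {μ : M.Seq none → ℝ} {x : ∀ i : P, M.Seq (some i) → ℝ}
    (hx : ∀ i, x i ∈ M.strategies (some i)) {B : ℝ}
    (hB : ∀ y ∈ M.strategies (some i), |M.sandbox d i μ x y| ≤ B) :
    M.payment d α i μ x (x i) ≤ α * M.terminals.card + 2 * B := by
  have h1 : ∑ σ, d i σ * x i σ ≤ M.terminals.card := by
    calc ∑ σ, d i σ * x i σ ≤ ∑ _σ : M.Seq (some i), (1 : ℝ) := Finset.sum_le_sum fun σ _ =>
          mul_le_one₀ (M.strategies_mem_Icc (hd i) σ).2 (M.strategies_mem_Icc (hx i) σ).1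
            (M.strategies_mem_Icc (hx i) σ).2
      _ = Fintype.card (M.Seq (some i)) := by simp
      _ ≤ M.terminals.card := by exact_mod_cast M.card_seq_le (some i)
  have h2 : -B ≤ sInf (M.sandbox d i μ x '' M.strategies (some i)) := by
    refine le_csInf ⟨_, x i, hx i, rfl⟩ ?_
    rintro _ ⟨y, hy, rfl⟩
    exact (abs_le.1 (hB y hy)).1
  have h3 := (abs_le.1 (hB (x i) (hx i))).2
  have h4 := mul_le_mul_of_nonneg_left h1 hα
  rw [payment]
  linarith

theorem abs_sandbox_le_one (hd : ∀ i, d i ∈ M.strategies (some i)) {i : P}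
    {μ : M.Seq none → ℝ} (hμ : μ ∈ M.strategies none) {x : ∀ i : P, M.Seq (some i) → ℝ}
    (hx : ∀ i, x i ∈ M.strategies (some i)) {y : M.Seq (some i) → ℝ}
    (hy : y ∈ M.strategies (some i)) : |M.sandbox d i μ x y| ≤ 1 := by
  have h1 := M.util_mem_Icc (some i) hμ (M.update_mem_strategies hd hy)
  have h2 := M.util_mem_Icc (some i) hμ (M.update_mem_strategies hx hy)
  rw [sandbox, abs_le]
  constructor <;> linarith [h1.1, h1.2, h2.1, h2.2]

theorem abs_sandbox_le_totalLoss (hs : ∀ i, M.IsPure (some i) (s i))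
    (hd : ∀ i, d i = M.seqForm (some i) (s i)) {i : P}
    {μ : M.Seq none → ℝ} (hμ : μ ∈ M.strategies none) {x : ∀ i : P, M.Seq (some i) → ℝ}
    (hx : ∀ i, x i ∈ M.strategies (some i)) {y : M.Seq (some i) → ℝ}
    (hy : y ∈ M.strategies (some i)) : |M.sandbox d i μ x y| ≤ M.totalLoss d x := by
  have hdX : ∀ i, d i ∈ M.strategies (some i) := fun i => by
    rw [hd i]
    exact M.seqForm_mem_strategies (hs i)
  refine abs_util_sub_le hd hx (some i) hμ (M.update_mem_strategies hdX hy) fun j => ?_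
  by_cases hj : j = i
  · subst hj
    simp
  · simp [hj]

/-- The sandboxing term replaces the actual opponents by direct ones, and the subtracted minimum
does not depend on the player's own strategy. What remains is the bonus and the gain against direct
opponents. -/
theorem paidUtil_sub_paidUtil (α : ℝ) (i : P) (μ : M.Seq none → ℝ)
    (x : ∀ i : P, M.Seq (some i) → ℝ) (y y' : M.Seq (some i) → ℝ) :
    M.paidUtil d α i μ x y - M.paidUtil d α i μ x y' =
      α * (M.directLoss (some i) (d i) y' - M.directLoss (some i) (d i) y)
        + M.gain d i μ y - M.gain d i μ y' := by
  simp only [paidUtil, payment, sandbox, gain, directLoss_eq]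
  ring

theorem util_avgMediator (j : Option P) (x : ∀ i : P, M.Seq (some i) → ℝ) (T : ℕ)
    (μ : ℕ → M.Seq none → ℝ) :
    M.util j (M.avgMediator T μ) x = 1 / (T : ℝ) * ∑ t ∈ Finset.range T, M.util j (μ t) x := by
  obtain ⟨φ, hφ⟩ := M.exists_linear_util_mediator j x
  simp only [hφ, linear_avgMediator]

theorem gain_avgMediator (i : P) (y : M.Seq (some i) → ℝ) (T : ℕ) (μ : ℕ → M.Seq none → ℝ) :
    M.gain d i (M.avgMediator T μ) y
      = 1 / (T : ℝ) * ∑ t ∈ Finset.range T, M.gain d i (μ t) y := by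
  obtain ⟨φ, hφ⟩ := M.exists_linear_gain d i y
  simp only [hφ, linear_avgMediator]

/-- The regret bounds combined: the average play of online steering is an approximate saddle point
in which the players are approximately direct. -/
theorem IsOnlineSteer.combined {Y : ∀ i : P, Set (M.Seq (some i) → ℝ)} {α lam : ℝ} {T : ℕ}
    {R R₀ : ℝ} {μ : ℕ → M.Seq none → ℝ} {x : ℕ → ∀ i : P, M.Seq (some i) → ℝ}
    (h : M.IsOnlineSteer d Y α lam T R R₀ μ x) (hT : 0 < T) {ν : M.Seq none → ℝ}
    (hν : M.IsEquilibrium d Y ν) {y : ∀ i : P, M.Seq (some i) → ℝ} (hy : ∀ i, y i ∈ Y i) :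
    α * (1 / (T : ℝ) * ∑ t ∈ Finset.range T, M.totalLoss d (x t) - M.totalLoss d y)
      + 1 / lam * (M.util none ν d - M.util none (M.avgMediator T μ) d)
      + ∑ i, M.gain d i (M.avgMediator T μ) (y i) ≤ (R₀ + 4 * Fintype.card P * R) / T := by
  have hT' : (0 : ℝ) < T := by exact_mod_cast hT
  have h1 : ∀ i, ∑ t ∈ Finset.range T,
      (α * (M.directLoss (some i) (d i) (x t i) - M.directLoss (some i) (d i) (y i))
        + M.gain d i (μ t) (y i) - M.gain d i (μ t) (x t i)) ≤ 4 * R := by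
    intro i
    have := h.player_regret i (y i) (hy i)
    rw [← Finset.sum_sub_distrib] at this
    simp only [paidUtil_sub_paidUtil] at this
    linarith
  have h2 := Finset.sum_le_sum fun i (_ : i ∈ Finset.univ) => h1 i
  rw [Finset.sum_comm] at h2
  simp only [Finset.sum_const, Finset.card_univ, nsmul_eq_mul, Finset.sum_add_distrib,
    Finset.sum_sub_distrib, ← Finset.mul_sum] at h2
  have h3 := h.mediator_regret ν hν.1
  -- The realized gains at `μ t` occur with opposite signs in the two kinds of regret and cancel.
  -- Those at `ν` are nonpositive because `ν` is an equilibrium and the players stay in `Y`.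
  have h4 : ∑ t ∈ Finset.range T, ∑ i, M.gain d i ν (x t i) ≤ 0 :=
    Finset.sum_nonpos fun t ht => Finset.sum_nonpos fun i _ =>
      hν.2 i _ (h.player_mem t (Finset.mem_range.1 ht) i)
  simp only [mediatorReward, Finset.sum_sub_distrib, ← Finset.mul_sum, Finset.sum_const,
    Finset.card_range, nsmul_eq_mul] at h3
  have h5 : ∑ t ∈ Finset.range T, ∑ i, M.gain d i (μ t) (y i)
      = T * ∑ i, M.gain d i (M.avgMediator T μ) (y i) := by
    rw [Finset.sum_comm, Finset.mul_sum]
    refine Finset.sum_congr rfl fun i _ => ?_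
    rw [gain_avgMediator]
    field_simp
  have h6 : ∑ t ∈ Finset.range T, M.util none (μ t) d
      = T * M.util none (M.avgMediator T μ) d := by
    rw [util_avgMediator]
    field_simp
  have h7 : (1 : ℝ) / T * ∑ t ∈ Finset.range T, M.totalLoss d (x t)
      = (∑ t ∈ Finset.range T, M.totalLoss d (x t)) / T := by ring
  have e1 : ∀ x : ∀ i : P, M.Seq (some i) → ℝ,
      ∑ i, M.directLoss (some i) (d i) (x i) = M.totalLoss d x := fun x => rfl
  rw [h5] at h2
  rw [h6] at h3
  simp only [e1, Finset.card_range] at h2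
  rw [h7, le_div_iff₀ hT']
  have h8 : (∑ t ∈ Finset.range T, M.totalLoss d (x t)) / T * T
      = ∑ t ∈ Finset.range T, M.totalLoss d (x t) := div_mul_cancel₀ _ hT'.ne'
  generalize M.gain d = q at *
  have e2 : (α * ((∑ t ∈ Finset.range T, M.totalLoss d (x t)) / T - M.totalLoss d y)
      + 1 / lam * (M.util none ν d - M.util none (M.avgMediator T μ) d)
      + ∑ i, q i (M.avgMediator T μ) (y i)) * T
      = α * ((∑ t ∈ Finset.range T, M.totalLoss d (x t)) - T * M.totalLoss d y)
        + (1 / lam * (T * M.util none ν d) - 1 / lam * (T * M.util none (M.avgMediator T μ) d))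
        + T * ∑ i, q i (M.avgMediator T μ) (y i) := by
    linear_combination α * h8
  rw [e2]
  linarith

end Steer

end ExtensiveGame

/-- Here `b ^ 2 / N`, `N / b` and `b ^ 3 / N` are α, λ and ε. The first inequality becomes `b * l ≤
b ^ 2 + w`. In the second, `2 * k ≤ N / b` makes the coefficient of `w` on the right at most 1/2, so
absorption gives `w ≤ b ^ 2 + 4 * k * b ^ 2`. -/
theorem loss_le_of_approximate_saddle {N b k l w : ℝ} (hN : 1 ≤ N) (hb : 0 < b)
    (hkN : 2 * k ≤ N / b) (hl : b ^ 2 / N * l - 1 / (N / b) * w ≤ b ^ 3 / N)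
    (hw : w ≤ k * (b ^ 3 / N + 1 / (N / b) * w + b ^ 2 / N * (2 * N))) :
    l ≤ 6 * max 1 k * b := by
  have hN0 : 0 < N := by linarith
  have hK1 : 1 ≤ max 1 k := le_max_left _ _
  have hKk : k ≤ max 1 k := le_max_right _ _
  set K := max 1 k
  have h1 : b * l ≤ b ^ 2 + w := by
    have h := mul_le_mul_of_nonneg_right hl (div_pos hN0 hb).le
    have e1 : (b ^ 2 / N * l - 1 / (N / b) * w) * (N / b) = b * l - w := by field_simp
    have e2 : b ^ 3 / N * (N / b) = b ^ 2 := by field_simp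
    linarith
  have h2 : 2 * (k * b) ≤ N := by
    rw [le_div_iff₀ hb] at hkN
    linarith
  have h3 : w ≤ b ^ 2 + 4 * K * b ^ 2 := by
    rcases le_or_gt w 0 with h0 | h0
    · have : 0 ≤ b ^ 2 + 4 * K * b ^ 2 := by positivity
      linarith
    · have e1 : k * (b ^ 3 / N + 1 / (N / b) * w + b ^ 2 / N * (2 * N))
          = (k * b) / N * b ^ 2 + (k * b) / N * w + 2 * k * b ^ 2 := by field_simp
      have h4 : (k * b) / N ≤ 1 / 2 := by
        rw [div_le_iff₀ hN0]
        linarith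
      have h5 := mul_le_mul_of_nonneg_right h4 (sq_nonneg b)
      have h6 := mul_le_mul_of_nonneg_right h4 h0.le
      have h7 := mul_le_mul_of_nonneg_right hKk (sq_nonneg b)
      rw [e1] at hw
      linarith
  have h4 : b * l ≤ b * (6 * K * b) := by
    have := mul_le_mul_of_nonneg_right hK1 (sq_nonneg b)
    linarith
  exact le_of_mul_le_mul_left h4 hb

namespace ExtensiveGame

variable {P A I : Type*} [Fintype A]

section Steer

variable [Fintype P] [DecidableEq P] {M : ExtensiveGame (Option P) A I} {s : P → I → A}
  {d : ∀ i : P, M.Seq (some i) → ℝ}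

/-- The penalized suboptimality of the average mediator strategy. -/
theorem IsOnlineSteer.util_avgMediator_sub_le {Y : ∀ i : P, Set (M.Seq (some i) → ℝ)}
    (hd : ∀ i, d i = M.seqForm (some i) (s i))
    (hY : ∀ i, Y i ⊆ M.strategies (some i)) (hdY : ∀ i, d i ∈ Y i) {lamStar : ℝ}
    (hexact : M.IsExactMultiplier d Y lamStar) {α lam D : ℝ} (hα : 0 ≤ α)
    (hD : ∀ x : ∀ i : P, M.Seq (some i) → ℝ, (∀ i, x i ∈ M.strategies (some i)) →
      M.totalLoss d x ≤ D) {T : ℕ} {R R₀ : ℝ} {μ : ℕ → M.Seq none → ℝ}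
    {x : ℕ → ∀ i : P, M.Seq (some i) → ℝ} (h : M.IsOnlineSteer d Y α lam T R R₀ μ x) (hT : 0 < T)
    {ν : M.Seq none → ℝ} (hν : M.IsOptimalEquilibrium d Y ν) :
    M.util none (M.avgMediator T μ) d - M.util none ν d ≤
      lamStar * ((R₀ + 4 * Fintype.card P * R) / T
        + 1 / lam * (M.util none (M.avgMediator T μ) d - M.util none ν d) + α * D) := by
  have hμ := avgMediator_mem hT h.mediator_mem
  -- Exactness is used at `lamStar` itself, not at the algorithm's `lam`: the optimal equilibrium
  -- `ν` is a saddle solution there, so the value at the average strategy is at most that at `ν`.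
  have h1 := ((hexact.2 lamStar le_rfl ν).2 hν).2 _ hμ
  rw [hν.1.sInf_lagrangian hdY hexact.1] at h1
  set B := (R₀ + 4 * Fintype.card P * R) / T
    + 1 / lam * (M.util none (M.avgMediator T μ) d - M.util none ν d) + α * D with hB
  have h2 : M.util none (M.avgMediator T μ) d - lamStar * B
      ≤ sInf (M.lagrangian d lamStar (M.avgMediator T μ) '' Set.univ.pi Y) := by
    refine le_csInf ⟨_, d, fun i _ => hdY i, rfl⟩ ?_
    rintro _ ⟨y, hy, rfl⟩
    have h3 := h.combined hT hν.1 fun i => hy i trivial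
    have h4 : 0 ≤ 1 / (T : ℝ) * ∑ t ∈ Finset.range T, M.totalLoss d (x t) :=
      mul_nonneg (by positivity) (Finset.sum_nonneg fun t ht =>
        totalLoss_nonneg hd fun i => hY i (h.player_mem t (Finset.mem_range.1 ht) i))
    have h5 := mul_le_mul_of_nonneg_left (hD y fun i => hY i (hy i trivial)) hα
    have h6 : ∑ i, M.gain d i (M.avgMediator T μ) (y i) ≤ B := by
      have := mul_nonneg hα h4
      rw [hB]
      linarith
    have h7 := mul_le_mul_of_nonneg_left h6 hexact.1
    rw [lagrangian]
    linarith
  linarith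

/-- The guarantees of online steering, in terms of `b = (N * ε) ^ (1 / 3)`, where `N` is the number
of terminal nodes. -/
theorem IsOnlineSteer.bounds {Y : ∀ i : P, Set (M.Seq (some i) → ℝ)}
    (hs : ∀ i, M.IsPure (some i) (s i)) (hd : ∀ i, d i = M.seqForm (some i) (s i))
    (hY : ∀ i, Y i ⊆ M.strategies (some i)) (hdY : ∀ i, d i ∈ Y i) {lamStar : ℝ}
    (hexact : M.IsExactMultiplier d Y lamStar) {N b : ℝ} (hN : N = M.terminals.card)
    (hb : 0 < b) (hb1 : b ≤ 1)
    (hD : ∀ x : ∀ i : P, M.Seq (some i) → ℝ, (∀ i, x i ∈ M.strategies (some i)) →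
      M.totalLoss d x ≤ 2 * (N - 1)) {T : ℕ} {R R₀ : ℝ} {μ : ℕ → M.Seq none → ℝ}
    {x : ℕ → ∀ i : P, M.Seq (some i) → ℝ}
    (h : M.IsOnlineSteer d Y (b ^ 2 / N) (N / b) T R R₀ μ x) (hT : 0 < T)
    (hε : (R₀ + 4 * Fintype.card P * R) / T = b ^ 3 / N)
    {ν : M.Seq none → ℝ} (hν : M.IsOptimalEquilibrium d Y ν) :
    (∀ i, M.avgPayment d (b ^ 2 / N) T μ x i ≤ 7 * max 1 lamStar * (N * b)) ∧
      M.directnessGap d T x ≤ 7 * max 1 lamStar * (N * b) ∧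
      M.util none ν d - 1 / (T : ℝ) * ∑ t ∈ Finset.range T, M.util none (μ t) (x t)
        ≤ 7 * max 1 lamStar * (N * b) := by
  have hcard : 1 ≤ M.terminals.card := Finset.card_pos.2 M.terminals_nonempty
  have hN1 : 1 ≤ N := by
    rw [hN]
    exact_mod_cast hcard
  have hN0 : 0 < N := by linarith
  have hα : 0 ≤ b ^ 2 / N := by positivity
  have hαN : b ^ 2 / N * N = b ^ 2 := by field_simp
  have hb2 : b ^ 2 ≤ b := by nlinarith
  have hT' : (0 : ℝ) < T := by exact_mod_cast hT
  have havg : ∀ c : ℝ, 1 / (T : ℝ) * ∑ _t ∈ Finset.range T, c = c := fun c => by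
    rw [Finset.sum_const, Finset.card_range, nsmul_eq_mul]
    field_simp
  have hdX : ∀ i, d i ∈ M.strategies (some i) := fun i => hY i (hdY i)
  have hxX : ∀ t < T, ∀ i, x t i ∈ M.strategies (some i) := fun t ht i =>
    hY i (h.player_mem t ht i)
  have hK1 : 1 ≤ max 1 lamStar := le_max_left _ _
  have hKk : lamStar ≤ max 1 lamStar := le_max_right _ _
  have hpay : ∀ i (B : ℕ → ℝ), (∀ t < T, ∀ y ∈ M.strategies (some i),
      |M.sandbox d i (μ t) (x t) y| ≤ B t) → M.avgPayment d (b ^ 2 / N) T μ x i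
        ≤ b ^ 2 + 2 * (1 / (T : ℝ) * ∑ t ∈ Finset.range T, B t) := by
    intro i B hB
    refine (avg_le_avg fun t ht => payment_le hα hdX (hxX t ht) (hB t ht)).trans_eq ?_
    rw [Finset.sum_add_distrib, mul_add, havg, ← Finset.mul_sum, ← hN, hαN]
    ring
  set K := max 1 lamStar with hK
  -- If λ < 2λ^*, then `N ≤ 2 * K * b`, and the claimed bound is at least `7 / 2 * N`. This exceeds
  -- the trivial bounds: 3 for payments, `N` for the directness gap and 1 for the optimality gap.
  rcases lt_or_ge (N / b) (2 * lamStar) with hsmall | hlarge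
  · have h1 : N ≤ 2 * K * b := by
      rw [div_lt_iff₀ hb] at hsmall
      nlinarith
    have h2 : 7 / 2 * N ≤ 7 * K * (N * b) := by nlinarith
    refine ⟨fun i => ?_, ?_, ?_⟩
    · have := hpay i (fun _ => 1) fun t ht y hy =>
        abs_sandbox_le_one hdX (h.mediator_mem t ht) (hxX t ht) hy
      rw [havg] at this
      linarith
    · have := directnessGap_le (d := d) (x := x) hT (c := fun _ => 1) fun t ht z => by
        have h3 := prod_leafSeq_mem_Icc (hxX t ht) z
        have h4 := prod_leafSeq_mem_Icc hdX z
        rw [abs_le]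
        constructor <;> linarith [h3.1, h3.2, h4.1, h4.2]
      rw [havg, ← hN] at this
      linarith
    · have h3 := (M.util_mem_Icc none hν.1.1 hdX).2
      have h4 : 0 ≤ 1 / (T : ℝ) * ∑ t ∈ Finset.range T, M.util none (μ t) (x t) :=
        mul_nonneg (by positivity) (Finset.sum_nonneg fun t ht =>
          (M.util_mem_Icc none (h.mediator_mem t (Finset.mem_range.1 ht))
            (hxX t (Finset.mem_range.1 ht))).1)
      linarith
  set l := 1 / (T : ℝ) * ∑ t ∈ Finset.range T, M.totalLoss d (x t) with hl
  have hl0 : 0 ≤ l := mul_nonneg (by positivity) (Finset.sum_nonneg fun t ht =>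
    totalLoss_nonneg hd (hxX t (Finset.mem_range.1 ht)))
  have hlN : l ≤ 2 * (N - 1) := by
    rw [← havg (2 * (N - 1))]
    exact avg_le_avg fun t ht => hD _ (hxX t ht)
  have hA := h.combined hT hν.1 hdY
  simp only [gain_self, Finset.sum_const_zero, add_zero, totalLoss_self, sub_zero] at hA
  rw [hε, ← hl] at hA
  have hw := h.util_avgMediator_sub_le hd hY hdY hexact hα (D := 2 * N)
    (fun y hy => (hD y hy).trans (by linarith)) hT hν
  rw [hε] at hw
  have hl6 : l ≤ 6 * K * b :=
    loss_le_of_approximate_saddle hN1 hb hlarge (by linarith) hw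
  have hNb : K * b ≤ K * (N * b) := by
    refine mul_le_mul_of_nonneg_left ?_ (by linarith)
    nlinarith
  have hbK : b ≤ K * b := by nlinarith
  refine ⟨fun i => ?_, ?_, ?_⟩
  · have h1 := hpay i (fun t => M.totalLoss d (x t)) fun t ht y hy =>
      abs_sandbox_le_totalLoss hs hd (h.mediator_mem t ht) (hxX t ht) hy
    rw [← hl] at h1
    -- The payment is at most `b ^ 2 + 2 * l`, hence at most `13 * K * b`, which fits under `7 * K *
    -- N * b` once `N ≥ 2`. For a single leaf the bound `2 * (N - 1)` makes the loss vanish.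
    by_cases hN2 : 2 ≤ N
    · have h2 : 2 * (K * b) ≤ K * (N * b) := by
        have := mul_le_mul_of_nonneg_right hN2 (by positivity : 0 ≤ K * b)
        linarith
      linarith
    · have h2 : N = 1 := by
        have h3 : M.terminals.card < 2 := by
          rw [hN] at hN2
          exact_mod_cast not_le.1 hN2
        rw [hN, show M.terminals.card = 1 by omega, Nat.cast_one]
      have hl1 : l ≤ 0 := by
        rw [h2] at hlN
        linarith
      have h3 : 0 ≤ K * (N * b) := by positivity
      linarith
  · have h1 := directnessGap_le (d := d) (x := x) hT (c := fun t => M.totalLoss d (x t)) fun t ht z =>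
      abs_prod_sub_prod_le hs hd (hxX t ht) z
    rw [← hl, ← hN] at h1
    have h2 := mul_le_mul_of_nonneg_left hl6 hN0.le
    have h3 : 0 ≤ K * (N * b) := by positivity
    linarith
  · have h1 : 1 / (T : ℝ) * ∑ t ∈ Finset.range T, M.util none (μ t) d
        ≤ 1 / (T : ℝ) * ∑ t ∈ Finset.range T, (M.util none (μ t) (x t) + M.totalLoss d (x t)) :=
      avg_le_avg fun t ht => by
        have := (abs_le.1 (abs_util_sub_le hd (hxX t ht) none (h.mediator_mem t ht) hdX
          (b := x t) fun i => .inr ⟨rfl, rfl⟩)).2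
        linarith
    rw [Finset.sum_add_distrib, mul_add, ← hl, ← util_avgMediator] at h1
    -- This is the combined inequality at `y = d` with the nonnegative loss dropped. The passage
    -- from direct to actual play costs another `l`, so the total is at most `b + 6 * K * b`.
    have h2 : M.util none ν d - M.util none (M.avgMediator T μ) d ≤ b ^ 2 := by
      have h3 : 0 ≤ b ^ 2 / N * l := mul_nonneg hα hl0
      have h4 : 1 / (N / b) * (M.util none ν d - M.util none (M.avgMediator T μ) d)
          ≤ b ^ 3 / N := by linarith
      have h5 := mul_le_mul_of_nonneg_left h4 (by positivity : 0 ≤ N / b)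
      have e1 : N / b * (1 / (N / b) * (M.util none ν d - M.util none (M.avgMediator T μ) d))
          = M.util none ν d - M.util none (M.avgMediator T μ) d := by field_simp
      have e2 : N / b * (b ^ 3 / N) = b ^ 2 := by field_simp
      rwa [e1, e2] at h5
    linarith

/-- The guarantees of online steering for the hyperparameters that balance them. -/
theorem IsOnlineSteer.guarantees {Y : ∀ i : P, Set (M.Seq (some i) → ℝ)}
    (hs : ∀ i, M.IsPure (some i) (s i)) (hd : ∀ i, d i = M.seqForm (some i) (s i))
    (hY : ∀ i, Y i ⊆ M.strategies (some i)) (hdY : ∀ i, d i ∈ Y i) {lamStar : ℝ}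
    (hexact : M.IsExactMultiplier d Y lamStar)
    (hD : ∀ x : ∀ i : P, M.Seq (some i) → ℝ, (∀ i, x i ∈ M.strategies (some i)) →
      M.totalLoss d x ≤ 2 * ((M.terminals.card : ℝ) - 1)) {T : ℕ} {R R₀ ε α lam : ℝ}
    (hε : ε = (R₀ + 4 * Fintype.card P * R) / T) (hε0 : 0 < ε)
    (hα : α = ε ^ (2 / 3 : ℝ) * (M.terminals.card : ℝ) ^ (-(1 / 3) : ℝ))
    (hlam : lam = (M.terminals.card : ℝ) ^ (2 / 3 : ℝ) * ε ^ (-(1 / 3) : ℝ))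
    (hαN : α ≤ 1 / (M.terminals.card : ℝ)) {μ : ℕ → M.Seq none → ℝ}
    {x : ℕ → ∀ i : P, M.Seq (some i) → ℝ} (h : M.IsOnlineSteer d Y α lam T R R₀ μ x)
    {ν : M.Seq none → ℝ} (hν : M.IsOptimalEquilibrium d Y ν) :
    (∀ i, M.avgPayment d α T μ x i
        ≤ 7 * max 1 lamStar * (M.terminals.card : ℝ) ^ (4 / 3 : ℝ) * ε ^ (1 / 3 : ℝ)) ∧
      M.directnessGap d T x
        ≤ 7 * max 1 lamStar * (M.terminals.card : ℝ) ^ (4 / 3 : ℝ) * ε ^ (1 / 3 : ℝ) ∧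
      M.util none ν d - 1 / (T : ℝ) * ∑ t ∈ Finset.range T, M.util none (μ t) (x t)
        ≤ 7 * max 1 lamStar * (M.terminals.card : ℝ) ^ (4 / 3 : ℝ) * ε ^ (1 / 3 : ℝ) := by
  -- With `T = 0` the quotient defining `ε` would be 0 by the convention for division, contrary to
  -- `ε > 0`.
  have hT : 0 < T := by
    rcases Nat.eq_zero_or_pos T with rfl | hT
    · simp [hε] at hε0
    · exact hT
  set N : ℝ := (M.terminals.card : ℝ) with hN
  have hN0 : 0 < N := by
    rw [hN]
    exact_mod_cast Finset.card_pos.2 M.terminals_nonempty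
  set b : ℝ := N ^ (1 / 3 : ℝ) * ε ^ (1 / 3 : ℝ) with hb
  have hb0 : 0 < b := by positivity
  have hα' : α = b ^ 2 / N := by
    rw [eq_div_iff hN0.ne', hα, hb, mul_pow, ← Real.rpow_natCast, ← Real.rpow_natCast,
      ← Real.rpow_mul hN0.le, ← Real.rpow_mul hε0.le, mul_assoc, ← Real.rpow_add_one hN0.ne']
    norm_num
    ring
  have hlam' : lam = N / b := by
    rw [eq_div_iff hb0.ne', hlam, hb, mul_mul_mul_comm, ← Real.rpow_add hN0, ← Real.rpow_add hε0]
    norm_num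
  have hε' : b ^ 3 / N = ε := by
    rw [div_eq_iff hN0.ne', hb, mul_pow, ← Real.rpow_natCast, ← Real.rpow_natCast,
      ← Real.rpow_mul hN0.le, ← Real.rpow_mul hε0.le]
    norm_num
    ring
  have hNb : N ^ (4 / 3 : ℝ) * ε ^ (1 / 3 : ℝ) = N * b := by
    rw [hb, ← mul_assoc]
    congr 1
    rw [mul_comm, ← Real.rpow_add_one hN0.ne']
    norm_num
  have hb1 : b ≤ 1 := by
    rw [hα', div_le_div_iff_of_pos_right hN0] at hαN
    nlinarith
  rw [mul_assoc, hNb]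
  rw [hα', hlam'] at h
  rw [hα']
  exact h.bounds hs hd hY hdY hexact hN hb0 hb1 hD hT (by rw [hε', hε]) hν

end Steer

end ExtensiveGame

/-! ### Assembly of both parts of the claim -/

theorem mainTheorem10 {n : ℕ} {A I : Type*} [Fintype A] [Nonempty A]
    (G : ExtensiveGame (Fin n) A I) (hG : ∀ i, G.PerfectRecall i)
    (u₀ : List A → ℝ)
    (hu₀ : ∀ h ∈ G.hist, (∀ a, a :: h ∉ G.hist) → u₀ h ∈ Set.Icc (0 : ℝ) 1)
    (M : ExtensiveGame (Option (Fin n)) (A ⊕ A) (List (A ⊕ A) ⊕ (I × Option A × List A)))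
    (hM : M = G.augment u₀ hu₀)
    (s : Fin n → List (A ⊕ A) ⊕ (I × Option A × List A) → A ⊕ A)
    (hs : ∀ i, G.IsDirect u₀ hu₀ i (s i))
    (d : ∀ i, M.Seq (some i) → ℝ) (hd : ∀ i, d i = M.seqForm (some i) (s i))
    (Y : ∀ i, Set (M.Seq (some i) → ℝ))
    (hY : ∀ i, Y i ⊆ M.strategies (some i)) (hdY : ∀ i, d i ∈ Y i) :
    ((∀ i, ∃ F : Set (M.Seq (some i) → ℝ), F.Finite ∧ convexHull ℝ (Y i) = convexHull ℝ F) →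
      ∃ lamStar, M.IsExactMultiplier d Y lamStar) ∧
    ∀ lamStar, M.IsExactMultiplier d Y lamStar →
      ∃ uStar, IsGreatest {v | ∃ μ, M.IsEquilibrium d Y μ ∧ v = M.util none μ d} uStar ∧
        ∀ (R R₀ : ℕ → ℝ) (T : ℕ) (ε α lam : ℝ),
          ε = (R₀ T + 4 * n * R T) / T → 0 < ε →
          α = ε ^ (2 / 3 : ℝ) * (M.terminals.card : ℝ) ^ (-(1 / 3) : ℝ) →
          lam = (M.terminals.card : ℝ) ^ (2 / 3 : ℝ) * ε ^ (-(1 / 3) : ℝ) →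
          α ≤ 1 / (M.terminals.card : ℝ) →
          ∀ (μ : ℕ → M.Seq none → ℝ) (x : ℕ → ∀ i, M.Seq (some i) → ℝ),
            M.IsOnlineSteer d Y α lam T (R T) (R₀ T) μ x →
            (∀ i, M.avgPayment d α T μ x i
              ≤ 7 * max 1 lamStar * (M.terminals.card : ℝ) ^ (4 / 3 : ℝ) * ε ^ (1 / 3 : ℝ)) ∧
            M.directnessGap d T x
              ≤ 7 * max 1 lamStar * (M.terminals.card : ℝ) ^ (4 / 3 : ℝ) * ε ^ (1 / 3 : ℝ) ∧
            uStar - 1 / (T : ℝ) * ∑ t ∈ Finset.range T, M.util none (μ t) (x t)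
              ≤ 7 * max 1 lamStar * (M.terminals.card : ℝ) ^ (4 / 3 : ℝ) * ε ^ (1 / 3 : ℝ) := by
  have hD : ∀ x : ∀ i, M.Seq (some i) → ℝ, (∀ i, x i ∈ M.strategies (some i)) →
      M.totalLoss d x ≤ 2 * ((M.terminals.card : ℝ) - 1) := by
    subst hM
    obtain rfl : d = fun i => (G.augment u₀ hu₀).seqForm (some i) (s i) := funext hd
    exact fun x hx => ExtensiveGame.sum_directLoss_le hs hx
  have hpure : ∀ i, M.IsPure (some i) (s i) := by
    subst hM
    exact fun i => (hs i).1
  -- An equilibrium against all of `X_i` is one against every `Y_i ⊆ X_i`.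
  have hequil : ∃ μ, M.IsEquilibrium d (fun i => M.strategies (some i)) μ := by
    subst hM
    obtain rfl : d = fun i => (G.augment u₀ hu₀).seqForm (some i) (s i) := funext hd
    exact ExtensiveGame.exists_isEquilibrium_augment hG hs
  clear hM hs
  refine ⟨fun hfin => ?_, fun lamStar hexact => ?_⟩
  · obtain ⟨μ, hμ⟩ := hequil
    exact M.exists_isExactMultiplier hY hdY ⟨μ, hμ.1, fun i y hy => hμ.2 i y (hY i hy)⟩ hfin
  -- No polyhedrality is assumed from here on. A saddle solution at `lamStar` always exists, and
  -- exactness turns it into an optimal equilibrium.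
  obtain ⟨ν, hν⟩ := M.exists_isSaddleSolution hY hdY hexact.1
  rw [hexact.2 lamStar le_rfl] at hν
  refine ⟨M.util none ν d, ⟨⟨ν, hν.1, rfl⟩, ?_⟩, ?_⟩
  · rintro _ ⟨κ, hκ, rfl⟩
    exact hν.2 κ hκ
  intro R R₀ T ε α lam hε hε0 hα hlam hαN μ x h
  exact h.guarantees hpure hd hY hdY hexact hD (by rw [hε, Fintype.card_fin]) hε0 hα hlam hαN hν

end
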